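/- Setup. Let $P_\infty\subset S^3$ be a smooth oriented knot and $K_1,\dots,K_m\subset S^3\setminus P_\infty$ ($m\ge 0$) oriented knots with linking numbers $\operatorname{lk}(P_\infty,K_j)>0$, which are the cores of smooth closed solid tori $N_j$ disjoint from $P_\infty$; any two of the $N_j$ are either disjoint or identical (with $K_i=K_j$ in the latter case). Put $L_j=\partial N_j$ and $M=S^3\setminus\bigcup_j\operatorname{int}N_j$. A positively oriented meridian on $L_j$ is one whose linking number with $K_j$ is $+1$. A stable Hamiltonian structure on $M$ is a tuple $\mathcal H=(\xi,X,\omega,J)$ of smooth data: a cooriented plane field $\xi$; a closed $2$-form $\omega$ that is symplectic on $\xi$; a vector field $X$ transverse to $\xi$ with $\omega(X,\cdot)\equiv0$ whose flow preserves $\xi$; a complex structure $J$ on $\xi$ such that $\omega(\cdot,J\cdot)$ is a bundle metric on $\xi$. Let $\lambda$ be the $1$-form with $\ker\lambda=\xi$, $\lambda(X)\equiv1$, and let $\tilde J$ be the almost complex structure on $\mathbb R\times M$ with $\tilde J\partial_a=X$, $\tilde J|_\xi=J$. Let $\mathcal H_k=(\xi_k,X_k,\omega_k,J_k)$, $k\in\mathbb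 N$, be stable Hamiltonian structures on $M$ converging in $C^\infty(M)$ to a stable Hamiltonian structure $\mathcal H_\infty$, such that for every $k\in\mathbb N$: (1) $P_\infty$ is a nondegenerate (simply covered) periodic orbit of $X_k$; (2) every periodic orbit $P\subset M\setminus P_\infty$ of $X_k$ satisfies $\operatorname{lk}(P,P_\infty)\neq0$; (3) $X_k$ is tangent to each $L_j$; (4) there is a trivialization $\Phi_k$ of $\xi_k$ over $M$ for which the Conley–Zehnder index of $P_\infty$ is $3$ and, for every $j$, the line field $TL_j\cap\xi_k$ has winding number $1$ along positively oriented meridians of $L_j$. Let $\mathcal D_1,\dots,\mathcal D_m\subset\mathbb C$ be open round disks with pairwise disjoint closures, $\Sigma=(\mathbb C\cup\{\infty\})\setminus\bigcup_j\mathcal D_j$ with its standard orientation, $\dot\Sigma=\Sigma\setminus\{\infty\}$ and $\gamma_j=\partial\mathcal D_j$, oriented as a component of $\partial\Sigma$. For every $k$ let $j_k$ be a smooth, orientation-compatible complex structure on $\Sigma$ and $\tilde u_k=(a_k,u_k):(\dot\Sigma,j_k)\to(\mathbb R\times M,\tilde J_k)$ an embedded pseudoholomorphic curve of finite energy with $u_k$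 injective, such that: $\tilde u_k$ is positively asymptotic at $\infty$ to $P_\infty$ (that is, in holomorphic coordinates $(s,t)\in[0,\infty)\times\mathbb R/\mathbb Z$ near $\infty$, $u_k(s,\cdot)\to x_k(T_k\,\cdot)$ and $a_k(s,\cdot)/s\to T_k$ in $C^\infty(\mathbb R/\mathbb Z)$ as $s\to\infty$, where $x_k$ parametrizes $P_\infty$ as an orbit of $X_k$ and $T_k>0$ is its minimal period); and, for each $j$, $\tilde u_k(\gamma_j)\subset\{\mathrm{const}\}\times L_j$ (the constant may depend on $j$ and $k$) and the oriented loop $u_k|_{\gamma_j}$ is homotopic in $L_j$ to a negatively oriented meridian. The energy of a curve $\tilde u=(a,u)$ with respect to $(\omega_k,\lambda_k)$ is $$E_k(\tilde u)=\int_{\dot\Sigma}u^*\omega_k+\sup_{\varphi\in\mathcal T}\int_{\dot\Sigma}\tilde u^*(d\varphi\wedge\lambda_k),\qquad \mathcal T=\{\varphi\in C^\infty(\mathbb R,[0,1])\mid\varphi'\ge0\}.$$ Proposition. There exists a constant $C>0$ such that $E_k(\tilde u_k)<C$ for all $k\in\mathbb N$. -/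

import Mathlib

open Set Filter Topology MeasureTheory
open scoped ContDiff ENNReal

noncomputable section

namespace HolCurve

/-! ## Conventions

The three-sphere is the unit sphere of `ℝ⁴`, oriented as the boundary of the ball: tangent vectors
`v₁, v₂, v₃` at `x` form a positive basis iff `det (x, v₁, v₂, v₃) > 0`.

The `3`-manifold `M ⊆ S³` is a compact domain with smooth boundary. A smooth tensor field on `M` is
represented by a smooth field on all of `ℝ⁴`, of which only the values at points of `M`, on vectors
tangent to `S³`, are used. (Every field which is smooth on `M` up to the boundary has such an
extension, by a continuous linear extension operator; exterior derivatives restricted to `T S³` and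
derivatives in directions tangent to `S³` do not depend on it.) -/

/-- The Euclidean space `ℝ⁴`. -/
abbrev E4 : Type := EuclideanSpace ℝ (Fin 4)

/-- The unit sphere `S³ ⊆ ℝ⁴`. -/
def S3 : Set E4 := Metric.sphere 0 1

/-- The tangent space `T_x S³ = x^⊥`. -/
def tangentS3 (x : E4) : Submodule ℝ E4 := (ℝ ∙ x)ᗮ

/-- The determinant of four vectors of `ℝ⁴`. -/
def det4 (v₁ v₂ v₃ v₄ : E4) : ℝ :=
  Matrix.det (Matrix.of ![fun i => v₁ i, fun i => v₂ i, fun i => v₃ i, fun i => v₄ i])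

/-- The point `e^{2π i t}` of the unit circle. -/
def circ (t : ℝ) : ℂ := Complex.exp (2 * Real.pi * t * Complex.I)

/-! ## Knots, linking numbers, solid tori -/

/-- `p` is a `1`-periodic parametrization of a smooth oriented knot in `S³`. -/
structure IsKnot (p : ℝ → E4) : Prop where
  smooth : ContDiff ℝ ∞ p
  mem : ∀ t, p t ∈ S3
  periodic : ∀ t, p (t + 1) = p t
  injective : ∀ s t, p s = p t → ∃ n : ℤ, t = s + n
  immersed : ∀ t, deriv p t ≠ 0

/-- The linking number of two disjoint `1`-periodic smooth loops in `S³`, as the Gauss linking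
integral of the three-sphere
`1/(4π²) ∫∫ ((π - α) cos α + sin α) / sin³ α · det (x, x', y, y')`, where `α` is the angle between
`x` and `y`. It is normalized so that two fibres of the Hopf fibration have linking
number `1`. -/
def linking (x y : ℝ → E4) : ℝ :=
  1 / (4 * Real.pi ^ 2) * ∫ s in (0 : ℝ)..1, ∫ t in (0 : ℝ)..1,
    ((Real.pi - InnerProductGeometry.angle (x s) (y t))
          * Real.cos (InnerProductGeometry.angle (x s) (y t))
        + Real.sin (InnerProductGeometry.angle (x s) (y t)))
      / Real.sin (InnerProductGeometry.angle (x s) (y t)) ^ 3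
      * det4 (x s) (deriv x s) (y t) (deriv y t)

/-- `Ψ` restricts to an orientation preserving smooth embedding of the solid torus
`ℝ/ℤ × (closed unit disk)` into `S³`. -/
structure IsSolidTorus (Ψ : ℝ × ℂ → E4) : Prop where
  smooth : ContDiff ℝ ∞ Ψ
  mem : ∀ s z, ‖z‖ ≤ 1 → Ψ (s, z) ∈ S3
  periodic : ∀ s z, Ψ (s + 1, z) = Ψ (s, z)
  injective : ∀ s s' z z', ‖z‖ ≤ 1 → ‖z'‖ ≤ 1 → Ψ (s, z) = Ψ (s', z') →
    z = z' ∧ ∃ n : ℤ, s' = s + n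
  oriented : ∀ s z, ‖z‖ ≤ 1 →
    0 < det4 (Ψ (s, z)) (fderiv ℝ Ψ (s, z) (1, 0)) (fderiv ℝ Ψ (s, z) (0, 1))
      (fderiv ℝ Ψ (s, z) (0, Complex.I))

/-- The closed solid torus `N` parametrized by `Ψ`. -/
def solid (Ψ : ℝ × ℂ → E4) : Set E4 := Ψ '' {q | ‖q.2‖ ≤ 1}

/-- The interior of the solid torus. -/
def solidInt (Ψ : ℝ × ℂ → E4) : Set E4 := Ψ '' {q | ‖q.2‖ < 1}

/-- The boundary torus `L = ∂N`. -/
def torus (Ψ : ℝ × ℂ → E4) : Set E4 := Ψ '' {q | ‖q.2‖ = 1}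

/-- The tangent space of the torus `L` at the point `Ψ (s, z)`, `‖z‖ = 1`. -/
def tangentTorus (Ψ : ℝ × ℂ → E4) (s : ℝ) (z : ℂ) : Submodule ℝ E4 :=
  Submodule.span ℝ {fderiv ℝ Ψ (s, z) (1, 0), fderiv ℝ Ψ (s, z) (0, Complex.I * z)}

/-- The topological data: an oriented knot `P` (parametrized by `p`) and a link of cores
`K j = Ψ j (· , 0)` of solid tori `N j`, disjoint from `P`, with `lk (P, K j) > 0`. Two of the solid
tori are either disjoint or the same. -/
structure Configuration (m : ℕ) where
  p : ℝ → E4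
  Ψ : Fin m → ℝ × ℂ → E4
  knot : IsKnot p
  solidTorus : ∀ j, IsSolidTorus (Ψ j)
  disjoint : ∀ i j, Ψ i = Ψ j ∨ Disjoint (solid (Ψ i)) (solid (Ψ j))
  disjoint_knot : ∀ j t, p t ∉ solid (Ψ j)
  linking_pos : ∀ j, 0 < linking p (fun t => Ψ j (t, 0))

/-- `M = S³ ∖ int N`. -/
def Configuration.M {m : ℕ} (K : Configuration m) : Set E4 := S3 \ ⋃ j, solidInt (K.Ψ j)

/-! ## Stable Hamiltonian structures -/

/-- The fields of a stable Hamiltonian structure `(ξ, X, ω, J)`. The cooriented plane field `ξ`,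
transverse to `X`, is recorded by the `1`-form `lam` with kernel `ξ` and `lam X = 1`, which
determines and is determined by `ξ` once `X` is given. -/
structure HamData where
  X : E4 → E4
  lam : E4 → E4 →L[ℝ] ℝ
  omega : E4 → E4 [⋀^Fin 2]→L[ℝ] ℝ
  J : E4 → E4 →L[ℝ] E4

/-- The plane `ξ_x = ker λ_x ⊆ T_x S³`. -/
def HamData.xi (H : HamData) (x : E4) : Submodule ℝ E4 :=
  tangentS3 x ⊓ LinearMap.ker (H.lam x).toLinearMap

/-- On the set `I` of times, `x` is an integral curve in `M` of the vector field `X`, and `v` is a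
solution along `x` of the linearized equation, i.e. `v t = dφ^t (v 0)` for the flow `φ` of `X`. -/
def IsLinearizedFlow (M : Set E4) (X : E4 → E4) (I : Set ℝ) (x v : ℝ → E4) : Prop :=
  ∀ t ∈ I, x t ∈ M ∧ HasDerivAt x (X (x t)) t ∧ HasDerivAt v (fderiv ℝ X (x t) (v t)) t

/-- `(ξ, X, ω, J)` is a stable Hamiltonian structure on `M`. -/
structure IsStableHamiltonian (M : Set E4) (H : HamData) : Prop where
  smooth_X : ContDiff ℝ ∞ H.X
  smooth_lam : ContDiff ℝ ∞ H.lam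
  smooth_omega : ContDiff ℝ ∞ H.omega
  smooth_J : ContDiff ℝ ∞ H.J
  tangent : ∀ x ∈ M, H.X x ∈ tangentS3 x
  lam_X : ∀ x ∈ M, H.lam x (H.X x) = 1
  /-- the flow of `X` preserves `ξ` -/
  flow_preserves : ∀ ε > 0, ∀ x v : ℝ → E4, IsLinearizedFlow M H.X (Ioo (-ε) ε) x v →
    v 0 ∈ H.xi (x 0) → ∀ t ∈ Ioo (-ε) ε, v t ∈ H.xi (x t)
  closed : ∀ x ∈ M, ∀ v : Fin 3 → E4, (∀ i, v i ∈ tangentS3 x) → extDeriv H.omega x v = 0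
  omega_X : ∀ x ∈ M, ∀ v ∈ tangentS3 x, H.omega x ![H.X x, v] = 0
  symplectic : ∀ x ∈ M, ∀ v ∈ H.xi x, (∀ w ∈ H.xi x, H.omega x ![v, w] = 0) → v = 0
  J_mem : ∀ x ∈ M, ∀ v ∈ H.xi x, H.J x v ∈ H.xi x
  J_sq : ∀ x ∈ M, ∀ v ∈ H.xi x, H.J x (H.J x v) = -v
  compat_symm : ∀ x ∈ M, ∀ v ∈ H.xi x, ∀ w ∈ H.xi x,
    H.omega x ![v, H.J x w] = H.omega x ![w, H.J x v]
  compat_pos : ∀ x ∈ M, ∀ v ∈ H.xi x, v ≠ 0 → 0 < H.omega x ![v, H.J x v]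

/-- `C^∞(M)`-convergence of a sequence of smooth fields. -/
def ConvergesSmoothlyOn {F : Type*} [NormedAddCommGroup F] [NormedSpace ℝ F] (M : Set E4)
    (f : ℕ → E4 → F) (g : E4 → F) : Prop :=
  ∀ n : ℕ, TendstoUniformlyOn (fun k x => iteratedFDeriv ℝ n (f k) x) (iteratedFDeriv ℝ n g) atTop M

/-- `C^∞(M)`-convergence of stable Hamiltonian structures. -/
structure HamConverges (M : Set E4) (H : ℕ → HamData) (Hlim : HamData) : Prop where
  X : ConvergesSmoothlyOn M (fun k => (H k).X) Hlim.X
  lam : ConvergesSmoothlyOn M (fun k => (H k).lam) Hlim.lam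
  omega : ConvergesSmoothlyOn M (fun k => (H k).omega) Hlim.omega
  J : ConvergesSmoothlyOn M (fun k => (H k).J) Hlim.J

/-! ## Periodic orbits -/

/-- `x` is a periodic orbit of `X` in `M` with (not necessarily minimal) period `T`. -/
structure IsPeriodicOrbit (M : Set E4) (X : E4 → E4) (x : ℝ → E4) (T : ℝ) : Prop where
  period_pos : 0 < T
  mem : ∀ t, x t ∈ M
  deriv : ∀ t, HasDerivAt x (X (x t)) t
  periodic : ∀ t, x (t + T) = x t

/-- The `T`-periodic path `x` runs exactly once, in the positive direction, through the oriented
knot `p`. -/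
def RunsOnceAlong (p x : ℝ → E4) (T : ℝ) : Prop :=
  ∃ θ : ℝ → ℝ, Continuous θ ∧ StrictMono θ ∧ ∀ t, θ (t + T) = θ t + 1 ∧ x t = p (θ t)

/-- The linearized return map on `ξ` does not have the eigenvalue `1`. -/
def IsNondegenerate (M : Set E4) (H : HamData) (x : ℝ → E4) (T : ℝ) : Prop :=
  ∀ v : ℝ → E4, IsLinearizedFlow M H.X univ x v → v 0 ∈ H.xi (x 0) → v T = v 0 → v 0 = 0

/-- A trivialization of the complex line bundle `(ξ, J)` over `M`, given by a nowhere vanishing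
section `e` (the trivialization being `(r + i s) ↦ r e + s J e`). -/
structure IsTrivialization (M : Set E4) (H : HamData) (e : E4 → E4) : Prop where
  smooth : ContDiff ℝ ∞ e
  mem : ∀ x ∈ M, e x ∈ H.xi x
  ne_zero : ∀ x ∈ M, e x ≠ 0

/-- Over the time interval `[0, T]`, the nowhere vanishing section `v` of `ξ` along the path `x`
turns `r` times (total change of angle `2π r`) with respect to the trivialization `e`. -/
def HasRotation (H : HamData) (e : E4 → E4) (x v : ℝ → E4) (T r : ℝ) : Prop :=
  ∃ θ ρ : ℝ → ℝ, ContinuousOn θ (Icc 0 T) ∧ θ T - θ 0 = 2 * Real.pi * r ∧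
    ∀ t ∈ Icc 0 T, 0 < ρ t ∧
      v t = ρ t • (Real.cos (θ t) • e (x t) + Real.sin (θ t) • H.J (x t) (e (x t)))

/-- The nondegenerate `T`-periodic orbit `x` has Conley-Zehnder index `n` with respect to the
trivialization `e`. This is the description through rotation numbers: let `R` be the set of the
rotations, over one period, of nonzero solutions in `ξ` of the linearized equation. The index is
`2k` if the integer `k` is in `R`, and `2k + 1` if `R` lies in the open interval `(k, k + 1)`. -/
def HasCZIndex (M : Set E4) (H : HamData) (e : E4 → E4) (x : ℝ → E4) (T : ℝ) (n : ℤ) : Prop :=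
  (∃ k : ℤ, n = 2 * k ∧ ∃ v : ℝ → E4, IsLinearizedFlow M H.X univ x v ∧ v 0 ∈ H.xi (x 0) ∧
    HasRotation H e x v T k) ∨
  (∃ k : ℤ, n = 2 * k + 1 ∧ ∀ v : ℝ → E4, IsLinearizedFlow M H.X univ x v → v 0 ∈ H.xi (x 0) →
    v 0 ≠ 0 → ∃ r : ℝ, HasRotation H e x v T r ∧ (k : ℝ) < r ∧ r < k + 1)

/-- The line field `T L ∩ ξ` along the positively oriented meridians `t ↦ Ψ (s, e^{2π i t})` of
the torus `L` has winding number `n` with respect to the trivialization `e`. -/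
def MeridianWinding (H : HamData) (e : E4 → E4) (Ψ : ℝ × ℂ → E4) (n : ℤ) : Prop :=
  ∀ s : ℝ, ∃ v : ℝ → E4,
    (∀ t ∈ Icc (0 : ℝ) 1, v t ∈ H.xi (Ψ (s, circ t)) ∧ v t ∈ tangentTorus Ψ s (circ t)) ∧
    HasRotation H e (fun t => Ψ (s, circ t)) v 1 n

/-- The assumptions of the compactness setup on one stable Hamiltonian structure. -/
structure SatisfiesSetup {m : ℕ} (K : Configuration m) (H : HamData) : Prop where
  /-- `P` is a nondegenerate periodic orbit, and there is a global trivialization of `ξ` in which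
  its Conley-Zehnder index is `3` and the characteristic line fields of the tori wind once along
  the positive meridians. -/
  orbit : ∃ (x : ℝ → E4) (T : ℝ) (e : E4 → E4), IsPeriodicOrbit K.M H.X x T ∧
    RunsOnceAlong K.p x T ∧ IsNondegenerate K.M H x T ∧ IsTrivialization K.M H e ∧
    HasCZIndex K.M H e x T 3 ∧ ∀ j, MeridianWinding H e (K.Ψ j) 1
  /-- Every other periodic orbit is linked with `P`. -/
  linked : ∀ (x : ℝ → E4) (T : ℝ), IsPeriodicOrbit K.M H.X x T → (∀ t, x t ∉ range K.p) →
    linking (fun t => x (T * t)) K.p ≠ 0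
  /-- `X` is tangent to each torus. -/
  tangent_torus : ∀ j s z, ‖z‖ = 1 → H.X (K.Ψ j (s, z)) ∈ tangentTorus (K.Ψ j) s z

/-! ## The domain -/

/-- Disjoint round disks in the plane: the disks `𝒟 j` which are removed from
`S² = ℂ ∪ {∞}`. -/
structure Disks (m : ℕ) where
  center : Fin m → ℂ
  radius : Fin m → ℝ
  radius_pos : ∀ j, 0 < radius j
  disjoint : ∀ i j, i ≠ j → Disjoint (Metric.closedBall (center i) (radius i))
    (Metric.closedBall (center j) (radius j))

/-- The punctured surface with boundary `(S² ∖ ⋃ 𝒟 j) ∖ {∞}`. -/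
def Disks.domain {m : ℕ} (D : Disks m) : Set ℂ := (⋃ j, Metric.ball (D.center j) (D.radius j))ᶜ

/-- `j` is a smooth complex structure on `Σ = S² ∖ ⋃ 𝒟 j` (including the point `∞`), compatible
with the orientation of `S²`. Near `∞` smoothness is that of the expression of `j` in the
coordinate `w = 1/z`. -/
structure IsComplexStructure {m : ℕ} (D : Disks m) (j : ℂ → ℂ →L[ℝ] ℂ) : Prop where
  smooth : ContDiff ℝ ∞ j
  sq : ∀ z ∈ D.domain, ∀ v, j z (j z v) = -v
  oriented : ∀ z ∈ D.domain, ∀ v, v ≠ 0 → 0 < ((starRingEnd ℂ) v * j z v).im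
  smooth_infinity : ∃ (j' : ℂ → ℂ →L[ℝ] ℂ) (ρ : ℝ), ContDiff ℝ ∞ j' ∧ 0 < ρ ∧
    ∀ w, w ≠ 0 → ‖w‖ < ρ → ∀ v, j' w v = w ^ 2 * j w⁻¹ (v / w ^ 2)

/-! ## Pseudoholomorphic curves and their energy -/

/-- The `ℝ`-invariant almost complex structure on `ℝ × M` given by `∂_a ↦ X` and by `J` on `ξ`,
at a point over `x`. -/
def HamData.Jtilde (H : HamData) (x : E4) (V : ℝ × E4) : ℝ × E4 :=
  (-(H.lam x V.2), V.1 • H.X x + H.J x (V.2 - H.lam x V.2 • H.X x))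

/-- A complex structure `j` on the domain and a map `(a, u)` to `ℝ × M`. As for the fields on `M`,
smooth maps on the punctured surface are represented by smooth extensions to `ℂ`. -/
structure CurveData where
  j : ℂ → ℂ →L[ℝ] ℂ
  a : ℂ → ℝ
  u : ℂ → E4

/-- The set `𝒯` of smooth nondecreasing functions `ℝ → [0, 1]`. -/
def testFunctions : Set (ℝ → ℝ) :=
  {φ | ContDiff ℝ ∞ φ ∧ (∀ t, φ t ∈ Icc (0 : ℝ) 1) ∧ ∀ t, 0 ≤ deriv φ t}

/-- The `ω`-energy `∫ u^*ω`. The integrand is pointwise nonnegative for pseudoholomorphic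
curves, so that the integral makes sense in `[0, ∞]`. -/
def omegaEnergy {m : ℕ} (D : Disks m) (H : HamData) (c : CurveData) : ℝ≥0∞ :=
  ∫⁻ z in D.domain, ENNReal.ofReal
    (H.omega (c.u z) ![fderiv ℝ c.u z 1, fderiv ℝ c.u z Complex.I])

/-- The `λ`-energy `sup_φ ∫ (a, u)^*(dφ ∧ λ)`, again with a nonnegative integrand for
pseudoholomorphic curves. -/
def lamEnergy {m : ℕ} (D : Disks m) (H : HamData) (c : CurveData) : ℝ≥0∞ :=
  ⨆ φ ∈ testFunctions, ∫⁻ z in D.domain, ENNReal.ofReal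
    (deriv φ (c.a z) *
      (fderiv ℝ c.a z 1 * H.lam (c.u z) (fderiv ℝ c.u z Complex.I)
        - fderiv ℝ c.a z Complex.I * H.lam (c.u z) (fderiv ℝ c.u z 1)))

/-- The energy of a curve with respect to `(ω, λ)`. -/
def energy {m : ℕ} (D : Disks m) (H : HamData) (c : CurveData) : ℝ≥0∞ :=
  omegaEnergy D H c + lamEnergy D H c

/-- `ψ` is a parametrization of a closed punctured neighbourhood of `∞` in `(Σ, j)` by the
half-cylinder `[0, ∞) × ℝ/ℤ`: it is written as a function of `s + i t`, and is holomorphic and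
injective for `s ≥ 0`, with `s → ∞` corresponding to the puncture. -/
structure IsCylindricalEnd {m : ℕ} (D : Disks m) (j : ℂ → ℂ →L[ℝ] ℂ) (ψ : ℂ → ℂ) : Prop where
  smooth : ContDiff ℝ ∞ ψ
  periodic : ∀ ζ, ψ (ζ + Complex.I) = ψ ζ
  mem : ∀ ζ, 0 ≤ ζ.re → ψ ζ ∈ D.domain
  injective : ∀ ζ ζ', 0 ≤ ζ.re → 0 ≤ ζ'.re → ψ ζ = ψ ζ' → ∃ n : ℤ, ζ' = ζ + n * Complex.I
  holomorphic : ∀ ζ, 0 ≤ ζ.re → ∀ v, fderiv ℝ ψ ζ (Complex.I * v) = j (ψ ζ) (fderiv ℝ ψ ζ v)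
  tendsto : ∀ R : ℝ, ∃ S : ℝ, ∀ ζ, S ≤ ζ.re → R ≤ ‖ψ ζ‖
  surjective : ∃ R : ℝ, ∀ z, R ≤ ‖z‖ → ∃ ζ, 0 ≤ ζ.re ∧ ψ ζ = z

/-- The curve is positively asymptotic at `∞` to the simply covered orbit `P` (of period `T`): in
cylindrical holomorphic coordinates `s + i t` at the puncture, as `s → ∞`,
`u(s, ·) → x(T ·)` and `a(s, ·)/s → T` in `C^∞(S¹)`, where `x` parametrizes `P` by the flow. -/
def PositivelyAsymptotic {m : ℕ} (K : Configuration m) (D : Disks m) (H : HamData)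
    (c : CurveData) : Prop :=
  ∃ (ψ : ℂ → ℂ) (x : ℝ → E4) (T : ℝ), IsCylindricalEnd D c.j ψ ∧
    IsPeriodicOrbit K.M H.X x T ∧ RunsOnceAlong K.p x T ∧
    (∀ n : ℕ, TendstoUniformly
      (fun s t : ℝ => iteratedDeriv n (fun τ : ℝ => c.u (ψ (s + τ * Complex.I))) t)
      (iteratedDeriv n (fun τ : ℝ => x (T * τ))) atTop) ∧
    (∀ n : ℕ, TendstoUniformly
      (fun s t : ℝ => iteratedDeriv n (fun τ : ℝ => c.a (ψ (s + τ * Complex.I)) / s) t)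
      (iteratedDeriv n (fun _ : ℝ => T)) atTop)

/-- The curves of the compactness setup. -/
structure IsSetupCurve {m : ℕ} (K : Configuration m) (D : Disks m) (H : HamData)
    (c : CurveData) : Prop where
  complexStructure : IsComplexStructure D c.j
  smooth_a : ContDiff ℝ ∞ c.a
  smooth_u : ContDiff ℝ ∞ c.u
  mem : ∀ z ∈ D.domain, c.u z ∈ K.M
  holomorphic : ∀ z ∈ D.domain, ∀ v : ℂ,
    (fderiv ℝ c.a z (c.j z v), fderiv ℝ c.u z (c.j z v))
      = H.Jtilde (c.u z) (fderiv ℝ c.a z v, fderiv ℝ c.u z v)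
  /-- `(a, u)` is an embedding. -/
  isEmbedding : IsEmbedding (fun z : D.domain => (c.a z, c.u z))
  immersed : ∀ z ∈ D.domain, ∀ v : ℂ, v ≠ 0 → (fderiv ℝ c.a z v, fderiv ℝ c.u z v) ≠ 0
  /-- `u` itself is injective. -/
  injOn : InjOn c.u D.domain
  finite_energy : energy D H c < ⊤
  asymptotic : PositivelyAsymptotic K D H c
  /-- The `j`-th boundary circle is mapped to `{const} × L j`. -/
  boundary : ∀ j, ∃ σ : ℝ, ∀ z ∈ Metric.sphere (D.center j) (D.radius j),
    c.a z = σ ∧ c.u z ∈ torus (K.Ψ j)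
  /-- The image under `u` of the `j`-th boundary circle, oriented as part of `∂Σ` (i.e. clockwise
  around the disk), is homotopic along `L j` to a negatively oriented meridian. -/
  meridian : ∀ j, ∃ h : ℝ × ℝ → E4, ContinuousOn h (Icc 0 1 ×ˢ univ) ∧
    (∀ r ∈ Icc (0 : ℝ) 1, ∀ t, h (r, t) ∈ torus (K.Ψ j) ∧ h (r, t + 1) = h (r, t)) ∧
    (∀ t, h (0, t) = c.u (D.center j + D.radius j * circ (-t))) ∧
    (∀ t, h (1, t) = K.Ψ j (0, circ (-t)))

end HolCurve

end

set_option linter.unusedSectionVars false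
set_option autoImplicit false

noncomputable section

namespace HolCurve

/-! Both parts of the energy come from Stokes' theorem on an exhaustion of the punctured surface
(`exists_truncations`). The contributions of the end and of the boundary circles then have to be
bounded uniformly in the sequence.

For the `ω`-energy one needs a primitive `α` of `ω` that is controlled along the knot and integrates
to zero over the boundary circles. Since `X` spans the kernel of `ω` and is tangent to each torus
`L`, the form `ω` vanishes on `TL`. Pushing a collar of `L` onto `L` therefore pulls `ω` back to a
closed form that is zero near `L`; it extends by zero over the solid tori and, through the radial
projection, to `ℝ⁴ ∖ 0`. On `M` the extension differs from `ω` by the differential of a homotopy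
form, and this form vanishes on the tori and on the knot because the isotopy fixes them. The
complement of a closed ray from the origin is star-shaped, so the Poincaré lemma gives a primitive
of the extension there. Near a solid torus away from the ray this primitive is closed, and the
boundary circles, being homotopic to meridians, are contractible in the solid torus, so the
integrals over them vanish. The cones over countably many surfaces and over the knot have Hausdorff
dimension at most three, hence a single ray avoids all curves at once and the constants do not
depend on the curve (`exists_toricPrimitives`).

For the `λ`-energy, `d(φ(a) u^*λ) = φ'(a) da ∧ u^*λ + φ(a) u^*dλ`. Invariance of `ξ` under the flow
gives `ι_X dλ = 0` (`IsStableHamiltonian.dOne_lam_X`), so `u^*dλ` only sees the part of `du` in `ξ`,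
and compactness bounds it by a multiple of `u^*ω` (`IsSetupCurve.omega_density`). On a boundary
circle `a` is constant, so `φ(a)` factors out and the integral of `λ` over a loop homotopic to a
meridian remains. Since `λ` is closed on `L`, that integral depends only on the homotopy class and
is bounded by the length of a meridian (`exists_bound_lam_loop`).

At the puncture the boundary integral is bounded through the length of the orbit, which the knot
bounds whatever the period and the time parametrization (`RunsOnceAlong.integral_norm_deriv_le`).
Convergence of the structures makes all constants uniform from some index on
(`HamConverges.eventually_hasBounds`), and the finitely many remaining energies are finite by
assumption. `IsSetupCurve.energy_le` assembles the estimate. -/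

section

/-! ## Parametric integrals and the homotopy formula -/

section Parametric

variable {E G : Type*} [NormedAddCommGroup E] [NormedSpace ℝ E] [NormedAddCommGroup G]
  [NormedSpace ℝ G]

/-- The points `x` whose segment `[0, 1] × {x}` lies in `W`. -/
def segmentCore (W : Set (ℝ × E)) : Set E := {x | ∀ t ∈ Icc (0 : ℝ) 1, (t, x) ∈ W}

theorem isOpen_segmentCore {W : Set (ℝ × E)} (hW : IsOpen W) : IsOpen (segmentCore W) := by
  rw [isOpen_iff_mem_nhds]
  intro x hx
  refine (isCompact_Icc (a := (0 : ℝ)) (b := 1)).eventually_forall_of_forall_eventually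
    (P := fun x t => (t, x) ∈ W) fun t ht => ?_
  have : Tendsto (fun z : E × ℝ => (z.2, z.1)) (𝓝 (x, t)) (𝓝 (t, x)) :=
    (continuous_snd.prodMk continuous_fst).tendsto _
  exact this.eventually (hW.mem_nhds (hx t ht))

/-- Compactness of `[0, 1]` makes the bound on one segment persist for nearby segments. This
supplies the dominating constant for continuity and differentiation under the integral. -/
theorem eventually_segment_norm_le {g : ℝ × E → G} {W : Set (ℝ × E)} (hW : IsOpen W)
    (hg : ContinuousOn g W) {x : E} (hx : x ∈ segmentCore W) :
    ∃ C : ℝ, ∀ᶠ y in 𝓝 x, ∀ t ∈ Icc (0 : ℝ) 1, ‖g (t, y)‖ ≤ C := by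
  have hc : ContinuousOn (fun t : ℝ => g (t, x)) (Icc 0 1) :=
    hg.comp (by fun_prop) fun t ht => hx t ht
  obtain ⟨C, hC⟩ := isCompact_Icc.exists_bound_of_continuousOn hc
  refine ⟨C + 1, (isCompact_Icc (a := (0 : ℝ)) (b := 1)).eventually_forall_of_forall_eventually
    (P := fun y t => ‖g (t, y)‖ ≤ C + 1) fun t ht => ?_⟩
  have h1 : Tendsto (fun z : E × ℝ => (z.2, z.1)) (𝓝 (x, t)) (𝓝 (t, x)) :=
    (continuous_snd.prodMk continuous_fst).tendsto _
  have h2 := ((hg.continuousAt (hW.mem_nhds (hx t ht))).tendsto.comp h1).norm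
  exact (h2.eventually (gt_mem_nhds ((hC t ht).trans_lt (lt_add_one C)))).mono
    fun z hz => le_of_lt hz

theorem continuousOn_segment {g : ℝ × E → G} {W : Set (ℝ × E)}
    (hg : ContinuousOn g W) {x : E} (hx : x ∈ segmentCore W) :
    ContinuousOn (fun t : ℝ => g (t, x)) (uIcc 0 1) := by
  rw [uIcc_of_le zero_le_one]
  exact hg.comp (by fun_prop) fun t ht => hx t ht

theorem aestronglyMeasurable_segment {g : ℝ × E → G} {W : Set (ℝ × E)}
    (hg : ContinuousOn g W) {x : E} (hx : x ∈ segmentCore W) :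
    AEStronglyMeasurable (fun t : ℝ => g (t, x)) (volume.restrict (uIoc (0 : ℝ) 1)) :=
  ((continuousOn_segment hg hx).mono uIoc_subset_uIcc).aestronglyMeasurable measurableSet_uIoc

theorem continuousOn_integral_segment {g : ℝ × E → G} {W : Set (ℝ × E)} (hW : IsOpen W)
    (hg : ContinuousOn g W) :
    ContinuousOn (fun x => ∫ t in (0 : ℝ)..1, g (t, x)) (segmentCore W) := by
  intro x hx
  refine ContinuousAt.continuousWithinAt ?_
  obtain ⟨C, hC⟩ := eventually_segment_norm_le hW hg hx
  refine intervalIntegral.continuousAt_of_dominated_interval (bound := fun _ => C) ?_ ?_ ?_ ?_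
  · filter_upwards [(isOpen_segmentCore hW).mem_nhds hx] with y hy
    exact aestronglyMeasurable_segment hg hy
  · filter_upwards [hC] with y hy
    refine Eventually.of_forall fun t ht => hy t ?_
    rw [uIoc_of_le zero_le_one] at ht
    exact Ioc_subset_Icc_self ht
  · exact intervalIntegrable_const
  · refine Eventually.of_forall fun t ht => ?_
    rw [uIoc_of_le zero_le_one] at ht
    have := hg.continuousAt (hW.mem_nhds (hx t (Ioc_subset_Icc_self ht)))
    exact ContinuousAt.comp (f := fun y : E => (t, y)) this (by fun_prop)

theorem hasFDerivAt_integral_segment {g : ℝ × E → G} {W : Set (ℝ × E)} (hW : IsOpen W)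
    (hg : ContDiffOn ℝ 1 g W) {x : E} (hx : x ∈ segmentCore W) :
    HasFDerivAt (fun x => ∫ t in (0 : ℝ)..1, g (t, x))
      (∫ t in (0 : ℝ)..1, (fderiv ℝ g (t, x)).comp (ContinuousLinearMap.inr ℝ ℝ E)) x := by
  have hg' : ContinuousOn (fun p => (fderiv ℝ g p).comp (ContinuousLinearMap.inr ℝ ℝ E)) W :=
    (hg.continuousOn_fderiv_of_isOpen hW le_rfl).clm_comp continuousOn_const
  obtain ⟨C, hC⟩ := eventually_segment_norm_le hW hg' hx
  have hs := hC.and ((isOpen_segmentCore hW).mem_nhds hx)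
  refine intervalIntegral.hasFDerivAt_integral_of_dominated_of_fderiv_le
    (F := fun x t => g (t, x))
    (F' := fun x t => (fderiv ℝ g (t, x)).comp (ContinuousLinearMap.inr ℝ ℝ E))
    (bound := fun _ => C) hs ?_ ?_ ?_ ?_ ?_ ?_
  · filter_upwards [(isOpen_segmentCore hW).mem_nhds hx] with y hy
    exact aestronglyMeasurable_segment hg.continuousOn hy
  · exact (continuousOn_segment hg.continuousOn hx).intervalIntegrable
  · exact aestronglyMeasurable_segment hg' hx
  · refine Eventually.of_forall fun t ht y hy => hy.1 t ?_
    rw [uIoc_of_le zero_le_one] at ht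
    exact Ioc_subset_Icc_self ht
  · exact intervalIntegrable_const
  · refine Eventually.of_forall fun t ht y hy => ?_
    rw [uIoc_of_le zero_le_one] at ht
    have h1 : HasFDerivAt g (fderiv ℝ g (t, y)) (t, y) :=
      ((hg.contDiffAt (hW.mem_nhds (hy.2 t (Ioc_subset_Icc_self ht)))).differentiableAt
        one_ne_zero).hasFDerivAt
    have h2 : HasFDerivAt (fun y : E => (t, y)) (ContinuousLinearMap.inr ℝ ℝ E) y :=
      hasFDerivAt_prodMk_right t y
    exact h1.comp y h2

theorem contDiffOn_integral_segment {g : ℝ × E → G} {W : Set (ℝ × E)} (hW : IsOpen W)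
    (hg : ContDiffOn ℝ 1 g W) :
    ContDiffOn ℝ 1 (fun x => ∫ t in (0 : ℝ)..1, g (t, x)) (segmentCore W) := by
  have hg' : ContinuousOn (fun p => (fderiv ℝ g p).comp (ContinuousLinearMap.inr ℝ ℝ E)) W :=
    (hg.continuousOn_fderiv_of_isOpen hW le_rfl).clm_comp continuousOn_const
  have h0 := isOpen_segmentCore hW
  rw [show (1 : WithTop ℕ∞) = 0 + 1 from rfl, contDiffOn_succ_iff_fderiv_of_isOpen h0]
  refine ⟨fun x hx => (hasFDerivAt_integral_segment hW hg hx).differentiableAt.differentiableWithinAt,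
    by simp, contDiffOn_zero.2 ?_⟩
  exact (continuousOn_integral_segment hW hg').congr fun x hx =>
    (hasFDerivAt_integral_segment hW hg hx).fderiv

end Parametric

/-- The exterior derivative of a `1`-form. -/
def dOne {E : Type*} [NormedAddCommGroup E] [NormedSpace ℝ E] (a : E → E →L[ℝ] ℝ) (x v w : E) :
    ℝ := fderiv ℝ a x v w - fderiv ℝ a x w v

section Homotopy

variable {E : Type*} [NormedAddCommGroup E] [NormedSpace ℝ E] [FiniteDimensional ℝ E]

theorem vecTwo_add {V : Type*} [NormedAddCommGroup V] [NormedSpace ℝ V]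
    (b : V [⋀^Fin 2]→L[ℝ] ℝ) (u v w : V) : b ![u, v + w] = b ![u, v] + b ![u, w] := by
  have := b.map_update_add ![u, 0] 1 v w
  have e (z : V) : Function.update ![u, 0] 1 z = ![u, z] := by
    ext i; fin_cases i <;> simp
  simpa only [e] using this

theorem vecTwo_smul {V : Type*} [NormedAddCommGroup V] [NormedSpace ℝ V]
    (b : V [⋀^Fin 2]→L[ℝ] ℝ) (u : V) (c : ℝ) (v : V) : b ![u, c • v] = c * b ![u, v] := by
  have := b.map_update_smul ![u, 0] 1 c v
  have e (z : V) : Function.update ![u, 0] 1 z = ![u, z] := by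
    ext i; fin_cases i <;> simp
  simpa only [e, smul_eq_mul] using this

theorem vecTwo_swap {V : Type*} [NormedAddCommGroup V] [NormedSpace ℝ V]
    (b : V [⋀^Fin 2]→L[ℝ] ℝ) (u v : V) : b ![u, v] = - b ![v, u] := by
  have := b.toAlternatingMap.map_swap ![v, u] (i := 0) (j := 1) (by simp)
  have e : ![v, u] ∘ (Equiv.swap (0 : Fin 2) 1) = ![u, v] := by
    ext i; fin_cases i <;> simp
  rw [e] at this
  exact this

/-- The coefficient `b (∂_t, v)` of a `2`-form on `ℝ × E`. -/
def timeCoeff (b : ℝ × E → (ℝ × E) [⋀^Fin 2]→L[ℝ] ℝ) (v : E) (p : ℝ × E) : ℝ :=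
  b p ![(1, 0), (0, v)]

theorem contDiffOn_apply_const {V E' : Type*} [NormedAddCommGroup V] [NormedSpace ℝ V]
    [NormedAddCommGroup E'] [NormedSpace ℝ E'] {n : WithTop ℕ∞} {k : ℕ}
    {b : E' → V [⋀^Fin k]→L[ℝ] ℝ} {W : Set E'}
    (hb : ContDiffOn ℝ n b W) (v : Fin k → V) : ContDiffOn ℝ n (fun p => b p v) W :=
  (ContinuousLinearMap.contDiff (ContinuousAlternatingMap.apply ℝ V ℝ v)).comp_contDiffOn hb

/-- The homotopy operator `b ↦ ∫₀¹ ι_{∂_t} b dt`. -/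
def homotopyForm (b : ℝ × E → (ℝ × E) [⋀^Fin 2]→L[ℝ] ℝ) (W : Set (ℝ × E)) (x : E) : E →L[ℝ] ℝ :=
  open Classical in
  -- Additivity in `v` needs integrability along the segment, which these two conditions guarantee;
  -- elsewhere the value 0 is a convention.
  if h : x ∈ segmentCore W ∧ ContinuousOn b W then
    LinearMap.toContinuousLinearMap
      { toFun := fun v => ∫ t in (0 : ℝ)..1, timeCoeff b v (t, x)
        map_add' := fun v w => by
          rw [← intervalIntegral.integral_add]
          · refine intervalIntegral.integral_congr fun t _ => ?_
            have : ((0 : ℝ), v + w) = (0, v) + (0, w) := by simp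
            simp only [timeCoeff, this, vecTwo_add]
          all_goals
            exact (continuousOn_segment (contDiffOn_zero.1
              (contDiffOn_apply_const (contDiffOn_zero.2 h.2) _)) h.1).intervalIntegrable
        map_smul' := fun c v => by
          rw [RingHom.id_apply, smul_eq_mul, ← intervalIntegral.integral_const_mul]
          refine intervalIntegral.integral_congr fun t _ => ?_
          have : ((0 : ℝ), c • v) = c • (0, v) := by simp
          simp only [timeCoeff, this, vecTwo_smul] }
  else 0

theorem homotopyForm_apply {b : ℝ × E → (ℝ × E) [⋀^Fin 2]→L[ℝ] ℝ} {W : Set (ℝ × E)}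
    (hb : ContinuousOn b W) {x : E} (hx : x ∈ segmentCore W) (v : E) :
    homotopyForm b W x v = ∫ t in (0 : ℝ)..1, timeCoeff b v (t, x) := by
  rw [homotopyForm, dif_pos ⟨hx, hb⟩]; rfl

theorem contDiffOn_timeCoeff {b : ℝ × E → (ℝ × E) [⋀^Fin 2]→L[ℝ] ℝ} {W : Set (ℝ × E)}
    {n : WithTop ℕ∞} (hb : ContDiffOn ℝ n b W) (v : E) : ContDiffOn ℝ n (timeCoeff b v) W :=
  contDiffOn_apply_const hb _

theorem contDiffOn_homotopyForm {b : ℝ × E → (ℝ × E) [⋀^Fin 2]→L[ℝ] ℝ} {W : Set (ℝ × E)}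
    (hW : IsOpen W) (hb : ContDiffOn ℝ 1 b W) :
    ContDiffOn ℝ 1 (homotopyForm b W) (segmentCore W) := by
  rw [contDiffOn_clm_apply]
  intro v
  exact (contDiffOn_integral_segment hW (contDiffOn_timeCoeff hb v)).congr fun x hx =>
    homotopyForm_apply hb.continuousOn hx v

theorem fderiv_clm_apply_const {V E' F : Type*} [NormedAddCommGroup V] [NormedSpace ℝ V]
    [NormedAddCommGroup E'] [NormedSpace ℝ E'] [NormedAddCommGroup F] [NormedSpace ℝ F]
    {a : E' → V →L[ℝ] F} {x : E'} (ha : DifferentiableAt ℝ a x) (v : E') (w : V) :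
    fderiv ℝ a x v w = fderiv ℝ (fun y => a y w) x v := by
  rw [fderiv_clm_apply ha (differentiableAt_const w)]
  simp

theorem extDeriv_two_apply {V : Type*} [NormedAddCommGroup V] [NormedSpace ℝ V]
    {b : V → V [⋀^Fin 2]→L[ℝ] ℝ} {x : V} (hb : DifferentiableAt ℝ b x) (u v w : V) :
    extDeriv b x ![u, v, w] = fderiv ℝ (fun y => b y ![v, w]) x u
      - fderiv ℝ (fun y => b y ![u, w]) x v + fderiv ℝ (fun y => b y ![u, v]) x w := by
  have h0 : (0 : Fin 3).removeNth ![u, v, w] = ![v, w] := by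
    ext i; fin_cases i <;> rfl
  have h1 : (1 : Fin 3).removeNth ![u, v, w] = ![u, w] := by
    ext i; fin_cases i <;> rfl
  have h2 : (2 : Fin 3).removeNth ![u, v, w] = ![u, v] := by
    ext i; fin_cases i <;> rfl
  rw [extDeriv_apply hb, Fin.sum_univ_three, h0, h1, h2]
  simp
  ring

/-- The homotopy formula: if `ι_{∂_t} db = 0` along `[0, 1] × {x}`, then
`d (∫₀¹ ι_{∂_t} b dt) = b|_{t = 1} - b|_{t = 0}`. -/
theorem dOne_homotopyForm {b : ℝ × E → (ℝ × E) [⋀^Fin 2]→L[ℝ] ℝ} {W : Set (ℝ × E)}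
    (hW : IsOpen W) (hb : ContDiffOn ℝ 1 b W) {x : E} (hx : x ∈ segmentCore W) (v w : E)
    (hclosed : ∀ t ∈ Icc (0 : ℝ) 1, extDeriv b (t, x) ![(1, 0), (0, v), (0, w)] = 0) :
    dOne (homotopyForm b W) x v w = b (1, x) ![(0, v), (0, w)] - b (0, x) ![(0, v), (0, w)] := by
  have hd : DifferentiableAt ℝ (homotopyForm b W) x :=
    ((contDiffOn_homotopyForm hW hb).contDiffAt
      ((isOpen_segmentCore hW).mem_nhds hx)).differentiableAt one_ne_zero
  have key (v w : E) : fderiv ℝ (homotopyForm b W) x v w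
      = ∫ t in (0 : ℝ)..1, fderiv ℝ (timeCoeff b w) (t, x) (0, v) := by
    rw [fderiv_clm_apply_const hd]
    have h1 := hasFDerivAt_integral_segment hW (contDiffOn_timeCoeff hb w) hx
    have h2 : (fun y => homotopyForm b W y w)
        =ᶠ[𝓝 x] fun y => ∫ t in (0 : ℝ)..1, timeCoeff b w (t, y) := by
      filter_upwards [(isOpen_segmentCore hW).mem_nhds hx] with y hy
      exact homotopyForm_apply hb.continuousOn hy w
    rw [h2.fderiv_eq, h1.fderiv, ContinuousLinearMap.intervalIntegral_apply]
    · simp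
    · have hc : ContinuousOn (fun p => (fderiv ℝ (timeCoeff b w) p).comp
          (ContinuousLinearMap.inr ℝ ℝ E)) W :=
        ((contDiffOn_timeCoeff hb w).continuousOn_fderiv_of_isOpen hW le_rfl).clm_comp
          continuousOn_const
      exact (continuousOn_segment hc hx).intervalIntegrable
  have hcont (v w : E) : IntervalIntegrable (fun t => fderiv ℝ (timeCoeff b w) (t, x) (0, v))
      volume 0 1 :=
    (continuousOn_segment (((contDiffOn_timeCoeff hb w).continuousOn_fderiv_of_isOpen hW
        le_rfl).clm_apply continuousOn_const) hx).intervalIntegrable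
  have hbvw := contDiffOn_apply_const hb ![((0 : ℝ), v), (0, w)]
  rw [dOne, key, key, ← intervalIntegral.integral_sub (hcont _ _) (hcont _ _)]
  -- Closedness turns the antisymmetrized `E`-derivatives of `ι_{∂_t} b` into the `t`-derivative of
  -- `b (v, w)`, which the fundamental theorem of calculus integrates.
  have hftc := intervalIntegral.integral_eq_sub_of_hasDerivAt (a := 0) (b := 1)
    (f := fun t : ℝ => b (t, x) ![(0, v), (0, w)])
    (f' := fun t : ℝ => fderiv ℝ (fun p => b p ![(0, v), (0, w)]) (t, x) (1, 0)) ?_ ?_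
  · rw [← hftc]
    refine intervalIntegral.integral_congr fun t ht => ?_
    rw [uIcc_of_le zero_le_one] at ht
    have hbd : DifferentiableAt ℝ b (t, x) :=
      (hb.contDiffAt (hW.mem_nhds (hx t ht))).differentiableAt one_ne_zero
    have := hclosed t ht
    rw [extDeriv_two_apply hbd] at this
    change fderiv ℝ (fun p => b p ![(1, 0), (0, w)]) (t, x) (0, v)
      - fderiv ℝ (fun p => b p ![(1, 0), (0, v)]) (t, x) (0, w) = _
    linarith
  · intro t ht
    rw [uIcc_of_le zero_le_one] at ht
    have h1 : HasFDerivAt (fun p => b p ![((0 : ℝ), v), (0, w)])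
        (fderiv ℝ (fun p => b p ![((0 : ℝ), v), (0, w)]) (t, x)) (t, x) :=
      ((hbvw.contDiffAt (hW.mem_nhds (hx t ht))).differentiableAt one_ne_zero).hasFDerivAt
    have h2 : HasDerivAt (fun t : ℝ => (t, x)) ((1 : ℝ), (0 : E)) t :=
      (hasDerivAt_id t).prodMk (hasDerivAt_const t x)
    exact h1.comp_hasDerivAt t h2
  · exact (continuousOn_segment ((hbvw.continuousOn_fderiv_of_isOpen hW
        le_rfl).clm_apply continuousOn_const) hx).intervalIntegrable

end Homotopy

/-! ### Pullback and exterior derivative of 1-forms -/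

section Pullback

variable {E F : Type*} [NormedAddCommGroup E] [NormedSpace ℝ E] [NormedAddCommGroup F]
  [NormedSpace ℝ F]

/-- The pullback `f^* a` of a `1`-form. -/
def pullOne (f : E → F) (a : F → F →L[ℝ] ℝ) (x : E) : E →L[ℝ] ℝ := (a (f x)).comp (fderiv ℝ f x)

theorem contDiffAt_pullOne {f : E → F} {a : F → F →L[ℝ] ℝ} {x : E}
    (hf : ContDiffAt ℝ 2 f x) (ha : ContDiffAt ℝ 1 a (f x)) : ContDiffAt ℝ 1 (pullOne f a) x :=
  (ha.comp x (hf.of_le one_le_two)).clm_comp (hf.fderiv_right (m := 1) (by norm_num))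

/-- The second derivatives of `f` produced by the product rule cancel by symmetry. -/
theorem dOne_pullOne {f : E → F} {a : F → F →L[ℝ] ℝ} {x : E}
    (hf : ContDiffAt ℝ 2 f x) (ha : DifferentiableAt ℝ a (f x)) (v w : E) :
    dOne (pullOne f a) x v w = dOne a (f x) (fderiv ℝ f x v) (fderiv ℝ f x w) := by
  have hfd : DifferentiableAt ℝ f x := hf.differentiableAt two_ne_zero
  have hf' : DifferentiableAt ℝ (fderiv ℝ f) x :=
    (hf.fderiv_right (m := 1) (by norm_num)).differentiableAt one_ne_zero
  have hcomp : DifferentiableAt ℝ (fun y => a (f y)) x := ha.comp x hfd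
  have h1 : fderiv ℝ (fun y => a (f y)) x = (fderiv ℝ a (f x)).comp (fderiv ℝ f x) :=
    fderiv_comp x ha hfd
  have h2 : fderiv ℝ (pullOne f a) x = _ := fderiv_clm_comp hcomp hf'
  have hsymm : fderiv ℝ (fderiv ℝ f) x v w = fderiv ℝ (fderiv ℝ f) x w v :=
    (hf.isSymmSndFDerivAt (by simp)) v w
  rw [dOne, h2]
  simp [h1, dOne, hsymm]

/-- `d (κ a) = dκ ∧ a + κ da`. -/
theorem dOne_smul {κ : E → ℝ} {a : E → E →L[ℝ] ℝ} {x : E} (hκ : DifferentiableAt ℝ κ x)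
    (ha : DifferentiableAt ℝ a x) (v w : E) :
    dOne (fun y => κ y • a y) x v w
      = fderiv ℝ κ x v * a x w - fderiv ℝ κ x w * a x v + κ x * dOne a x v w := by
  rw [dOne, fderiv_fun_smul hκ ha]
  simp [dOne]
  ring

theorem dOne_congr {a b : E → E →L[ℝ] ℝ} {x : E} (h : a =ᶠ[𝓝 x] b) (v w : E) :
    dOne a x v w = dOne b x v w := by
  rw [dOne, dOne, h.fderiv_eq]

theorem dOne_sub {a b : E → E →L[ℝ] ℝ} {x : E} (ha : DifferentiableAt ℝ a x)
    (hb : DifferentiableAt ℝ b x) (v w : E) :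
    dOne (fun y => a y - b y) x v w = dOne a x v w - dOne b x v w := by
  rw [dOne, fderiv_fun_sub ha hb]; simp [dOne]; ring

theorem dOne_swap (a : E → E →L[ℝ] ℝ) (x v w : E) : dOne a x v w = - dOne a x w v := by
  simp [dOne]

end Pullback

end

section

/-! ## Green's theorem on the punctured surface -/

theorem det_complex (L : ℂ →L[ℝ] ℂ) :
    L.det = (L 1).re * (L Complex.I).im - (L 1).im * (L Complex.I).re := by
  have : L.det = LinearMap.det (L : ℂ →ₗ[ℝ] ℂ) := rfl
  rw [this, ← LinearMap.det_toMatrix Complex.basisOneI, Matrix.det_fin_two]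
  simp [LinearMap.toMatrix_apply]
  ring

theorem clm_apply_complex {F : Type*} [NormedAddCommGroup F] [NormedSpace ℝ F] (L : ℂ →L[ℝ] F)
    (z : ℂ) : L z = z.re • L 1 + z.im • L Complex.I := by
  conv_lhs => rw [← Complex.re_add_im z]
  rw [map_add]
  congr 1
  · rw [← L.map_smul]; simp
  · rw [← L.map_smul]; simp

/-- The exterior derivative is a top-degree form on the plane, so a linear map scales it by its
determinant. This matches it with the Jacobian of a change of variables. -/
theorem dOne_complex (b : ℂ → ℂ →L[ℝ] ℝ) (z : ℂ) (L : ℂ →L[ℝ] ℂ) :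
    dOne b z (L 1) (L Complex.I) = L.det * dOne b z 1 Complex.I := by
  rw [det_complex]
  simp only [dOne]
  rw [clm_apply_complex (fderiv ℝ b z) (L 1), clm_apply_complex (fderiv ℝ b z) (L Complex.I)]
  simp only [add_apply, smul_apply, smul_eq_mul]
  rw [clm_apply_complex (fderiv ℝ b z 1) (L Complex.I),
    clm_apply_complex (fderiv ℝ b z Complex.I) (L Complex.I),
    clm_apply_complex (fderiv ℝ b z 1) (L 1),
    clm_apply_complex (fderiv ℝ b z Complex.I) (L 1)]
  simp only [smul_eq_mul]
  ring

/-- The closed rectangle `[0, S] × [0, 1]`. -/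
def rect (S : ℝ) : Set ℂ := Icc 0 S ×ℂ Icc 0 1

/-- The fundamental domain `[0, S] × [0, 1)` of the cylinder. -/
def cell (S : ℝ) : Set ℂ := Icc 0 S ×ℂ Ico 0 1

theorem mem_rect {S : ℝ} {ζ : ℂ} :
    ζ ∈ rect S ↔ (0 ≤ ζ.re ∧ ζ.re ≤ S) ∧ 0 ≤ ζ.im ∧ ζ.im ≤ 1 := by
  simp [rect, Complex.mem_reProdIm]

theorem mem_cell {S : ℝ} {ζ : ℂ} :
    ζ ∈ cell S ↔ (0 ≤ ζ.re ∧ ζ.re ≤ S) ∧ 0 ≤ ζ.im ∧ ζ.im < 1 := by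
  simp [cell, Complex.mem_reProdIm]

theorem isCompact_rect (S : ℝ) : IsCompact (rect S) := isCompact_Icc.reProdIm isCompact_Icc

theorem measurableSet_cell (S : ℝ) : MeasurableSet (cell S) :=
  (measurableSet_Icc.preimage Complex.measurable_re).inter
    (measurableSet_Ico.preimage Complex.measurable_im)

theorem integral_complex_prod (f : ℂ → ℝ) (s t : Set ℝ) :
    ∫ z in s ×ℂ t, f z = ∫ p in s ×ˢ t, f (p.1 + p.2 * Complex.I) := by
  have h := Complex.volume_preserving_equiv_real_prod.symm
  have := h.setIntegral_preimage_emb (MeasurableEquiv.measurableEmbedding _) f (s ×ℂ t)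
  rw [← this]
  have e : Complex.measurableEquivRealProd.symm ⁻¹' (s ×ℂ t) = s ×ˢ t := by
    ext p; simp [Complex.measurableEquivRealProd_symm_apply, Complex.mem_reProdIm]
  rw [e]
  refine integral_congr_ae (Eventually.of_forall fun p => ?_)
  simp [Complex.measurableEquivRealProd_symm_apply, Complex.mk_eq_add_mul_I]

theorem integral_cell_eq_rect (f : ℂ → ℝ) (S : ℝ) : ∫ z in cell S, f z = ∫ z in rect S, f z := by
  rw [cell, rect, integral_complex_prod, integral_complex_prod]
  refine setIntegral_congr_set ?_
  exact Measure.set_prod_ae_eq (Filter.EventuallyEq.rfl) Ico_ae_eq_Icc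

/-- Green's theorem on a rectangle. -/
theorem integral_dOne_rect {a : ℂ → ℂ →L[ℝ] ℝ} {S : ℝ} (hS : 0 ≤ S)
    (ha : ∀ ζ ∈ rect S, ContDiffAt ℝ 1 a ζ) :
    ∫ ζ in rect S, dOne a ζ 1 Complex.I
      = (∫ t in (0 : ℝ)..1, a (S + t * Complex.I) Complex.I)
        - (∫ t in (0 : ℝ)..1, a (t * Complex.I) Complex.I)
        - ((∫ s in (0 : ℝ)..S, a (s + Complex.I) 1) - ∫ s in (0 : ℝ)..S, a s 1) := by
  let e : ℝ × ℝ →L[ℝ] ℂ := Complex.equivRealProdCLM.symm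
  have he (p : ℝ × ℝ) : e p = p.1 + p.2 * Complex.I := by
    simp [e, Complex.equivRealProdCLM_symm_apply]
  have hmem : ∀ p ∈ Icc (0 : ℝ) S ×ˢ Icc (0 : ℝ) 1, e p ∈ rect S := by
    rintro ⟨s, t⟩ ⟨hs, ht⟩
    rw [mem_rect, he]; simpa using ⟨hs, ht⟩
  have hcd (v : ℂ) : ∀ p ∈ Icc (0 : ℝ) S ×ˢ Icc (0 : ℝ) 1,
      ContDiffAt ℝ 1 (fun p => a (e p) v) p := fun p hp =>
    ((ha _ (hmem p hp)).comp p e.contDiff.contDiffAt).clm_apply contDiffAt_const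
  have hder (v : ℂ) : ∀ p ∈ Icc (0 : ℝ) S ×ˢ Icc (0 : ℝ) 1, ∀ w,
      fderiv ℝ (fun p => a (e p) v) p w = fderiv ℝ a (e p) (e w) v := fun p hp w => by
    have h1 := (ha _ (hmem p hp)).differentiableAt one_ne_zero
    rw [fderiv_clm_apply_const h1]
    have h2 : DifferentiableAt ℝ (fun z => a z v) (e p) :=
      h1.clm_apply (differentiableAt_const v)
    have h3 := fderiv_comp p h2 e.differentiableAt
    have : (fun z => a z v) ∘ e = fun p => a (e p) v := rfl
    rw [this] at h3
    rw [h3]; simp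
  have key := integral2_divergence_prod_of_hasFDerivAt
    (fun p => a (e p) Complex.I) (fun p => - a (e p) 1)
    (fun p => fderiv ℝ (fun p => a (e p) Complex.I) p)
    (fun p => - fderiv ℝ (fun p => a (e p) 1) p) 0 0 S 1
  rw [uIcc_of_le hS, uIcc_of_le zero_le_one, min_eq_left hS, max_eq_right hS,
    min_eq_left (zero_le_one' ℝ), max_eq_right (zero_le_one' ℝ)] at key
  have hsub : Ioo (0 : ℝ) S ×ˢ Ioo (0 : ℝ) 1 ⊆ Icc (0 : ℝ) S ×ˢ Icc (0 : ℝ) 1 :=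
    prod_mono Ioo_subset_Icc_self Ioo_subset_Icc_self
  have hc (v : ℂ) : ContinuousOn (fun p => fderiv ℝ (fun p => a (e p) v) p)
      (Icc (0 : ℝ) S ×ˢ Icc (0 : ℝ) 1) := fun p hp =>
    ((hcd v p hp).fderiv_right (m := 0) (by norm_num)).continuousAt.continuousWithinAt
  have hint : IntegrableOn (fun p => fderiv ℝ (fun p => a (e p) Complex.I) p (1, 0)
      + (- fderiv ℝ (fun p => a (e p) 1) p) (0, 1)) (Icc (0 : ℝ) S ×ˢ Icc (0 : ℝ) 1) := by
    refine ContinuousOn.integrableOn_compact (isCompact_Icc.prod isCompact_Icc) ?_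
    exact ((hc _).clm_apply continuousOn_const).add ((hc _).neg.clm_apply continuousOn_const)
  have key' := key
    (fun p hp => (hcd _ p hp).continuousAt.continuousWithinAt)
    (fun p hp => (hcd _ p hp).continuousAt.neg.continuousWithinAt)
    (fun p hp => ((hcd _ p (hsub hp)).differentiableAt one_ne_zero).hasFDerivAt)
    (fun p hp => (((hcd _ p (hsub hp)).differentiableAt one_ne_zero).hasFDerivAt).neg) hint
  have h1 : ∫ ζ in rect S, dOne a ζ 1 Complex.I
      = ∫ x in (0 : ℝ)..S, ∫ y in (0 : ℝ)..1,
        fderiv ℝ (fun p => a (e p) Complex.I) (x, y) (1, 0)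
          + (- fderiv ℝ (fun p => a (e p) 1) (x, y)) (0, 1) := by
    rw [rect, integral_complex_prod]
    calc _ = ∫ p in Icc (0 : ℝ) S ×ˢ Icc (0 : ℝ) 1,
          fderiv ℝ (fun p => a (e p) Complex.I) p (1, 0)
          + (- fderiv ℝ (fun p => a (e p) 1) p) (0, 1) := by
          refine setIntegral_congr_fun (measurableSet_Icc.prod measurableSet_Icc) fun p hp => ?_
          simp only [neg_apply]
          rw [hder _ p hp, hder _ p hp, dOne, he, he, he]
          simp [sub_eq_add_neg]
      _ = _ := by
          rw [Measure.volume_eq_prod, setIntegral_prod _ hint]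
          simp only [intervalIntegral.integral_of_le hS,
            intervalIntegral.integral_of_le (zero_le_one' ℝ),
            setIntegral_congr_set (Ioc_ae_eq_Icc (α := ℝ) (μ := volume))]
  rw [h1, key']
  simp only [he, intervalIntegral.integral_neg]
  simp only [Complex.ofReal_zero, Complex.ofReal_one, zero_mul, one_mul, zero_add, add_zero]
  ring

/-- Stokes' theorem on an immersed cylinder. -/
theorem integral_dOne_cylinder {ϕ : ℂ → ℂ} {b : ℂ → ℂ →L[ℝ] ℝ} {S : ℝ} (hS : 0 ≤ S)
    (hϕ : ContDiff ℝ 2 ϕ) (hper : ∀ ζ, ϕ (ζ + Complex.I) = ϕ ζ)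
    (hinj : ∀ ζ ζ', 0 ≤ ζ.re → 0 ≤ ζ'.re → ϕ ζ = ϕ ζ' → ∃ n : ℤ, ζ' = ζ + n * Complex.I)
    (hdet : ∀ ζ, 0 ≤ ζ.re → 0 ≤ (fderiv ℝ ϕ ζ).det)
    (hb : ∀ ζ, 0 ≤ ζ.re → ζ.re ≤ S → ContDiffAt ℝ 1 b (ϕ ζ)) :
    ∫ z in ϕ '' cell S, dOne b z 1 Complex.I
      = (∫ t in (0 : ℝ)..1, b (ϕ (S + t * Complex.I))
          (fderiv ℝ ϕ (S + t * Complex.I) Complex.I))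
        - ∫ t in (0 : ℝ)..1, b (ϕ (t * Complex.I)) (fderiv ℝ ϕ (t * Complex.I) Complex.I) := by
  have hinj' : InjOn ϕ (cell S) := by
    intro ζ hζ ζ' hζ' h
    rw [mem_cell] at hζ hζ'
    obtain ⟨n, hn⟩ := hinj ζ ζ' hζ.1.1 hζ'.1.1 h
    have him : ζ'.im = ζ.im + n := by rw [hn]; simp
    have : (n : ℝ) < 1 := by linarith [hζ.2.1, hζ'.2.2]
    have h2 : (-1 : ℝ) < n := by linarith [hζ.2.2, hζ'.2.1]
    have h3 : n < 1 := by exact_mod_cast this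
    have h4 : -1 < n := by exact_mod_cast h2
    have : n = 0 := by omega
    rw [hn, this]; simp
  rw [integral_image_eq_integral_abs_det_fderiv_smul volume (measurableSet_cell S)
    (fun ζ _ => ((hϕ.differentiable two_ne_zero) ζ).hasFDerivAt.hasFDerivWithinAt) hinj']
  have h1 : ∫ ζ in cell S, |(fderiv ℝ ϕ ζ).det| • dOne b (ϕ ζ) 1 Complex.I
      = ∫ ζ in cell S, dOne (pullOne ϕ b) ζ 1 Complex.I := by
    refine setIntegral_congr_fun (measurableSet_cell S) fun ζ hζ => ?_
    rw [mem_cell] at hζ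
    rw [dOne_pullOne hϕ.contDiffAt ((hb ζ hζ.1.1 hζ.1.2).differentiableAt one_ne_zero),
      dOne_complex, abs_of_nonneg (hdet ζ hζ.1.1), smul_eq_mul]
  rw [h1, integral_cell_eq_rect, integral_dOne_rect hS]
  · have h2 : ∀ s : ℂ, fderiv ℝ ϕ (s + Complex.I) = fderiv ℝ ϕ s := fun s => by
      rw [← fderiv_comp_add_right]
      congr 1; ext ζ; exact hper ζ
    simp [pullOne, hper, h2]
  · intro ζ hζ
    rw [mem_rect] at hζ
    exact contDiffAt_pullOne hϕ.contDiffAt (hb ζ hζ.1.1 hζ.1.2)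

/-- Integration by parts against the constant function 1; compact support removes the boundary term.
-/
theorem integral_fderiv_eq_zero {f : ℂ → ℝ} (hf : ContDiff ℝ 1 f) (hs : HasCompactSupport f)
    (v : ℂ) : ∫ z, fderiv ℝ f z v = 0 := by
  have hc : Continuous fun z => fderiv ℝ f z v :=
    (hf.continuous_fderiv one_ne_zero).clm_apply continuous_const
  have hs' : HasCompactSupport fun z => fderiv ℝ f z v := hs.fderiv_apply ℝ v
  have := integral_mul_fderiv_eq_neg_fderiv_mul_of_integrable (μ := volume) (f := fun _ : ℂ => (1 : ℝ))
    (g := f) (v := v) (by simp) (by simpa using hc.integrable_of_hasCompactSupport hs')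
    (by simpa using hf.continuous.integrable_of_hasCompactSupport hs) (fun x _ => by fun_prop)
    (fun x _ => (hf.differentiable one_ne_zero) x)
  simpa using this

theorem integral_dOne_eq_zero {b : ℂ → ℂ →L[ℝ] ℝ} (hb : ContDiff ℝ 1 b)
    (hs : HasCompactSupport b) : ∫ z, dOne b z 1 Complex.I = 0 := by
  have hd (v : ℂ) : ContDiff ℝ 1 fun z => b z v := hb.clm_apply contDiff_const
  have hs' (v : ℂ) : HasCompactSupport fun z => b z v :=
    hs.comp_left (g := fun L : ℂ →L[ℝ] ℝ => L v) (by simp)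
  have hint (v w : ℂ) : Integrable fun z => fderiv ℝ (fun z => b z w) z v :=
    Continuous.integrable_of_hasCompactSupport
      (((hd w).continuous_fderiv one_ne_zero).clm_apply continuous_const)
      ((hs' w).fderiv_apply ℝ v)
  have : ∀ z, dOne b z 1 Complex.I = fderiv ℝ (fun z => b z Complex.I) z 1
      - fderiv ℝ (fun z => b z 1) z Complex.I := fun z => by
    rw [dOne, fderiv_clm_apply_const ((hb.differentiable one_ne_zero) z),
      fderiv_clm_apply_const ((hb.differentiable one_ne_zero) z)]
  simp only [this]
  rw [integral_sub (hint _ _) (hint _ _), integral_fderiv_eq_zero (hd _) (hs' _),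
    integral_fderiv_eq_zero (hd _) (hs' _), sub_zero]

end

/-! ### Disks, annuli and Stokes' theorem on an annulus -/

section

theorem two_le_infty : (2 : WithTop ℕ∞) ≤ ((⊤ : ℕ∞) : WithTop ℕ∞) := by
  exact ENat.LEInfty.out

theorem Disks.mem_domain {m : ℕ} {D : Disks m} {z : ℂ} :
    z ∈ D.domain ↔ ∀ j, D.radius j ≤ dist z (D.center j) := by
  simp [Disks.domain, Metric.mem_ball]

theorem Disks.isClosed_domain {m : ℕ} (D : Disks m) : IsClosed D.domain :=
  (isOpen_iUnion fun _ => Metric.isOpen_ball).isClosed_compl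

/-- The factor 2 makes the `δ`-neighbourhoods of the disks pairwise disjoint, so the cutoffs around
different disks do not interact. -/
theorem Disks.exists_margin {m : ℕ} (D : Disks m) : ∃ δ > 0, ∀ i j, i ≠ j →
    D.radius i + D.radius j + 2 * δ < dist (D.center i) (D.center j) := by
  have : ∀ᶠ δ in 𝓝[>] (0 : ℝ), ∀ i j, i ≠ j →
      D.radius i + D.radius j + 2 * δ < dist (D.center i) (D.center j) := by
    rw [eventually_all]; intro i
    rw [eventually_all]; intro j
    by_cases hij : i = j
    · exact Eventually.of_forall fun δ h => absurd hij h
    · have h := (disjoint_closedBall_closedBall_iff (D.radius_pos i).le (D.radius_pos j).le).1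
        (D.disjoint i j hij)
      have hc : Tendsto (fun δ : ℝ => D.radius i + D.radius j + 2 * δ) (𝓝[>] 0)
          (𝓝 (D.radius i + D.radius j)) := by
        have : Continuous fun δ : ℝ => D.radius i + D.radius j + 2 * δ := by fun_prop
        simpa using (this.tendsto 0).mono_left nhdsWithin_le_nhds
      filter_upwards [hc.eventually (gt_mem_nhds h)] with δ hδ _ using hδ
  obtain ⟨δ, h1, h2⟩ := (this.and self_mem_nhdsWithin).exists
  exact ⟨δ, h2, h1⟩

/-- The holomorphic parametrization `ζ ↦ c + r e^{2πζ}` of the exterior of a disk by a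
half-cylinder. -/
def annulusMap (c : ℂ) (r : ℝ) (ζ : ℂ) : ℂ := c + r * Complex.exp (2 * Real.pi * ζ)

theorem hasDerivAt_annulusMap (c : ℂ) (r : ℝ) (ζ : ℂ) :
    HasDerivAt (annulusMap c r) (2 * Real.pi * (r * Complex.exp (2 * Real.pi * ζ))) ζ := by
  have h1 : HasDerivAt (fun ζ : ℂ => 2 * Real.pi * ζ) (2 * Real.pi : ℂ) ζ := by
    simpa using (hasDerivAt_id ζ).const_mul (2 * Real.pi : ℂ)
  have h := ((h1.cexp).const_mul (r : ℂ)).const_add c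
  refine h.congr_deriv ?_
  ring

theorem fderiv_annulusMap (c : ℂ) (r : ℝ) (ζ v : ℂ) :
    fderiv ℝ (annulusMap c r) ζ v = v * (2 * Real.pi * (r * Complex.exp (2 * Real.pi * ζ))) := by
  rw [((hasDerivAt_annulusMap c r ζ).hasFDerivAt.restrictScalars ℝ).fderiv]
  simp

theorem norm_annulusMap_sub (c : ℂ) {r : ℝ} (hr : 0 < r) (ζ : ℂ) :
    dist (annulusMap c r ζ) c = r * Real.exp (2 * Real.pi * ζ.re) := by
  rw [dist_eq_norm, annulusMap, add_sub_cancel_left, norm_mul, Complex.norm_exp,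
    Complex.norm_real, Real.norm_of_nonneg hr.le]
  simp

theorem annulusMap_eq {c : ℂ} {r : ℝ} (hr : 0 < r) {ζ ζ' : ℂ}
    (h : annulusMap c r ζ = annulusMap c r ζ') : ∃ n : ℤ, ζ' = ζ + n * Complex.I := by
  have hr' : (r : ℂ) ≠ 0 := by exact_mod_cast hr.ne'
  have h1 : Complex.exp (2 * Real.pi * ζ') = Complex.exp (2 * Real.pi * ζ) := by
    have := add_left_cancel h
    exact (mul_left_cancel₀ hr' this).symm
  obtain ⟨n, hn⟩ := Complex.exp_eq_exp_iff_exists_int.1 h1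
  refine ⟨n, ?_⟩
  have hpi : (2 * Real.pi : ℂ) ≠ 0 := by exact_mod_cast Real.two_pi_pos.ne'
  apply mul_left_cancel₀ hpi
  rw [hn]; ring

/-- A logarithm inverts the exponential parametrization. Subtracting the integer part of the
imaginary coordinate brings the preimage into the fundamental cell. -/
theorem image_annulusMap_cell {c : ℂ} {r ρ : ℝ} (hr : 0 < r) (hρ : r ≤ ρ) :
    annulusMap c r '' cell (Real.log (ρ / r) / (2 * Real.pi))
      = {z | r ≤ dist z c ∧ dist z c ≤ ρ} := by
  have hpi := Real.two_pi_pos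
  have hkey (x : ℝ) : r * Real.exp (2 * Real.pi * x) ≤ ρ ↔ x ≤ Real.log (ρ / r) / (2 * Real.pi) := by
    rw [le_div_iff₀ hpi, Real.le_log_iff_exp_le (div_pos (hr.trans_le hρ) hr), le_div_iff₀ hr,
      mul_comm r, mul_comm x]
  ext z
  constructor
  · rintro ⟨ζ, hζ, rfl⟩
    rw [mem_cell] at hζ
    simp only [Set.mem_ofPred_eq]
    rw [norm_annulusMap_sub c hr, hkey]
    refine ⟨?_, hζ.1.2⟩
    have : 1 ≤ Real.exp (2 * Real.pi * ζ.re) := Real.one_le_exp (mul_nonneg hpi.le hζ.1.1)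
    nlinarith
  · rintro ⟨h1, h2⟩
    have hr' : (r : ℂ) ≠ 0 := by exact_mod_cast hr.ne'
    have hne : (z - c) / r ≠ 0 := by
      refine div_ne_zero (fun h => ?_) hr'
      rw [dist_eq_norm, h, norm_zero] at h1; linarith
    have hpi' : (2 * Real.pi : ℂ) ≠ 0 := by exact_mod_cast hpi.ne'
    set ζ₀ : ℂ := Complex.log ((z - c) / r) / (2 * Real.pi) with hζ₀
    set ζ : ℂ := ζ₀ - (⌊ζ₀.im⌋ : ℤ) * Complex.I with hζ
    have hmap : annulusMap c r ζ = z := by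
      have : 2 * Real.pi * ζ = Complex.log ((z - c) / r) - ⌊ζ₀.im⌋ * (2 * Real.pi * Complex.I) := by
        rw [hζ, mul_sub, hζ₀, mul_div_cancel₀ _ hpi']; ring
      rw [annulusMap, this, Complex.exp_sub, Complex.exp_log hne, Complex.exp_int_mul_two_pi_mul_I]
      field_simp
      ring
    refine ⟨ζ, ?_, hmap⟩
    have hd := norm_annulusMap_sub c hr ζ
    rw [hmap] at hd
    rw [mem_cell]
    refine ⟨⟨?_, ?_⟩, ?_⟩
    · by_contra hneg
      push Not at hneg
      have : Real.exp (2 * Real.pi * ζ.re) < 1 := Real.exp_lt_one_iff.2 (by nlinarith)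
      nlinarith
    · rw [← hkey, ← hd]; exact h2
    · have : ζ.im = Int.fract ζ₀.im := by
        rw [hζ]; simp [← Int.self_sub_floor]
      rw [this]
      exact ⟨Int.fract_nonneg _, Int.fract_lt_one _⟩

theorem annulusMap_mul_I (c : ℂ) (r t : ℝ) :
    annulusMap c r (t * Complex.I) = c + r * circ t := by
  rw [annulusMap, circ]; congr 3; ring

theorem contDiff_annulusMap (c : ℂ) (r : ℝ) : ContDiff ℝ ∞ (annulusMap c r) := by
  have : ContDiff ℂ ∞ (annulusMap c r) := by unfold annulusMap; fun_prop
  exact this.restrict_scalars ℝ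

/-- Stokes' theorem on an annulus, for a form vanishing near the outer boundary. -/
theorem integral_dOne_annulus {b : ℂ → ℂ →L[ℝ] ℝ} {c : ℂ} {r ρ : ℝ} (hr : 0 < r) (hρ : r ≤ ρ)
    (hb : ∀ z, r ≤ dist z c → dist z c ≤ ρ → ContDiffAt ℝ 1 b z)
    (h0 : ∀ z, dist z c = ρ → b z = 0) :
    ∫ z in {z | r ≤ dist z c ∧ dist z c ≤ ρ}, dOne b z 1 Complex.I
      = - ∫ t in (0 : ℝ)..1, b (c + r * circ t) (2 * Real.pi * Complex.I * (r * circ t)) := by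
  have hpi := Real.two_pi_pos
  have hmem : ∀ ζ : ℂ, 0 ≤ ζ.re → ζ.re ≤ Real.log (ρ / r) / (2 * Real.pi) →
      r ≤ dist (annulusMap c r ζ) c ∧ dist (annulusMap c r ζ) c ≤ ρ := by
    intro ζ h1 h2
    have hin : (ζ - (⌊ζ.im⌋ : ℤ) * Complex.I) ∈ cell (Real.log (ρ / r) / (2 * Real.pi)) := by
      rw [mem_cell]
      refine ⟨by simpa using ⟨h1, h2⟩, ?_⟩
      have : (ζ - (⌊ζ.im⌋ : ℤ) * Complex.I).im = Int.fract ζ.im := by simp [← Int.self_sub_floor]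
      rw [this]
      exact ⟨Int.fract_nonneg _, Int.fract_lt_one _⟩
    have := mem_image_of_mem (annulusMap c r) hin
    rw [image_annulusMap_cell hr hρ] at this
    simp only [Set.mem_ofPred_eq] at this
    rw [norm_annulusMap_sub c hr] at this ⊢
    simpa using this
  have hS : 0 ≤ Real.log (ρ / r) / (2 * Real.pi) :=
    div_nonneg (Real.log_nonneg ((one_le_div hr).2 hρ)) hpi.le
  rw [← image_annulusMap_cell hr hρ, integral_dOne_cylinder hS
    ((contDiff_annulusMap c r).of_le two_le_infty)
    (fun ζ => by
      rw [annulusMap, annulusMap, mul_add, Complex.exp_add, Complex.exp_two_pi_mul_I, mul_one])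
    (fun ζ ζ' _ _ h => annulusMap_eq hr h)
    (fun ζ _ => by
      rw [det_complex, fderiv_annulusMap, fderiv_annulusMap]
      generalize (2 * Real.pi * (r * Complex.exp (2 * Real.pi * ζ)) : ℂ) = w
      simp only [one_mul, Complex.mul_im, Complex.mul_re, Complex.I_re, Complex.I_im]
      nlinarith [sq_nonneg w.re, sq_nonneg w.im])
    (fun ζ h1 h2 => hb _ (hmem ζ h1 h2).1 (hmem ζ h1 h2).2)]
  have hz : ∀ t : ℝ, b (annulusMap c r ((Real.log (ρ / r) / (2 * Real.pi) : ℝ)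
      + t * Complex.I)) = 0 := fun t => by
    refine h0 _ ?_
    rw [norm_annulusMap_sub c hr]
    simp only [Complex.add_re, Complex.ofReal_re, Complex.mul_re, Complex.I_re, mul_zero,
      Complex.ofReal_im, Complex.I_im, mul_one, sub_self, add_zero]
    rw [mul_div_cancel₀ _ hpi.ne', Real.exp_log (div_pos (hr.trans_le hρ) hr),
      mul_div_cancel₀ _ hr.ne']
  simp only [hz]
  simp only [zero_apply, intervalIntegral.integral_zero, zero_sub, neg_inj]
  refine intervalIntegral.integral_congr fun t _ => ?_
  simp only [annulusMap_mul_I, fderiv_annulusMap]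
  congr 1
  rw [circ]
  have : (2 * Real.pi * (t * Complex.I) : ℂ) = 2 * Real.pi * t * Complex.I := by ring
  rw [this]; ring

end

/-! ### Stokes' theorem on truncations of the punctured surface -/

section

theorem contDiffAt_dOne {b : ℂ → ℂ →L[ℝ] ℝ} {z : ℂ} (hb : ContDiffAt ℝ 1 b z) (v w : ℂ) :
    ContinuousAt (fun z => dOne b z v w) z := by
  have h := (hb.fderiv_right (m := 0) (by norm_num)).continuousAt
  exact ((h.clm_apply continuousAt_const).clm_apply continuousAt_const).sub
    ((h.clm_apply continuousAt_const).clm_apply continuousAt_const)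

theorem dOne_eq_zero_of_eventually {b : ℂ → ℂ →L[ℝ] ℝ} {z : ℂ} (h : ∀ᶠ y in 𝓝 z, b y = 0)
    (v w : ℂ) : dOne b z v w = 0 := by
  have : b =ᶠ[𝓝 z] fun _ => 0 := h
  rw [dOne_congr this]; simp [dOne]

/-- The smooth cutoff which is `1` on the disk `𝒟 j` and supported in its `δ`-neighbourhood. -/
def Disks.bump {m : ℕ} (D : Disks m) (j : Fin m) (δ : ℝ) (hδ : 0 < δ) :
    ContDiffBump (D.center j) :=
  ⟨D.radius j, D.radius j + δ, D.radius_pos j, by linarith⟩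

theorem Disks.bump_eq_zero {m : ℕ} {D : Disks m} {j : Fin m} {δ : ℝ} {hδ : 0 < δ} {z : ℂ}
    (h : D.radius j + δ ≤ dist z (D.center j)) : D.bump j δ hδ z = 0 :=
  (D.bump j δ hδ).zero_of_le_dist h

/-- Stokes' theorem on the truncations of the punctured surface `(Σ ∖ {∞}, j)`. -/
theorem exists_truncations {m : ℕ} {D : Disks m} {j : ℂ → ℂ →L[ℝ] ℂ} {ψ : ℂ → ℂ}
    (hj : IsComplexStructure D j) (hψ : IsCylindricalEnd D j ψ) :
    ∃ (S₀ : ℝ) (A : ℝ → Set ℂ), 0 ≤ S₀ ∧ (∀ S, IsCompact (A S)) ∧ (∀ S, A S ⊆ D.domain) ∧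
      (∀ S T, S ≤ T → A S ⊆ A T) ∧ (D.domain = ⋃ n : ℕ, A n) ∧
      ∀ S ≥ S₀, ∀ a : ℂ → ℂ →L[ℝ] ℝ, (∀ z ∈ D.domain, ContDiffAt ℝ 1 a z) →
        ∫ z in A S, dOne a z 1 Complex.I
          = (∫ t in (0 : ℝ)..1, a (ψ (S + t * Complex.I))
              (fderiv ℝ ψ (S + t * Complex.I) Complex.I))
            - ∑ i, ∫ t in (0 : ℝ)..1, a (D.center i + D.radius i * circ t)
                (2 * Real.pi * Complex.I * (D.radius i * circ t)) := by
  obtain ⟨δ, hδ, hmargin⟩ := D.exists_margin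
  obtain ⟨R₁, hR₁⟩ := hψ.surjective
  obtain ⟨R₂, hR₂⟩ := (isCompact_rect 0).exists_bound_of_continuousOn
    hψ.smooth.continuous.continuousOn
  -- Beyond radius `R` everything is covered by the cylindrical end, while the initial circle of the
  -- end and the enlarged disks lie within radius `R`.
  obtain ⟨R, hRR₁, hRR₂, hRD⟩ : ∃ R : ℝ, R₁ ≤ R ∧ R₂ ≤ R ∧
      ∀ i, ‖D.center i‖ + D.radius i + δ < R := by
    have h3 : ∀ᶠ R : ℝ in atTop, ∀ i, ‖D.center i‖ + D.radius i + δ < R :=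
      eventually_all.2 fun i => eventually_gt_atTop _
    obtain ⟨R, h⟩ := ((eventually_ge_atTop R₁).and ((eventually_ge_atTop R₂).and h3)).exists
    exact ⟨R, h⟩
  -- Radius `R + 3` lies beyond the outer radius `R + 2` of the cutoff `β` chosen below, so the
  -- truncating circle meets only the region where `β` is zero.
  obtain ⟨S₁, hS₁⟩ := hψ.tendsto (R + 3)
  have hR0 : 0 ≤ R := (norm_nonneg _).trans ((hR₂ 0 (by simp [mem_rect])).trans hRR₂)
  have hper (ζ : ℂ) (n : ℤ) : ψ (ζ + n * Complex.I) = ψ ζ := by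
    have hp : Function.Periodic ψ Complex.I := hψ.periodic
    simpa using hp.int_mul n ζ
  have hfract (ζ : ℂ) : ∃ ζ' : ℂ, ζ'.re = ζ.re ∧ 0 ≤ ζ'.im ∧ ζ'.im < 1 ∧ ψ ζ' = ψ ζ := by
    refine ⟨ζ + ((-⌊ζ.im⌋ : ℤ) : ℂ) * Complex.I, by simp, ?_, ?_, hper _ _⟩
    · simpa using Int.floor_le ζ.im
    · have := Int.lt_floor_add_one ζ.im
      simp
      linarith
  set A : ℝ → Set ℂ := fun S => (D.domain ∩ Metric.closedBall 0 R) ∪ ψ '' rect S with hA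
  have hAc (S : ℝ) : IsCompact (A S) :=
    ((isCompact_closedBall 0 R).inter_left D.isClosed_domain).union
      ((isCompact_rect S).image hψ.smooth.continuous)
  have hAD (S : ℝ) : A S ⊆ D.domain := by
    rintro z (hz | ⟨ζ, hζ, rfl⟩)
    · exact hz.1
    · rw [mem_rect] at hζ; exact hψ.mem ζ hζ.1.1
  have hAmono (S T : ℝ) (hST : S ≤ T) : A S ⊆ A T := by
    refine union_subset_union_right _ (image_mono fun ζ hζ => ?_)
    rw [mem_rect] at hζ ⊢
    exact ⟨⟨hζ.1.1, hζ.1.2.trans hST⟩, hζ.2⟩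
  have hAfar : ∀ z ∈ D.domain, R ≤ ‖z‖ → ∃ ζ : ℂ, 0 ≤ ζ.re ∧ 0 ≤ ζ.im ∧ ζ.im < 1 ∧ ψ ζ = z := by
    intro z _ hz
    obtain ⟨ζ, h1, h2⟩ := hR₁ z (hRR₁.trans hz)
    obtain ⟨ζ', h3, h4, h5, h6⟩ := hfract ζ
    exact ⟨ζ', h3 ▸ h1, h4, h5, h6.trans h2⟩
  refine ⟨max S₁ 0, A, le_max_right _ _, hAc, hAD, hAmono, ?_, ?_⟩
  · refine Subset.antisymm (fun z hz => ?_) (iUnion_subset fun n => hAD n)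
    rcases le_or_gt ‖z‖ R with h | h
    · exact mem_iUnion.2 ⟨0, Or.inl ⟨hz, by simpa using h⟩⟩
    · obtain ⟨ζ, h1, h2, h3, h4⟩ := hAfar z hz h.le
      obtain ⟨n, hn⟩ := exists_nat_ge ζ.re
      exact mem_iUnion.2 ⟨n, Or.inr ⟨ζ, mem_rect.2 ⟨⟨h1, hn⟩, h2, h3.le⟩, h4⟩⟩
  intro S hS a ha
  have hS0 : 0 ≤ S := (le_max_right _ _).trans hS
  have hSS₁ : S₁ ≤ S := (le_max_left _ _).trans hS
  have hAmeas : MeasurableSet (A S) := (hAc S).measurableSet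
  let β : ContDiffBump (0 : ℂ) := ⟨R + 1, R + 2, by linarith, by linarith⟩
  let χ : Fin m → ℂ → ℝ := fun i => D.bump i δ hδ
  have hβ : ContDiff ℝ 1 β := β.contDiff
  have hχ (i : Fin m) : ContDiff ℝ 1 (χ i) := (D.bump i δ hδ).contDiff
  have hβone {z : ℂ} (hz : ‖z‖ ≤ R + 1) : β z = 1 :=
    β.one_of_mem_closedBall (by simpa using hz)
  have hβzero {z : ℂ} (hz : R + 2 ≤ ‖z‖) : β z = 0 := β.zero_of_le_dist (by simpa using hz)
  -- A partition of unity: `κ₀` is supported away from the disks and infinity, `κ₁` lives on the end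
  -- and `χ i` near the `i`-th disk. The three kinds of pieces give zero, the end term and the
  -- boundary terms.
  let κ₀ : ℂ → ℝ := fun z => β z - ∑ i, χ i z
  let κ₁ : ℂ → ℝ := fun z => 1 - β z
  have hκ₀ : ContDiff ℝ 1 κ₀ := hβ.sub (ContDiff.sum fun i _ => hχ i)
  have hκ₁ : ContDiff ℝ 1 κ₁ := contDiff_const.sub hβ
  have hcd {κ : ℂ → ℝ} (hκ : ContDiff ℝ 1 κ) : ∀ z ∈ D.domain,
      ContDiffAt ℝ 1 (fun y => κ y • a y) z := fun z hz => hκ.contDiffAt.smul (ha z hz)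
  have hint {κ : ℂ → ℝ} (hκ : ContDiff ℝ 1 κ) :
      IntegrableOn (fun z => dOne (fun y => κ y • a y) z 1 Complex.I) (A S) :=
    ContinuousOn.integrableOn_compact (hAc S) fun z hz =>
      (contDiffAt_dOne (hcd hκ z (hAD S hz)) _ _).continuousWithinAt
  have hsplit : ∀ z ∈ A S, dOne a z 1 Complex.I = dOne (fun y => κ₀ y • a y) z 1 Complex.I
      + dOne (fun y => κ₁ y • a y) z 1 Complex.I
      + ∑ i, dOne (fun y => χ i y • a y) z 1 Complex.I := by
    intro z hz
    have had : DifferentiableAt ℝ a z := (ha z (hAD S hz)).differentiableAt one_ne_zero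
    have hβd : DifferentiableAt ℝ β z := hβ.differentiable one_ne_zero z
    have hχd (i : Fin m) : DifferentiableAt ℝ (χ i) z := (hχ i).differentiable one_ne_zero z
    have e1 : fderiv ℝ κ₁ z = - fderiv ℝ β z := fderiv_const_sub 1
    have e0 : fderiv ℝ κ₀ z = fderiv ℝ β z - ∑ i, fderiv ℝ (χ i) z := by
      have := fderiv_fun_sub hβd (DifferentiableAt.fun_sum (u := Finset.univ) fun i _ => hχd i)
      rw [fderiv_fun_sum fun i _ => hχd i] at this
      exact this
    rw [dOne_smul (hκ₀.differentiable one_ne_zero z) had,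
      dOne_smul (hκ₁.differentiable one_ne_zero z) had, e0, e1]
    simp_rw [dOne_smul (hχd _) had]
    simp only [Finset.sum_add_distrib, Finset.sum_sub_distrib, ← Finset.sum_mul, κ₀, κ₁,
      sub_apply, neg_apply, sum_apply]
    ring
  have hI0 : ∫ z in A S, dOne (fun y => κ₀ y • a y) z 1 Complex.I = 0 := by
    have hzero : ∀ z, z ∉ D.domain → ∀ᶠ y in 𝓝 z, κ₀ y • a y = 0 := by
      intro z hz
      rw [Disks.mem_domain] at hz
      push Not at hz
      obtain ⟨i, hi⟩ := hz
      filter_upwards [Metric.isOpen_ball.mem_nhds hi] with y hy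
      rw [Metric.mem_ball] at hy
      have h1 : χ i y = 1 := (D.bump i δ hδ).one_of_mem_closedBall hy.le
      have h2 : ∀ k, k ≠ i → χ k y = 0 := fun k hk => by
        refine Disks.bump_eq_zero ?_
        have := hmargin k i hk
        have t := dist_triangle (D.center k) y (D.center i)
        rw [dist_comm (D.center k) y] at t
        linarith
      have h3 : β y = 1 := by
        refine hβone ?_
        have := hRD i
        have t := norm_add_le (y - D.center i) (D.center i)
        rw [sub_add_cancel, ← dist_eq_norm] at t
        linarith
      have h4 : κ₀ y = 0 := by
        simp only [κ₀]
        rw [Finset.sum_eq_single i (fun k _ hk => h2 k hk) (by simp), h1, h3, sub_self]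
      rw [h4, zero_smul]
    have hout : ∀ z : ℂ, R + 2 ≤ ‖z‖ → κ₀ z • a z = 0 := by
      intro z hz
      have h1 : ∀ i, χ i z = 0 := fun i => by
        refine Disks.bump_eq_zero ?_
        have := hRD i
        have t := norm_add_le (z - D.center i) (D.center i)
        rw [sub_add_cancel, ← dist_eq_norm] at t
        linarith
      simp only [κ₀, hβzero hz, h1, Finset.sum_const_zero, sub_self, zero_smul]
    have hb : ContDiff ℝ 1 (fun y => κ₀ y • a y) := by
      rw [contDiff_iff_contDiffAt]
      intro z
      by_cases hz : z ∈ D.domain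
      · exact hcd hκ₀ z hz
      · have : (fun y => κ₀ y • a y) =ᶠ[𝓝 z] fun _ => 0 := hzero z hz
        exact contDiffAt_const.congr_of_eventuallyEq this
    have hsupp : HasCompactSupport (fun y => κ₀ y • a y) :=
      HasCompactSupport.intro (isCompact_closedBall (0 : ℂ) (R + 2)) fun z hz => by
        refine hout z ?_
        simp only [Metric.mem_closedBall, dist_zero_right, not_le] at hz
        exact hz.le
    rw [← integral_dOne_eq_zero hb hsupp]
    -- A point of the domain outside `A S` has norm at least `R + 3`, beyond the support of `κ₀`.
    -- Near points outside the domain one `χ i` and `β` equal 1 and the other cutoffs vanish, so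
    -- `κ₀` is zero as well.
    refine setIntegral_eq_integral_of_forall_compl_eq_zero fun z hz => ?_
    by_cases hzD : z ∈ D.domain
    · refine dOne_eq_zero_of_eventually ?_ _ _
      have hzR : R < ‖z‖ := by
        by_contra h
        exact hz (Or.inl ⟨hzD, by simpa using h⟩)
      obtain ⟨ζ, h1, h2, h3, h4⟩ := hAfar z hzD hzR.le
      have hζS : S < ζ.re := by
        by_contra h
        exact hz (Or.inr ⟨ζ, mem_rect.2 ⟨⟨h1, not_lt.1 h⟩, h2, h3.le⟩, h4⟩)
      have h5 := hS₁ ζ (hSS₁.trans hζS.le)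
      rw [h4] at h5
      have : R + 2 < ‖z‖ := by linarith
      filter_upwards [continuous_norm.continuousAt.eventually (lt_mem_nhds this)] with y hy
      exact hout y hy.le
    · exact dOne_eq_zero_of_eventually (hzero z hzD) _ _
  have hI1 : ∫ z in A S, dOne (fun y => κ₁ y • a y) z 1 Complex.I
      = ∫ t in (0 : ℝ)..1, a (ψ (S + t * Complex.I))
              (fderiv ℝ ψ (S + t * Complex.I) Complex.I) := by
    have hsub : ψ '' cell S ⊆ A S := by
      rintro _ ⟨ζ, hζ, rfl⟩
      rw [mem_cell] at hζ
      exact Or.inr ⟨ζ, mem_rect.2 ⟨hζ.1, hζ.2.1, hζ.2.2.le⟩, rfl⟩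
    -- What `A S` contains outside the image of the cell lies within radius `R`, where `κ₁` vanishes
    -- in a neighbourhood.
    rw [setIntegral_eq_of_subset_of_forall_sdiff_eq_zero hAmeas hsub]
    · rw [integral_dOne_cylinder hS0 (hψ.smooth.of_le two_le_infty) hψ.periodic hψ.injective]
      · have h1 : ∀ t ∈ uIcc (0 : ℝ) 1, κ₁ (ψ (t * Complex.I)) = 0 := fun t ht => by
          rw [uIcc_of_le zero_le_one] at ht
          have : ‖ψ (t * Complex.I)‖ ≤ R₂ := hR₂ _ (by
            rw [mem_rect]; simpa using ht)
          simp only [κ₁]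
          rw [hβone (by linarith), sub_self]
        have h2 : ∀ t ∈ uIcc (0 : ℝ) 1, κ₁ (ψ (S + t * Complex.I)) = 1 := fun t ht => by
          have := hS₁ (S + t * Complex.I) (by simpa using hSS₁)
          simp only [κ₁]
          rw [hβzero (by linarith), sub_zero]
        rw [intervalIntegral.integral_congr (g := fun t : ℝ => (0 : ℝ)) (a := 0) (b := 1)
          (f := fun t : ℝ => (κ₁ (ψ (t * Complex.I)) • a (ψ (t * Complex.I)))
            (fderiv ℝ ψ (t * Complex.I) Complex.I)) fun t ht => by
              simp only [h1 t ht, zero_smul, zero_apply]]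
        rw [intervalIntegral.integral_zero, sub_zero]
        refine intervalIntegral.integral_congr fun t ht => ?_
        simp only [h2 t ht, one_smul]
      · intro ζ hζ
        have hh := hψ.holomorphic ζ hζ 1
        rw [mul_one] at hh
        rw [det_complex, hh]
        generalize fderiv ℝ ψ ζ 1 = w
        rcases eq_or_ne w 0 with rfl | hw
        · simp
        · have := hj.oriented _ (hψ.mem ζ hζ) w hw
          simp only [Complex.mul_im, Complex.conj_re, Complex.conj_im] at this
          linarith
      · exact fun ζ h1 _ => hcd hκ₁ _ (hψ.mem ζ h1)
    · rintro z ⟨hz, hz'⟩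
      have hzR : ‖z‖ < R + 1 := by
        by_contra h
        push Not at h
        have hzD := hAD S hz
        rcases hz with hz | ⟨ζ, hζ, hζz⟩
        · have := hz.2; simp at this; linarith
        · rw [mem_rect] at hζ
          obtain ⟨ζ', h3, h4, h5, h6⟩ := hfract ζ
          exact hz' ⟨ζ', mem_cell.2 ⟨by rw [h3]; exact hζ.1, h4, h5⟩, h6.trans hζz⟩
      refine dOne_eq_zero_of_eventually ?_ _ _
      filter_upwards [continuous_norm.continuousAt.eventually (gt_mem_nhds hzR)] with y hy
      simp only [κ₁]
      rw [hβone hy.le, sub_self, zero_smul]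
  have hIi (i : Fin m) : ∫ z in A S, dOne (fun y => χ i y • a y) z 1 Complex.I
      = - ∫ t in (0 : ℝ)..1, a (D.center i + D.radius i * circ t)
                (2 * Real.pi * Complex.I * (D.radius i * circ t)) := by
    have hri := D.radius_pos i
    have hdom : ∀ z, D.radius i ≤ dist z (D.center i) → dist z (D.center i) ≤ D.radius i + δ →
        z ∈ D.domain := by
      intro z h1 h2
      rw [Disks.mem_domain]
      intro k
      rcases eq_or_ne k i with rfl | hk
      · exact h1
      · have := hmargin k i hk
        have t := dist_triangle (D.center k) z (D.center i)
        rw [dist_comm (D.center k) z] at t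
        linarith
    have hsub : {z | D.radius i ≤ dist z (D.center i) ∧ dist z (D.center i) ≤ D.radius i + δ}
        ⊆ A S := by
      rintro z ⟨h1, h2⟩
      refine Or.inl ⟨hdom z h1 h2, ?_⟩
      rw [mem_closedBall_zero_iff]
      have := hRD i
      have t := norm_add_le (z - D.center i) (D.center i)
      rw [sub_add_cancel, ← dist_eq_norm] at t
      linarith
    rw [setIntegral_eq_of_subset_of_forall_sdiff_eq_zero hAmeas hsub]
    · rw [integral_dOne_annulus hri (by linarith) (fun z h1 h2 => hcd (hχ i) z (hdom z h1 h2))]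
      · congr 1
        refine intervalIntegral.integral_congr fun t _ => ?_
        have : χ i (D.center i + D.radius i * circ t) = 1 := by
          refine (D.bump i δ hδ).one_of_mem_closedBall ?_
          have hc : ‖circ t‖ = 1 := by
            rw [circ, show (2 * Real.pi * t * Complex.I : ℂ) = ((2 * Real.pi * t : ℝ) : ℂ)
              * Complex.I by push_cast; ring]
            exact Complex.norm_exp_ofReal_mul_I _
          simp [Disks.bump, hc, abs_of_pos hri]
        simp only [this, one_smul]
      · intro z hz
        simp only [χ]
        rw [Disks.bump_eq_zero hz.ge, zero_smul]
    · rintro z ⟨hz, hz'⟩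
      have h1 := Disks.mem_domain.1 (hAD S hz) i
      have h2 : D.radius i + δ < dist z (D.center i) := by
        by_contra h
        exact hz' ⟨h1, not_lt.1 h⟩
      refine dOne_eq_zero_of_eventually ?_ _ _
      have hc : ContinuousAt (fun y => dist y (D.center i)) z := by fun_prop
      filter_upwards [hc.eventually (lt_mem_nhds h2)] with y hy
      simp only [χ]
      rw [Disks.bump_eq_zero hy.le, zero_smul]
  have hint01 : IntegrableOn (fun z => dOne (fun y => κ₀ y • a y) z 1 Complex.I
      + dOne (fun y => κ₁ y • a y) z 1 Complex.I) (A S) := (hint hκ₀).add (hint hκ₁)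
  rw [setIntegral_congr_fun hAmeas hsplit, integral_add hint01
    (integrable_finsetSum _ fun i _ => hint (hχ i)), integral_add (hint hκ₀) (hint hκ₁), hI0, hI1,
    integral_finsetSum _ fun i _ => hint (hχ i)]
  simp only [hIi, Finset.sum_neg_distrib]
  ring

end

section

/-! ## Collars of the tori -/

/-- The inverse function theorem: equality of dimensions upgrades injectivity of the differential to
invertibility. -/
theorem exists_localInverse {E F : Type*} [NormedAddCommGroup E] [NormedSpace ℝ E]
    [NormedAddCommGroup F] [NormedSpace ℝ F] [FiniteDimensional ℝ E] [FiniteDimensional ℝ F]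
    (hdim : Module.finrank ℝ E = Module.finrank ℝ F) {f : E → F} {x : E}
    (hf : ContDiffAt ℝ ∞ f x) (hinj : Function.Injective (fderiv ℝ f x)) :
    ∃ g : F → E, g (f x) = x ∧ ContDiffAt ℝ ∞ g (f x) ∧ (∀ᶠ y in 𝓝 (f x), f (g y) = y) ∧
      ∀ᶠ x' in 𝓝 x, g (f x') = x' := by
  have : CompleteSpace E := FiniteDimensional.complete ℝ E
  let e : E ≃L[ℝ] F :=
    (LinearEquiv.ofInjectiveOfFinrankEq (fderiv ℝ f x : E →ₗ[ℝ] F) hinj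
      hdim).toContinuousLinearEquiv
  have he : (e : E →L[ℝ] F) = fderiv ℝ f x := by ext v; rfl
  have hd : HasFDerivAt f (e : E →L[ℝ] F) x := by
    rw [he]; exact (hf.differentiableAt (by simp)).hasFDerivAt
  have hn : (∞ : WithTop ℕ∞) ≠ 0 := by simp
  have hs : HasStrictFDerivAt f (e : E →L[ℝ] F) x := hf.hasStrictFDerivAt' hd hn
  exact ⟨hf.localInverse hd hn, hs.localInverse_apply_image, hf.to_localInverse hd hn,
    hs.eventually_right_inverse, hs.eventually_left_inverse⟩

/-- The cone `(r, s, z) ↦ r Ψ(s, z)` over a solid torus. -/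
def coneMap (Ψ : ℝ × ℂ → E4) (p : ℝ × ℝ × ℂ) : E4 := p.1 • Ψ p.2

/-- The cone over a solid torus in polar coordinates `z = ρ e^{2πiθ}`. -/
def polarMap (Ψ : ℝ × ℂ → E4) (p : ℝ × ℝ × ℝ × ℝ) : E4 :=
  p.1 • Ψ (p.2.1, p.2.2.1 * circ p.2.2.2)

/-- The determinant of the differential of the cone map. -/
def coneDet (Ψ : ℝ × ℂ → E4) (q : ℝ × ℂ) : ℝ :=
  det4 (Ψ q) (fderiv ℝ Ψ q (1, 0)) (fderiv ℝ Ψ q (0, 1)) (fderiv ℝ Ψ q (0, Complex.I))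

theorem eq_zero_of_det4 {v₁ v₂ v₃ v₄ : E4} (h : det4 v₁ v₂ v₃ v₄ ≠ 0) {a b c d : ℝ}
    (h0 : a • v₁ + b • v₂ + c • v₃ + d • v₄ = 0) : a = 0 ∧ b = 0 ∧ c = 0 ∧ d = 0 := by
  have := Matrix.eq_zero_of_vecMul_eq_zero h (v := ![a, b, c, d]) (by
    ext i
    have hi := congrArg (fun w : E4 => w i) h0
    simp only [Matrix.vecMul, dotProduct, Fin.sum_univ_four]
    simpa using hi)
  exact ⟨congrFun this 0, congrFun this 1, congrFun this 2, congrFun this 3⟩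

theorem fderiv_split (Ψ : ℝ × ℂ → E4) (q : ℝ × ℂ) (b : ℝ) (w : ℂ) :
    fderiv ℝ Ψ q (b, w) = b • fderiv ℝ Ψ q (1, 0) + w.re • fderiv ℝ Ψ q (0, 1)
      + w.im • fderiv ℝ Ψ q (0, Complex.I) := by
  rw [← map_smul, ← map_smul, ← map_smul, ← map_add, ← map_add]
  congr 1
  ext <;> simp

theorem contDiff_coneMap {Ψ : ℝ × ℂ → E4} (h : ContDiff ℝ ∞ Ψ) : ContDiff ℝ ∞ (coneMap Ψ) :=
  contDiff_fst.smul (h.comp contDiff_snd)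

theorem contDiff_circ : ContDiff ℝ ∞ circ := by
  have h : ContDiff ℝ ∞ fun t : ℝ => (2 * Real.pi * t * Complex.I : ℂ) := by
    have : ContDiff ℝ ∞ fun t : ℝ => (t : ℂ) := Complex.ofRealCLM.contDiff
    fun_prop
  exact h.cexp

theorem circ_eq (t : ℝ) : circ t = Complex.exp ((2 * Real.pi * t : ℝ) * Complex.I) := by
  rw [circ]; push_cast; ring_nf

theorem norm_circ (t : ℝ) : ‖circ t‖ = 1 := by
  rw [circ_eq]; exact Complex.norm_exp_ofReal_mul_I _

theorem circ_ne_zero (t : ℝ) : circ t ≠ 0 := Complex.exp_ne_zero _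

theorem hasDerivAt_circ (t : ℝ) : HasDerivAt circ (2 * Real.pi * Complex.I * circ t) t := by
  have h1 : HasDerivAt (fun t : ℝ => (2 * Real.pi * t * Complex.I : ℂ))
      (2 * Real.pi * Complex.I) t := by
    have := ((Complex.ofRealCLM.hasDerivAt (x := t)).const_mul
      (2 * Real.pi : ℂ)).mul_const Complex.I
    simpa using this
  refine h1.cexp.congr_deriv ?_
  rw [circ]; ring

theorem circ_add_int (t : ℝ) (n : ℤ) : circ (t + n) = circ t := by
  rw [circ, circ, Complex.exp_eq_exp_iff_exists_int]
  exact ⟨n, by push_cast; ring⟩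

theorem circ_add_one (t : ℝ) : circ (t + 1) = circ t := by simpa using circ_add_int t 1

theorem circ_eq_circ {s t : ℝ} (h : circ s = circ t) : ∃ n : ℤ, t = s + n := by
  rw [circ, circ, eq_comm, Complex.exp_eq_exp_iff_exists_int] at h
  obtain ⟨n, hn⟩ := h
  refine ⟨n, ?_⟩
  have hpi : (2 * Real.pi * Complex.I : ℂ) ≠ 0 := Complex.two_pi_I_ne_zero
  have : (2 * Real.pi * Complex.I : ℂ) * t = (2 * Real.pi * Complex.I) * (s + n) := by
    linear_combination hn
  exact_mod_cast mul_left_cancel₀ hpi this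

theorem exists_eq_norm_mul_circ (z : ℂ) : ∃ θ : ℝ, z = ‖z‖ * circ θ := by
  refine ⟨z.arg / (2 * Real.pi), ?_⟩
  rw [circ_eq, mul_div_cancel₀ _ Real.two_pi_pos.ne']
  exact (Complex.norm_mul_exp_arg_mul_I z).symm

/-- The columns of the differential are `Ψ` and the partial derivatives of `Ψ` scaled by `r`; these
are independent as `coneDet` is nonzero. Cones give an equidimensional map into `ℝ⁴` even where `Ψ`
leaves the sphere, which is allowed outside the unit disk. -/
theorem fderiv_coneMap_injective {Ψ : ℝ × ℂ → E4} (h : ContDiff ℝ ∞ Ψ) {r : ℝ} {q : ℝ × ℂ}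
    (hr : r ≠ 0) (hq : coneDet Ψ q ≠ 0) : Function.Injective (fderiv ℝ (coneMap Ψ) (r, q)) := by
  have hΨ : HasFDerivAt Ψ (fderiv ℝ Ψ q) q := (h.differentiable (by simp) q).hasFDerivAt
  have hc : HasFDerivAt (fun p : ℝ × ℝ × ℂ => Ψ p.2)
      ((fderiv ℝ Ψ q).comp (ContinuousLinearMap.snd ℝ ℝ (ℝ × ℂ))) (r, q) :=
    HasFDerivAt.comp (g := Ψ) (r, q) hΨ hasFDerivAt_snd
  have h1 : HasFDerivAt (coneMap Ψ) _ (r, q) :=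
    (hasFDerivAt_fst (𝕜 := ℝ) (p := (r, q))).smul hc
  rw [h1.fderiv, injective_iff_map_eq_zero]
  rintro ⟨a, b, w⟩ h0
  simp only [add_apply, smul_apply, ContinuousLinearMap.smulRight_apply,
    ContinuousLinearMap.comp_apply, ContinuousLinearMap.coe_fst', ContinuousLinearMap.coe_snd'] at h0
  rw [fderiv_split, smul_add, smul_add, smul_smul, smul_smul, smul_smul, add_comm, ← add_assoc,
    ← add_assoc] at h0
  obtain ⟨ha, hb, hc, hd⟩ := eq_zero_of_det4 hq h0
  have hw : w = 0 := Complex.ext (by simpa [hr] using hc) (by simpa [hr] using hd)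
  have hb' : b = 0 := by simpa [hr] using hb
  rw [ha, hb', hw]; rfl

/-- Polar coordinates on the second factor. -/
def polarCoord4 (p : ℝ × ℝ × ℝ × ℝ) : ℝ × ℝ × ℂ := (p.1, p.2.1, p.2.2.1 * circ p.2.2.2)

theorem contDiff_polarCoord4 : ContDiff ℝ ∞ polarCoord4 := by
  have h1 : ContDiff ℝ ∞ fun p : ℝ × ℝ × ℝ × ℝ => ((p.2.2.1 : ℝ) : ℂ) :=
    Complex.ofRealCLM.contDiff.comp (by fun_prop)
  have h2 : ContDiff ℝ ∞ fun p : ℝ × ℝ × ℝ × ℝ => circ p.2.2.2 :=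
    contDiff_circ.comp (by fun_prop)
  exact contDiff_fst.prodMk ((contDiff_fst.comp contDiff_snd).prodMk (h1.mul h2))

theorem polarMap_eq (Ψ : ℝ × ℂ → E4) : polarMap Ψ = coneMap Ψ ∘ polarCoord4 := rfl

theorem contDiff_polarMap {Ψ : ℝ × ℂ → E4} (h : ContDiff ℝ ∞ Ψ) : ContDiff ℝ ∞ (polarMap Ψ) :=
  (contDiff_coneMap h).comp contDiff_polarCoord4

theorem fderiv_polarCoord4_injective {p : ℝ × ℝ × ℝ × ℝ} (hp : p.2.2.1 ≠ 0) :
    Function.Injective (fderiv ℝ polarCoord4 p) := by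
  have h1 : HasFDerivAt (fun p : ℝ × ℝ × ℝ × ℝ => ((p.2.2.1 : ℝ) : ℂ)) (Complex.ofRealCLM.comp
      ((ContinuousLinearMap.fst ℝ ℝ ℝ).comp ((ContinuousLinearMap.snd ℝ ℝ (ℝ × ℝ)).comp
        (ContinuousLinearMap.snd ℝ ℝ (ℝ × ℝ × ℝ))))) p :=
    (Complex.ofRealCLM.comp ((ContinuousLinearMap.fst ℝ ℝ ℝ).comp
      ((ContinuousLinearMap.snd ℝ ℝ (ℝ × ℝ)).comp
        (ContinuousLinearMap.snd ℝ ℝ (ℝ × ℝ × ℝ))))).hasFDerivAt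
  have h2 : HasFDerivAt (fun p : ℝ × ℝ × ℝ × ℝ => circ p.2.2.2) _ p :=
    HasFDerivAt.comp (g := circ) p (hasDerivAt_circ p.2.2.2).hasFDerivAt
      ((ContinuousLinearMap.snd ℝ ℝ ℝ).comp ((ContinuousLinearMap.snd ℝ ℝ (ℝ × ℝ)).comp
        (ContinuousLinearMap.snd ℝ ℝ (ℝ × ℝ × ℝ)))).hasFDerivAt
  have h3 : HasFDerivAt polarCoord4 _ p :=
    (hasFDerivAt_fst (𝕜 := ℝ) (p := p)).prodMk ((((ContinuousLinearMap.fst ℝ ℝ (ℝ × ℝ)).comp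
      (ContinuousLinearMap.snd ℝ ℝ (ℝ × ℝ × ℝ))).hasFDerivAt (x := p)).prodMk (h1.mul h2))
  rw [h3.fderiv, injective_iff_map_eq_zero]
  rintro ⟨a, b, c, d⟩ h0
  simp only [ContinuousLinearMap.prod_apply, Prod.mk_eq_zero, ContinuousLinearMap.coe_fst',
    ContinuousLinearMap.comp_apply, ContinuousLinearMap.coe_snd', add_apply, smul_apply,
    ContinuousLinearMap.toSpanSingleton_apply, Complex.ofRealCLM_apply, smul_eq_mul] at h0
  obtain ⟨ha, hb, hcd⟩ := h0
  have hcd' : ((c : ℂ) + p.2.2.1 * (2 * Real.pi * d) * Complex.I) * circ p.2.2.2 = 0 := by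
    rw [← hcd, Complex.real_smul]; ring
  have h4 := (mul_eq_zero.1 hcd').resolve_right (circ_ne_zero _)
  have hc : c = 0 := by simpa using congrArg Complex.re h4
  have hd : d = 0 := by
    have := congrArg Complex.im h4
    simpa [hp, Real.pi_ne_zero] using this
  rw [ha, hb, hc, hd]; rfl

theorem fderiv_polarMap_injective {Ψ : ℝ × ℂ → E4} (h : ContDiff ℝ ∞ Ψ) {p : ℝ × ℝ × ℝ × ℝ}
    (hr : p.1 ≠ 0) (hp : p.2.2.1 ≠ 0) (hq : coneDet Ψ (p.2.1, p.2.2.1 * circ p.2.2.2) ≠ 0) :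
    Function.Injective (fderiv ℝ (polarMap Ψ) p) := by
  rw [polarMap_eq, fderiv_comp p ((contDiff_coneMap h).differentiable (by simp) _)
    (contDiff_polarCoord4.differentiable (by simp) p)]
  exact (fderiv_coneMap_injective h hr hq).comp (fderiv_polarCoord4_injective hp)

theorem finrank_E4 : Module.finrank ℝ E4 = 4 := by simp [E4]

theorem exists_localInverse_coneMap {Ψ : ℝ × ℂ → E4} (h : ContDiff ℝ ∞ Ψ) {r : ℝ} {q : ℝ × ℂ}
    (hr : r ≠ 0) (hq : coneDet Ψ q ≠ 0) :
    ∃ g : E4 → ℝ × ℝ × ℂ, g (coneMap Ψ (r, q)) = (r, q) ∧ ContDiffAt ℝ ∞ g (coneMap Ψ (r, q)) ∧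
      (∀ᶠ y in 𝓝 (coneMap Ψ (r, q)), coneMap Ψ (g y) = y) ∧
      ∀ᶠ x' in 𝓝 (r, q), g (coneMap Ψ x') = x' :=
  exists_localInverse (by rw [finrank_E4]; simp) (contDiff_coneMap h).contDiffAt
    (fderiv_coneMap_injective h hr hq)

theorem exists_localInverse_polarMap {Ψ : ℝ × ℂ → E4} (h : ContDiff ℝ ∞ Ψ) {p : ℝ × ℝ × ℝ × ℝ}
    (hr : p.1 ≠ 0) (hp : p.2.2.1 ≠ 0) (hq : coneDet Ψ (p.2.1, p.2.2.1 * circ p.2.2.2) ≠ 0) :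
    ∃ g : E4 → ℝ × ℝ × ℝ × ℝ, g (polarMap Ψ p) = p ∧ ContDiffAt ℝ ∞ g (polarMap Ψ p) ∧
      (∀ᶠ y in 𝓝 (polarMap Ψ p), polarMap Ψ (g y) = y) ∧
      ∀ᶠ x' in 𝓝 p, g (polarMap Ψ x') = x' :=
  exists_localInverse (by rw [finrank_E4]; simp) (contDiff_polarMap h).contDiffAt
    (fderiv_polarMap_injective h hr hp hq)

end

/-! ### Injectivity on slightly enlarged solid tori -/

section

/-- On the solid tori enlarged by `ε`, the cone maps are still injective local diffeomorphisms,
disjoint from each other and from the cone over the knot. -/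
structure IsCollarWidth {m : ℕ} (K : Configuration m) (ε : ℝ) : Prop where
  pos : 0 < ε
  det : ∀ j s z, ‖z‖ < 1 + ε → 0 < coneDet (K.Ψ j) (s, z)
  inj : ∀ i j s s' z z', ∀ r r' : ℝ, 0 < r → 0 < r' → ‖z‖ < 1 + ε → ‖z'‖ < 1 + ε →
    r • K.Ψ i (s, z) = r' • K.Ψ j (s', z') →
    K.Ψ i = K.Ψ j ∧ r = r' ∧ z = z' ∧ ∃ n : ℤ, s' = s + n
  knot : ∀ j s z t, ∀ r r' : ℝ, 0 < r → 0 < r' → ‖z‖ < 1 + ε → r • K.p t ≠ r' • K.Ψ j (s, z)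

theorem exists_norm_le_one_dist_lt {ε : ℝ} (hε : 0 < ε) {z : ℂ} (hz : ‖z‖ < 1 + ε) :
    ∃ w : ℂ, ‖w‖ ≤ 1 ∧ dist z w < ε := by
  rcases le_or_gt ‖z‖ 1 with h | h
  · exact ⟨z, h, by simpa using hε⟩
  · obtain ⟨θ, hθ⟩ := exists_eq_norm_mul_circ z
    refine ⟨circ θ, (norm_circ θ).le, ?_⟩
    have : z - circ θ = ((‖z‖ - 1 : ℝ) : ℂ) * circ θ := by
      conv_lhs => rw [hθ]
      push_cast; ring
    rw [dist_eq_norm, this, norm_mul, norm_circ, mul_one, Complex.norm_real,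
      Real.norm_of_nonneg (by linarith)]
    linarith

/-- The pairs near which `P` holds form an open set containing a compact one, hence also a uniform
thickening of it. One period in the long direction suffices. -/
theorem exists_width_of_eventually {P : ℝ × ℂ → ℝ × ℂ → Prop}
    (h : ∀ q q' : ℝ × ℂ, ‖q.2‖ ≤ 1 → ‖q'.2‖ ≤ 1 → ∀ᶠ x in 𝓝 (q, q'), P x.1 x.2) :
    ∀ᶠ ε in 𝓝[>] (0 : ℝ), ∀ q q' : ℝ × ℂ, q.1 ∈ Icc (0 : ℝ) 1 → q'.1 ∈ Icc (0 : ℝ) 1 →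
      ‖q.2‖ < 1 + ε → ‖q'.2‖ < 1 + ε → P q q' := by
  let C : Set (ℝ × ℂ) := Icc 0 1 ×ˢ Metric.closedBall 0 1
  have hC : IsCompact C := isCompact_Icc.prod (isCompact_closedBall 0 1)
  let U : Set ((ℝ × ℂ) × (ℝ × ℂ)) := {x | ∀ᶠ y in 𝓝 x, P y.1 y.2}
  have hU : IsOpen U := isOpen_setOfPred_eventually_nhds
  have hCU : C ×ˢ C ⊆ U := by
    rintro ⟨q, q'⟩ ⟨hq, hq'⟩
    exact h q q' (by simpa using hq.2) (by simpa using hq'.2)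
  obtain ⟨δ, hδ, hδU⟩ := (hC.prod hC).exists_thickening_subset_open hU hCU
  filter_upwards [Ioo_mem_nhdsGT hδ] with ε hε q q' hq hq' hz hz'
  obtain ⟨w, hw, hd⟩ := exists_norm_le_one_dist_lt hε.1 hz
  obtain ⟨w', hw', hd'⟩ := exists_norm_le_one_dist_lt hε.1 hz'
  have hmem : (q, q') ∈ Metric.thickening δ (C ×ˢ C) := by
    rw [Metric.mem_thickening_iff]
    refine ⟨((q.1, w), (q'.1, w')), ⟨⟨hq, by simpa using hw⟩, ⟨hq', by simpa using hw'⟩⟩, ?_⟩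
    rw [Prod.dist_eq, Prod.dist_eq, Prod.dist_eq]
    simp only [dist_self, max_lt_iff]
    exact ⟨⟨hδ, hd.trans hε.2⟩, hδ, hd'.trans hε.2⟩
  exact (hδU hmem).self_of_nhds

theorem IsSolidTorus.add_int {Ψ : ℝ × ℂ → E4} (h : IsSolidTorus Ψ) (s : ℝ) (z : ℂ) (n : ℤ) :
    Ψ (s + n, z) = Ψ (s, z) := by
  have hp : Function.Periodic (fun s => Ψ (s, z)) 1 := fun s => h.periodic s z
  simpa using hp.int_mul n s

theorem IsSolidTorus.coneDet_add_int {Ψ : ℝ × ℂ → E4} (h : IsSolidTorus Ψ) (s : ℝ) (z : ℂ)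
    (n : ℤ) : coneDet Ψ (s + n, z) = coneDet Ψ (s, z) := by
  have h1 : (fun q => Ψ (q + ((n : ℝ), (0 : ℂ)))) = Ψ := by
    ext1 q
    have : q + ((n : ℝ), (0 : ℂ)) = (q.1 + n, q.2) := by ext <;> simp
    rw [this, h.add_int]
  have h2 : fderiv ℝ Ψ (s + n, z) = fderiv ℝ Ψ (s, z) := by
    have := fderiv_comp_add_right (𝕜 := ℝ) (f := Ψ) (x := (s, z)) ((n : ℝ), (0 : ℂ))
    rw [h1] at this
    rw [this]; simp
  rw [coneDet, coneDet, h2, h.add_int]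

theorem continuous_det4 {X : Type*} [TopologicalSpace X] {f₁ f₂ f₃ f₄ : X → E4}
    (h₁ : Continuous f₁) (h₂ : Continuous f₂) (h₃ : Continuous f₃) (h₄ : Continuous f₄) :
    Continuous fun x => det4 (f₁ x) (f₂ x) (f₃ x) (f₄ x) := by
  refine Continuous.matrix_det (continuous_matrix fun i j => ?_)
  have hc (j : Fin 4) : Continuous fun v : E4 => v j := by fun_prop
  fin_cases i
  · exact (hc j).comp h₁
  · exact (hc j).comp h₂
  · exact (hc j).comp h₃
  · exact (hc j).comp h₄

theorem IsSolidTorus.continuous_coneDet {Ψ : ℝ × ℂ → E4} (h : IsSolidTorus Ψ) :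
    Continuous (coneDet Ψ) := by
  have hd : Continuous (fderiv ℝ Ψ) := h.smooth.continuous_fderiv (by simp)
  exact continuous_det4 h.smooth.continuous (hd.clm_apply continuous_const)
    (hd.clm_apply continuous_const) (hd.clm_apply continuous_const)

theorem norm_eq_one_of_mem_S3 {x : E4} (h : x ∈ S3) : ‖x‖ = 1 := by simpa [S3] using h

theorem IsSolidTorus.norm_eq {Ψ : ℝ × ℂ → E4} (h : IsSolidTorus Ψ) {s : ℝ} {z : ℂ}
    (hz : ‖z‖ ≤ 1) : ‖Ψ (s, z)‖ = 1 := norm_eq_one_of_mem_S3 (h.mem s z hz)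

/-- The pairs of points of two solid tori near which the cones over them intersect at most along
the diagonal. -/
theorem eventually_cone_injective {Ψ Ψ' : ℝ × ℂ → E4} (h : IsSolidTorus Ψ) (h' : IsSolidTorus Ψ')
    (hdis : Ψ = Ψ' ∨ Disjoint (solid Ψ) (solid Ψ')) {q q' : ℝ × ℂ} (hq : ‖q.2‖ ≤ 1)
    (hq' : ‖q'.2‖ ≤ 1) :
    ∀ᶠ x : (ℝ × ℂ) × (ℝ × ℂ) in 𝓝 (q, q'), ∀ κ : ℝ, 0 < κ → Ψ x.1 = κ • Ψ' x.2 →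
      Ψ = Ψ' ∧ κ = 1 ∧ x.1.2 = x.2.2 ∧ ∃ n : ℤ, x.2.1 = x.1.1 + n := by
  have hn : ‖Ψ q‖ = 1 := h.norm_eq hq
  have hn' : ‖Ψ' q'‖ = 1 := h'.norm_eq hq'
  have hc1 : ContinuousAt (fun x : (ℝ × ℂ) × (ℝ × ℂ) => ‖Ψ x.1‖) (q, q') :=
    (h.smooth.continuous.comp continuous_fst).norm.continuousAt
  have hc2 : ContinuousAt (fun x : (ℝ × ℂ) × (ℝ × ℂ) => ‖Ψ' x.2‖) (q, q') :=
    (h'.smooth.continuous.comp continuous_snd).norm.continuousAt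
  have hκc : ContinuousAt (fun x : (ℝ × ℂ) × (ℝ × ℂ) => ‖Ψ x.1‖ / ‖Ψ' x.2‖) (q, q') :=
    hc1.div hc2 (by simp [hn'])
  have hne : ∀ᶠ x : (ℝ × ℂ) × (ℝ × ℂ) in 𝓝 (q, q'), 0 < ‖Ψ' x.2‖ :=
    hc2.eventually (lt_mem_nhds (by simp [hn']))
  have hκ : ∀ x : (ℝ × ℂ) × (ℝ × ℂ), 0 < ‖Ψ' x.2‖ → ∀ κ : ℝ, 0 < κ → Ψ x.1 = κ • Ψ' x.2 →
      κ = ‖Ψ x.1‖ / ‖Ψ' x.2‖ := by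
    intro x hx κ hκ he
    rw [he, norm_smul, Real.norm_of_nonneg hκ.le, mul_div_cancel_right₀ _ hx.ne']
  -- Where the points coincide, the local inverse of the cone map separates nearby points up to the
  -- deck shift. Where they differ, continuity keeps the rays apart, since the factor `κ` is forced
  -- to be the quotient of the norms.
  by_cases heq : Ψ q = Ψ' q'
  · have hΨ : Ψ = Ψ' := by
      refine hdis.resolve_right fun hd => ?_
      exact disjoint_left.1 hd ⟨q, hq, rfl⟩ ⟨q', hq', heq.symm⟩
    subst hΨ
    obtain ⟨s, z⟩ := q
    obtain ⟨s', z'⟩ := q'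
    obtain ⟨hz, n, hs⟩ := h.injective s s' z z' hq hq' heq
    subst hz hs
    obtain ⟨g, -, -, -, hg⟩ := exists_localInverse_coneMap h.smooth one_ne_zero
      (q := (s, z)) (h.oriented s z hq).ne'
    have t1 : Tendsto (fun x : (ℝ × ℂ) × (ℝ × ℂ) => ((1 : ℝ), x.1)) (𝓝 ((s, z), (s + n, z)))
        (𝓝 (1, (s, z))) :=
      (continuous_const.prodMk continuous_fst).tendsto _
    have t2 : Tendsto (fun x : (ℝ × ℂ) × (ℝ × ℂ) =>
        (‖Ψ x.1‖ / ‖Ψ x.2‖, (x.2.1 - n, x.2.2))) (𝓝 ((s, z), (s + n, z)))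
        (𝓝 (1, (s, z))) := by
      refine Tendsto.prodMk_nhds ?_ ?_
      · have := hκc.tendsto
        simp only [hn, hn', div_one] at this
        exact this
      · have : Continuous fun x : (ℝ × ℂ) × (ℝ × ℂ) => (x.2.1 - n, x.2.2) := by fun_prop
        simpa using this.tendsto ((s, z), (s + n, z))
    filter_upwards [hne, t1.eventually hg, t2.eventually hg] with x hx hx1 hx2 κ hκ0 he
    have hκe := hκ x hx κ hκ0 he
    have e : coneMap Ψ (1, x.1) = coneMap Ψ (‖Ψ x.1‖ / ‖Ψ x.2‖, (x.2.1 - n, x.2.2)) := by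
      have hsh : Ψ (x.2.1 - n, x.2.2) = Ψ x.2 := by
        have := h.add_int (x.2.1 - n) x.2.2 n
        rw [sub_add_cancel] at this
        exact this.symm
      change (1 : ℝ) • Ψ x.1 = (‖Ψ x.1‖ / ‖Ψ x.2‖) • Ψ (x.2.1 - n, x.2.2)
      rw [one_smul, hsh, ← hκe, he]
    rw [e, hx2] at hx1
    have e1 := congrArg Prod.fst hx1
    have e2 := congrArg (fun p => p.2.1) hx1
    have e3 := congrArg (fun p => p.2.2) hx1
    simp only at e1 e2 e3
    refine ⟨rfl, hκe.trans e1, e3.symm, n, ?_⟩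
    rw [← e2]; ring
  · have hc : ContinuousAt (fun x : (ℝ × ℂ) × (ℝ × ℂ) =>
        Ψ x.1 - (‖Ψ x.1‖ / ‖Ψ' x.2‖) • Ψ' x.2) (q, q') :=
      (h.smooth.continuous.comp continuous_fst).continuousAt.sub
        (hκc.smul (h'.smooth.continuous.comp continuous_snd).continuousAt)
    have h0 : Ψ q - (‖Ψ q‖ / ‖Ψ' q'‖) • Ψ' q' ≠ 0 := by
      rw [hn, hn', div_one, one_smul]; exact sub_ne_zero.2 heq
    filter_upwards [hne, hc.eventually_ne h0] with x hx hx0 κ hκ0 he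
    refine absurd ?_ hx0
    rw [← hκ x hx κ hκ0 he, he, sub_self]

/-- The knot is a compact set of unit vectors. If it met the ray through `Ψ x`, it would contain the
normalized vector, which stays off the knot for `x` near `q`. -/
theorem eventually_cone_knot {Ψ : ℝ × ℂ → E4} {p : ℝ → E4} (h : IsSolidTorus Ψ) (hp : IsKnot p)
    (hdis : ∀ t, p t ∉ solid Ψ) {q : ℝ × ℂ} (hq : ‖q.2‖ ≤ 1) :
    ∀ᶠ x : ℝ × ℂ in 𝓝 q, ∀ t κ : ℝ, 0 < κ → p t ≠ κ • Ψ x := by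
  have hn : ‖Ψ q‖ = 1 := h.norm_eq hq
  have hcl : IsClosed (range p) := by
    have hper : Function.Periodic p 1 := hp.periodic
    rw [← hper.image_Icc zero_lt_one 0]
    exact (isCompact_Icc.image hp.smooth.continuous).isClosed
  have hc : ContinuousAt (fun x => ‖Ψ x‖⁻¹ • Ψ x) q :=
    (h.smooth.continuous.norm.continuousAt.inv₀ (by simp [hn])).smul h.smooth.continuous.continuousAt
  have hmem : ‖Ψ q‖⁻¹ • Ψ q ∈ (range p)ᶜ := by
    rw [hn, inv_one, one_smul]
    rintro ⟨t, ht⟩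
    exact hdis t ⟨q, hq, ht.symm⟩
  filter_upwards [hc.eventually (hcl.isOpen_compl.mem_nhds hmem)] with x hx t κ hκ he
  have h1 : κ * ‖Ψ x‖ = 1 := by
    have := norm_eq_one_of_mem_S3 (hp.mem t)
    rwa [he, norm_smul, Real.norm_of_nonneg hκ.le] at this
  refine hx ⟨t, ?_⟩
  rw [he, eq_inv_of_mul_eq_one_left h1]

theorem exists_collarWidth {m : ℕ} (K : Configuration m) : ∃ ε, IsCollarWidth K ε := by
  have h1 : ∀ᶠ ε in 𝓝[>] (0 : ℝ), ∀ i j, ∀ q q' : ℝ × ℂ, q.1 ∈ Icc (0 : ℝ) 1 →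
      q'.1 ∈ Icc (0 : ℝ) 1 → ‖q.2‖ < 1 + ε → ‖q'.2‖ < 1 + ε →
      (∀ κ : ℝ, 0 < κ → K.Ψ i q = κ • K.Ψ j q' →
        K.Ψ i = K.Ψ j ∧ κ = 1 ∧ q.2 = q'.2 ∧ ∃ n : ℤ, q'.1 = q.1 + n) :=
    eventually_all.2 fun i => eventually_all.2 fun j =>
      exists_width_of_eventually (P := fun q q' => ∀ κ : ℝ, 0 < κ → K.Ψ i q = κ • K.Ψ j q' →
        K.Ψ i = K.Ψ j ∧ κ = 1 ∧ q.2 = q'.2 ∧ ∃ n : ℤ, q'.1 = q.1 + n) fun q q' hq hq' =>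
        eventually_cone_injective (K.solidTorus i) (K.solidTorus j) (K.disjoint i j) hq hq'
  have h2 : ∀ᶠ ε in 𝓝[>] (0 : ℝ), ∀ i, ∀ q q' : ℝ × ℂ, q.1 ∈ Icc (0 : ℝ) 1 →
      q'.1 ∈ Icc (0 : ℝ) 1 → ‖q.2‖ < 1 + ε → ‖q'.2‖ < 1 + ε →
      (0 < coneDet (K.Ψ i) q ∧ ∀ t κ : ℝ, 0 < κ → K.p t ≠ κ • K.Ψ i q) :=
    eventually_all.2 fun i =>
      exists_width_of_eventually (P := fun q _ => 0 < coneDet (K.Ψ i) q ∧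
        ∀ t κ : ℝ, 0 < κ → K.p t ≠ κ • K.Ψ i q) fun q q' hq hq' => by
        have hdet : ∀ᶠ x in 𝓝 q, 0 < coneDet (K.Ψ i) x :=
          (K.solidTorus i).continuous_coneDet.continuousAt.eventually
            (lt_mem_nhds ((K.solidTorus i).oriented q.1 q.2 hq))
        exact (continuous_fst.tendsto (q, q')).eventually (hdet.and
          (eventually_cone_knot (K.solidTorus i) K.knot (K.disjoint_knot i) hq))
  obtain ⟨ε, ⟨h1, h2⟩, hε⟩ := ((h1.and h2).and self_mem_nhdsWithin).exists
  have hfr (s : ℝ) : Int.fract s ∈ Icc (0 : ℝ) 1 := ⟨Int.fract_nonneg s, (Int.fract_lt_one s).le⟩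
  have hΨ (i : Fin m) (s : ℝ) (z : ℂ) : K.Ψ i (s, z) = K.Ψ i (Int.fract s, z) := by
    conv_lhs => rw [← Int.fract_add_floor s]
    exact (K.solidTorus i).add_int _ _ _
  refine ⟨ε, hε, fun j s z hz => ?_, fun i j s s' z z' (r r' : ℝ) hr hr' hz hz' he => ?_,
    fun j s z t (r r' : ℝ) hr hr' hz he => ?_⟩
  · have := (h2 j (Int.fract s, z) (Int.fract s, z) (hfr s) (hfr s) hz hz).1
    rw [← Int.fract_add_floor s, (K.solidTorus j).coneDet_add_int]
    exact this
  · have he' : K.Ψ i (Int.fract s, z) = ((r : ℝ)⁻¹ * r') • K.Ψ j (Int.fract s', z') := by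
      rw [← hΨ, ← hΨ, mul_smul, ← he, smul_smul, inv_mul_cancel₀ (ne_of_gt hr), one_smul]
    obtain ⟨e1, e2, e3, n, e4⟩ := h1 i j (Int.fract s, z) (Int.fract s', z') (hfr s) (hfr s')
      hz hz' _ (mul_pos (inv_pos.2 hr) hr') he'
    refine ⟨e1, ?_, e3, n + ⌊s'⌋ - ⌊s⌋, ?_⟩
    · field_simp at e2
      exact e2.symm
    · simp only at e4
      push_cast
      have a1 := Int.fract_add_floor s
      have a2 := Int.fract_add_floor s'
      linarith
  · refine (h2 j (Int.fract s, z) (Int.fract s, z) (hfr s) (hfr s) hz hz).2 t (r⁻¹ * r')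
      (mul_pos (inv_pos.2 hr) hr') ?_
    rw [← hΨ, mul_smul, ← he, smul_smul, inv_mul_cancel₀ (ne_of_gt hr), one_smul]

end

/-! ### The isotopy pushing collars onto the tori -/

section

variable {m : ℕ} {K : Configuration m} {ε : ℝ}

/-- The cone over the open solid torus of radius `c`. -/
def openCone (K : Configuration m) (j : Fin m) (c : ℝ) : Set E4 :=
  {y | ∃ r : ℝ, 0 < r ∧ ∃ s z, ‖z‖ < c ∧ y = r • K.Ψ j (s, z)}

/-- The cone over the closed solid torus of radius `c`. -/
def closedCone (K : Configuration m) (j : Fin m) (c : ℝ) : Set E4 :=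
  {y | ∃ r : ℝ, 0 < r ∧ ∃ s z, ‖z‖ ≤ c ∧ y = r • K.Ψ j (s, z)}

theorem IsCollarWidth.ne_zero (hε : IsCollarWidth K ε) {j : Fin m} {s : ℝ} {z : ℂ}
    (hz : ‖z‖ < 1 + ε) : K.Ψ j (s, z) ≠ 0 := by
  intro h
  have h2 := (hε.det j s z hz).ne'
  have := eq_zero_of_det4 (a := 1) (b := 0) (c := 0) (d := 0) h2 (by rw [h]; simp)
  exact one_ne_zero this.1

theorem IsCollarWidth.isOpen_openCone (hε : IsCollarWidth K ε) (j : Fin m) {c : ℝ}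
    (hc : c ≤ 1 + ε) : IsOpen (openCone K j c) := by
  rw [isOpen_iff_mem_nhds]
  rintro y ⟨r, hr, s, z, hz, rfl⟩
  obtain ⟨g, hg1, hg2, hg3, -⟩ := exists_localInverse_coneMap (K.solidTorus j).smooth hr.ne'
    (hε.det j s z (hz.trans_le hc)).ne'
  change _ ∈ 𝓝 (coneMap (K.Ψ j) (r, s, z))
  have ht : Tendsto g (𝓝 (coneMap (K.Ψ j) (r, s, z))) (𝓝 (r, s, z)) := by
    have := hg2.continuousAt.tendsto
    rwa [hg1] at this
  have h1 : ∀ᶠ p : ℝ × ℝ × ℂ in 𝓝 (r, s, z), 0 < p.1 :=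
    continuous_fst.continuousAt.eventually (lt_mem_nhds hr)
  have h2 : ∀ᶠ p : ℝ × ℝ × ℂ in 𝓝 (r, s, z), ‖p.2.2‖ < c :=
    (continuous_snd.snd.norm.continuousAt (x := (r, s, z))).eventually (gt_mem_nhds hz)
  filter_upwards [hg3, ht.eventually h1, ht.eventually h2] with y hy hy1 hy2
  exact ⟨(g y).1, hy1, (g y).2.1, (g y).2.2, hy2, hy.symm⟩

/-- Membership in the cone depends only on the direction of the vector, and the directions in the
cone form a compact set. The apex must be excluded, as the cone does not contain it. -/
theorem IsCollarWidth.eventually_not_mem_closedCone (hε : IsCollarWidth K ε) (j : Fin m) {c : ℝ}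
    (hc : c < 1 + ε) {y : E4} (hy : y ≠ 0) (hyc : y ∉ closedCone K j c) :
    ∀ᶠ y' in 𝓝 y, y' ∉ closedCone K j c := by
  let f : ℝ × ℂ → E4 := fun q => ‖K.Ψ j q‖⁻¹ • K.Ψ j q
  have hcomp : IsCompact (f '' (Icc 0 1 ×ˢ Metric.closedBall 0 c)) := by
    refine (isCompact_Icc.prod (isCompact_closedBall 0 c)).image_of_continuousOn ?_
    have hΨ := (K.solidTorus j).smooth.continuous
    refine (ContinuousOn.inv₀ hΨ.norm.continuousOn ?_).smul hΨ.continuousOn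
    rintro ⟨s, z⟩ ⟨-, hz⟩
    exact norm_ne_zero_iff.2 (hε.ne_zero ((mem_closedBall_zero_iff.1 hz).trans_lt hc))
  have hchar : ∀ y : E4, y ≠ 0 → (y ∈ closedCone K j c ↔
      ‖y‖⁻¹ • y ∈ f '' (Icc 0 1 ×ˢ Metric.closedBall 0 c)) := by
    intro y hy
    constructor
    · rintro ⟨r, hr, s, z, hz, rfl⟩
      refine ⟨(Int.fract s, z), ⟨⟨Int.fract_nonneg s, (Int.fract_lt_one s).le⟩,
        mem_closedBall_zero_iff.2 hz⟩, ?_⟩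
      have : K.Ψ j (Int.fract s, z) = K.Ψ j (s, z) := by
        conv_rhs => rw [← Int.fract_add_floor s]
        exact ((K.solidTorus j).add_int _ _ _).symm
      simp only [f]
      rw [this, norm_smul, Real.norm_of_nonneg hr.le, mul_inv, smul_smul, mul_right_comm,
        inv_mul_cancel₀ hr.ne', one_mul]
    · rintro ⟨⟨s, z⟩, ⟨-, hz⟩, h⟩
      have hz' := mem_closedBall_zero_iff.1 hz
      have hne := norm_pos_iff.2 (hε.ne_zero (j := j) (s := s) (hz'.trans_lt hc))
      have hny := norm_pos_iff.2 hy
      refine ⟨‖y‖ * ‖K.Ψ j (s, z)‖⁻¹, by positivity, s, z, hz', ?_⟩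
      simp only [f] at h
      rw [mul_smul, h, smul_smul, mul_inv_cancel₀ hny.ne', one_smul]
  have hcont : ContinuousAt (fun y : E4 => ‖y‖⁻¹ • y) y :=
    (continuous_norm.continuousAt.inv₀ (norm_ne_zero_iff.2 hy)).smul continuousAt_id
  have hmem : ‖y‖⁻¹ • y ∈ (f '' (Icc 0 1 ×ˢ Metric.closedBall 0 c))ᶜ := by
    rwa [mem_compl_iff, ← hchar y hy]
  filter_upwards [hcont.eventually (hcomp.isClosed.isOpen_compl.mem_nhds hmem),
    isOpen_ne.mem_nhds hy] with y' h1 h2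
  rwa [hchar y' h2]

/-- The complement of the cones over the cores of the solid tori. -/
def coreFree (K : Configuration m) : Set E4 := {y | y ≠ 0 ∧ ∀ j, y ∉ closedCone K j 0}

theorem IsCollarWidth.isOpen_coreFree (hε : IsCollarWidth K ε) : IsOpen (coreFree K) := by
  rw [isOpen_iff_mem_nhds]
  rintro y ⟨hy, hyj⟩
  have := eventually_all.2 fun j => hε.eventually_not_mem_closedCone j (by linarith [hε.pos]) hy
    (hyj j)
  filter_upwards [this, isOpen_ne.mem_nhds hy] with y' h1 h2
  exact ⟨h2, h1⟩

/-- The cutoff function of the collar. -/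
def collarCut (ε ρ : ℝ) : ℝ := Real.smoothTransition ((1 + 2 * ε / 3 - ρ) / (ε / 3))

theorem collarCut_of_le {ρ : ℝ} (hε : 0 < ε) (h : ρ ≤ 1 + ε / 3) : collarCut ε ρ = 1 := by
  refine Real.smoothTransition.one_of_one_le ?_
  rw [one_le_div (by positivity)]; linarith

theorem collarCut_of_ge {ρ : ℝ} (hε : 0 < ε) (h : 1 + 2 * ε / 3 ≤ ρ) : collarCut ε ρ = 0 := by
  refine Real.smoothTransition.zero_of_nonpos ?_
  exact div_nonpos_of_nonpos_of_nonneg (by linarith) (by positivity)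

/-- The radial isotopy `ρ ↦ ρ + τ χ(ρ) (1 - ρ)`. -/
def collarPush (ε τ ρ : ℝ) : ℝ := ρ + τ * collarCut ε ρ * (1 - ρ)

theorem contDiff_collarPush (ε : ℝ) : ContDiff ℝ ∞ fun q : ℝ × ℝ => collarPush ε q.1 q.2 := by
  have h1 : ContDiff ℝ ∞ fun q : ℝ × ℝ => collarCut ε q.2 :=
    Real.smoothTransition.contDiff.comp (by fun_prop)
  unfold collarPush
  fun_prop

theorem collarCut_mem (ε ρ : ℝ) : 0 ≤ collarCut ε ρ ∧ collarCut ε ρ ≤ 1 :=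
  ⟨Real.smoothTransition.nonneg _, Real.smoothTransition.le_one _⟩

theorem one_le_collarPush {τ ρ : ℝ} (hτ : τ ∈ Icc (0 : ℝ) 1) (hρ : 1 ≤ ρ) :
    1 ≤ collarPush ε τ ρ := by
  obtain ⟨h1, h2⟩ := collarCut_mem ε ρ
  have h3 : τ * collarCut ε ρ ≤ 1 := mul_le_one₀ hτ.2 h1 h2
  unfold collarPush
  nlinarith

theorem one_le_collarPush_one {ρ : ℝ} (hε : 0 < ε) : 1 ≤ collarPush ε 1 ρ := by
  rcases le_total 1 ρ with h | h
  · exact one_le_collarPush (by simp) h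
  · rw [collarPush, collarCut_of_le hε (by linarith)]; linarith

theorem collarPush_one_eq {ρ : ℝ} (hε : 0 < ε) (h : ρ ≤ 1 + ε / 3) : collarPush ε 1 ρ = 1 := by
  rw [collarPush, collarCut_of_le hε h]; ring

theorem collarPush_lt {τ ρ : ℝ} (hε : 0 < ε) (hτ : τ ∈ Icc (0 : ℝ) 1) (hρ : ρ < 1 + ε) :
    collarPush ε τ ρ < 1 + ε := by
  obtain ⟨h1, h2⟩ := collarCut_mem ε ρ
  have h3 : τ * collarCut ε ρ ≤ 1 := mul_le_one₀ hτ.2 h1 h2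
  have h4 : 0 ≤ τ * collarCut ε ρ := mul_nonneg hτ.1 h1
  unfold collarPush
  rcases le_or_gt ρ 1 with h | h
  · nlinarith [mul_nonneg (sub_nonneg.2 h3) (sub_nonneg.2 h)]
  · nlinarith [mul_nonneg h4 (sub_nonneg.2 h.le)]

theorem collarPush_pos {τ ρ : ℝ} (hτ : τ ∈ Icc (0 : ℝ) 1) (hρ : 0 < ρ) :
    0 < collarPush ε τ ρ := by
  obtain ⟨h1, h2⟩ := collarCut_mem ε ρ
  have h3 : τ * collarCut ε ρ ≤ 1 := mul_le_one₀ hτ.2 h1 h2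
  have h4 : 0 ≤ τ * collarCut ε ρ := mul_nonneg hτ.1 h1
  unfold collarPush
  rcases le_or_gt ρ 1 with h | h
  · nlinarith
  · nlinarith

/-- Polar coordinates of points of the cone over the collar. -/
def IsPolar (ε : ℝ) (p : ℝ × ℝ × ℝ × ℝ) : Prop := 0 < p.1 ∧ 0 < p.2.2.1 ∧ p.2.2.1 < 1 + ε

theorem IsPolar.norm_lt {p : ℝ × ℝ × ℝ × ℝ} (h : IsPolar ε p) :
    ‖(p.2.2.1 * circ p.2.2.2 : ℂ)‖ < 1 + ε := by
  rw [norm_mul, norm_circ, mul_one, Complex.norm_real, Real.norm_of_nonneg h.2.1.le]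
  exact h.2.2

open Classical in
/-- The isotopy of the cone which pushes the collars onto the tori. -/
def push (K : Configuration m) (ε : ℝ) (q : ℝ × E4) : E4 :=
  if h : ∃ j p, IsPolar ε p ∧ polarMap (K.Ψ j) p = q.2 then
    polarMap (K.Ψ h.choose) (h.choose_spec.choose.1, h.choose_spec.choose.2.1,
      collarPush ε q.1 h.choose_spec.choose.2.2.1, h.choose_spec.choose.2.2.2)
  else q.2

/-- The chosen polar coordinates are irrelevant: injectivity on the collar leaves only integer
shifts of both angles, and possibly another index with the same solid torus. -/
theorem IsCollarWidth.push_polar (hε : IsCollarWidth K ε) {j : Fin m} {p : ℝ × ℝ × ℝ × ℝ}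
    (hp : IsPolar ε p) (τ : ℝ) : push K ε (τ, polarMap (K.Ψ j) p)
      = polarMap (K.Ψ j) (p.1, p.2.1, collarPush ε τ p.2.2.1, p.2.2.2) := by
  have h : ∃ i p', IsPolar ε p' ∧ polarMap (K.Ψ i) p' = (τ, polarMap (K.Ψ j) p).2 :=
    ⟨j, p, hp, rfl⟩
  rw [push, dif_pos h]
  obtain ⟨h1, h2⟩ := h.choose_spec.choose_spec
  generalize h.choose_spec.choose = p' at h1 h2 ⊢
  generalize h.choose = i at h2 ⊢
  obtain ⟨e1, e2, e3, n, e4⟩ := hε.inj i j _ _ _ _ _ _ h1.1 hp.1 h1.norm_lt hp.norm_lt h2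
  have e5 : p'.2.2.1 = p.2.2.1 := by
    have := congrArg norm e3
    rwa [norm_mul, norm_mul, norm_circ, norm_circ, mul_one, mul_one, Complex.norm_real,
      Complex.norm_real, Real.norm_of_nonneg h1.2.1.le, Real.norm_of_nonneg hp.2.1.le] at this
  have e6 : circ p'.2.2.2 = circ p.2.2.2 := by
    rw [e5] at e3
    exact mul_left_cancel₀ (by exact_mod_cast hp.2.1.ne') e3
  simp only [polarMap]
  rw [e1, e2, e4, e5, e6, (K.solidTorus j).add_int]

theorem push_of_not {q : ℝ × E4} (h : ¬ ∃ j p, IsPolar ε p ∧ polarMap (K.Ψ j) p = q.2) :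
    push K ε q = q.2 := by rw [push, dif_neg h]

theorem polarMap_of_mem_closedCone {j : Fin m} {c : ℝ} {y : E4} (hy : y ∈ coreFree K)
    (hc : c < 1 + ε) (h : y ∈ closedCone K j c) :
    ∃ p, IsPolar ε p ∧ p.2.2.1 ≤ c ∧ polarMap (K.Ψ j) p = y := by
  obtain ⟨r, hr, s, z, hz, rfl⟩ := h
  have hz0 : z ≠ 0 := by
    rintro rfl
    exact hy.2 j ⟨r, hr, s, 0, by simp, rfl⟩
  obtain ⟨θ, hθ⟩ := exists_eq_norm_mul_circ z
  refine ⟨(r, s, ‖z‖, θ), ⟨hr, norm_pos_iff.2 hz0, hz.trans_lt hc⟩, hz, ?_⟩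
  rw [polarMap]
  simp only
  rw [← hθ]

/-- The cutoff vanishes from radius `1 + 2ε/3` on, so the isotopy is stationary before the edge `1 +
ε` of the coordinate region. This is what lets the two branches of `push` glue smoothly. -/
theorem IsCollarWidth.push_of_not_mem (hε : IsCollarWidth K ε) {y : E4}
    (hy : ∀ j, y ∉ closedCone K j (1 + 2 * ε / 3)) (τ : ℝ) : push K ε (τ, y) = y := by
  by_cases h : ∃ j p, IsPolar ε p ∧ polarMap (K.Ψ j) p = y
  · obtain ⟨j, p, hp, rfl⟩ := h
    have hρ : 1 + 2 * ε / 3 ≤ p.2.2.1 := by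
      by_contra hlt
      refine hy j ⟨p.1, hp.1, p.2.1, p.2.2.1 * circ p.2.2.2, ?_, rfl⟩
      rw [norm_mul, norm_circ, mul_one, Complex.norm_real, Real.norm_of_nonneg hp.2.1.le]
      exact (not_le.1 hlt).le
    rw [hε.push_polar hp, collarPush, collarCut_of_ge hε.pos hρ, mul_zero, zero_mul, add_zero]
  · exact push_of_not h

theorem IsCollarWidth.contDiffAt_push (hε : IsCollarWidth K ε) {τ : ℝ} {y : E4}
    (hy : y ∈ coreFree K) : ContDiffAt ℝ ∞ (push K ε) (τ, y) := by
  have hpos := hε.pos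
  -- Inside the closed cone a local inverse of the polar map expresses the isotopy through smooth
  -- maps. Outside it the isotopy is locally the identity.
  by_cases h : ∃ j, y ∈ closedCone K j (1 + 2 * ε / 3)
  · obtain ⟨j, hj⟩ := h
    obtain ⟨p, hp, -, rfl⟩ := polarMap_of_mem_closedCone hy (by linarith : _ < 1 + ε) hj
    obtain ⟨g, hg1, hg2, hg3, -⟩ := exists_localInverse_polarMap (K.solidTorus j).smooth hp.1.ne'
      hp.2.1.ne' (hε.det j _ _ hp.norm_lt).ne'
    have ht : Tendsto g (𝓝 (polarMap (K.Ψ j) p)) (𝓝 p) := by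
      have := hg2.continuousAt.tendsto
      rwa [hg1] at this
    have hpo : ∀ᶠ p' in 𝓝 p, IsPolar ε p' := by
      have h1 : ∀ᶠ p' : ℝ × ℝ × ℝ × ℝ in 𝓝 p, 0 < p'.1 :=
        continuous_fst.continuousAt.eventually (lt_mem_nhds hp.1)
      have h2 : ∀ᶠ p' : ℝ × ℝ × ℝ × ℝ in 𝓝 p, 0 < p'.2.2.1 :=
        (continuous_snd.snd.fst.continuousAt (x := p)).eventually (lt_mem_nhds hp.2.1)
      have h3 : ∀ᶠ p' : ℝ × ℝ × ℝ × ℝ in 𝓝 p, p'.2.2.1 < 1 + ε :=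
        (continuous_snd.snd.fst.continuousAt (x := p)).eventually (gt_mem_nhds hp.2.2)
      filter_upwards [h1, h2, h3] with p' h1 h2 h3 using ⟨h1, h2, h3⟩
    have hev : push K ε =ᶠ[𝓝 (τ, polarMap (K.Ψ j) p)] fun q => polarMap (K.Ψ j)
        ((g q.2).1, (g q.2).2.1, collarPush ε q.1 (g q.2).2.2.1, (g q.2).2.2.2) := by
      have h4 := continuous_snd.tendsto (τ, polarMap (K.Ψ j) p)
      filter_upwards [h4.eventually hg3, h4.eventually (ht.eventually hpo)] with q hq1 hq2
      rw [← hε.push_polar hq2 q.1, hq1]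
    refine ContDiffAt.congr_of_eventuallyEq ?_ hev
    refine (contDiff_polarMap (K.solidTorus j).smooth).contDiffAt.comp _ ?_
    have hg : ContDiffAt ℝ ∞ (fun q : ℝ × E4 => g q.2) (τ, polarMap (K.Ψ j) p) :=
      hg2.comp (τ, polarMap (K.Ψ j) p) contDiffAt_snd
    refine hg.fst.prodMk (hg.snd.fst.prodMk (ContDiffAt.prodMk ?_ hg.snd.snd.snd))
    exact (contDiff_collarPush ε).contDiffAt.comp (τ, polarMap (K.Ψ j) p)
      (contDiffAt_fst.prodMk hg.snd.snd.fst)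
  · push Not at h
    have hev : push K ε =ᶠ[𝓝 (τ, y)] Prod.snd := by
      have := eventually_all.2 fun j => hε.eventually_not_mem_closedCone j
        (by linarith : 1 + 2 * ε / 3 < 1 + ε) hy.1 (h j)
      filter_upwards [(continuous_snd.tendsto (τ, y)).eventually this] with q hq
      exact hε.push_of_not_mem hq q.1
    exact contDiffAt_snd.congr_of_eventuallyEq hev

theorem IsCollarWidth.push_ne_zero (hε : IsCollarWidth K ε) {τ : ℝ} (hτ : τ ∈ Icc (0 : ℝ) 1)
    {y : E4} (hy : y ≠ 0) : push K ε (τ, y) ≠ 0 := by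
  by_cases h : ∃ j p, IsPolar ε p ∧ polarMap (K.Ψ j) p = y
  · obtain ⟨j, p, hp, rfl⟩ := h
    rw [hε.push_polar hp]
    have : IsPolar ε (p.1, p.2.1, collarPush ε τ p.2.2.1, p.2.2.2) :=
      ⟨hp.1, collarPush_pos hτ hp.2.1, collarPush_lt hε.pos hτ hp.2.2⟩
    exact smul_ne_zero hp.1.ne' (hε.ne_zero this.norm_lt)
  · rwa [push_of_not h]

/-- The radial projection to the sphere. -/
def radial (y : E4) : E4 := ‖y‖⁻¹ • y

theorem norm_radial {y : E4} (hy : y ≠ 0) : ‖radial y‖ = 1 := by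
  rw [radial, norm_smul, norm_inv, norm_norm, inv_mul_cancel₀ (norm_ne_zero_iff.2 hy)]

theorem radial_mem {y : E4} (hy : y ≠ 0) : radial y ∈ S3 := by simpa [S3] using norm_radial hy

theorem radial_smul {r : ℝ} (hr : 0 < r) (y : E4) : radial (r • y) = radial y := by
  rw [radial, radial, norm_smul, Real.norm_of_nonneg hr.le, mul_inv, smul_smul, mul_right_comm,
    inv_mul_cancel₀ hr.ne', one_mul]

theorem radial_of_mem {x : E4} (hx : x ∈ S3) : radial x = x := by
  rw [radial, norm_eq_one_of_mem_S3 hx, inv_one, one_smul]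

theorem contDiffAt_radial {y : E4} (hy : y ≠ 0) : ContDiffAt ℝ ∞ radial y :=
  ((contDiffAt_norm ℝ hy).inv (norm_ne_zero_iff.2 hy)).smul contDiffAt_id

/-- The isotopy `push`, followed by the radial projection. -/
def retract (K : Configuration m) (ε : ℝ) (q : ℝ × E4) : E4 := radial (push K ε q)

/-- The open set on which `retract` is defined and smooth. -/
def retractDomain (K : Configuration m) (ε : ℝ) : Set (ℝ × E4) :=
  {q | q.2 ∈ coreFree K ∧ push K ε q ≠ 0}

theorem IsCollarWidth.isOpen_retractDomain (hε : IsCollarWidth K ε) :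
    IsOpen (retractDomain K ε) := by
  rw [isOpen_iff_mem_nhds]
  rintro ⟨τ, y⟩ ⟨h1, h2⟩
  filter_upwards [(hε.contDiffAt_push (τ := τ) h1).continuousAt.eventually_ne h2,
    (continuous_snd.tendsto (τ, y)).eventually (hε.isOpen_coreFree.mem_nhds h1)] with q hq1 hq2
  exact ⟨hq2, hq1⟩

theorem IsCollarWidth.contDiffAt_retract (hε : IsCollarWidth K ε) {q : ℝ × E4}
    (hq : q ∈ retractDomain K ε) : ContDiffAt ℝ ∞ (retract K ε) q :=
  (contDiffAt_radial hq.2).comp q (hε.contDiffAt_push (τ := q.1) hq.1)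

theorem mem_M_iff {x : E4} : x ∈ K.M ↔ x ∈ S3 ∧ ∀ j s z, ‖z‖ < 1 → K.Ψ j (s, z) ≠ x := by
  constructor
  · rintro ⟨h1, h2⟩
    exact ⟨h1, fun j s z hz h => h2 (mem_iUnion.2 ⟨j, (s, z), hz, h⟩)⟩
  · rintro ⟨h1, h2⟩
    refine ⟨h1, fun h => ?_⟩
    obtain ⟨j, ⟨s, z⟩, hz, h⟩ := mem_iUnion.1 h
    exact h2 j s z hz h

theorem IsCollarWidth.radial_mem_M (hε : IsCollarWidth K ε) {j : Fin m} {s : ℝ} {z : ℂ}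
    (h1 : 1 ≤ ‖z‖) (h2 : ‖z‖ < 1 + ε) : radial (K.Ψ j (s, z)) ∈ K.M := by
  have hne := hε.ne_zero (j := j) (s := s) h2
  refine mem_M_iff.2 ⟨radial_mem hne, fun i s' z' hz' he => ?_⟩
  rw [radial, ← one_smul ℝ (K.Ψ i (s', z'))] at he
  have := (hε.inj i j _ _ _ _ _ _ one_pos (inv_pos.2 (norm_pos_iff.2 hne))
    (by linarith [hε.pos]) h2 he).2.2.1
  rw [this] at hz'
  linarith

/-- Radii at least 1 stay at least 1 at every time, so the isotopy never enters the open solid tori.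
-/
theorem IsCollarWidth.retract_mem_M (hε : IsCollarWidth K ε) {τ r : ℝ} {x : E4}
    (hτ : τ ∈ Icc (0 : ℝ) 1) (hr : 0 < r) (hx : x ∈ K.M) : retract K ε (τ, r • x) ∈ K.M := by
  by_cases h : ∃ j p, IsPolar ε p ∧ polarMap (K.Ψ j) p = r • x
  · obtain ⟨j, p, hp, he⟩ := h
    have hρ : 1 ≤ p.2.2.1 := by
      by_contra hlt
      have hlt := not_le.1 hlt
      have hn : ‖(p.2.2.1 * circ p.2.2.2 : ℂ)‖ < 1 := by
        rwa [norm_mul, norm_circ, mul_one, Complex.norm_real, Real.norm_of_nonneg hp.2.1.le]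
      have hx' : K.Ψ j (p.2.1, p.2.2.1 * circ p.2.2.2) = x := by
        have e := congrArg radial he
        rw [polarMap, radial_smul hp.1, radial_smul hr, radial_of_mem (mem_M_iff.1 hx).1,
          radial_of_mem ((K.solidTorus j).mem _ _ hn.le)] at e
        exact e
      exact (mem_M_iff.1 hx).2 j _ _ hn hx'
    rw [retract, ← he, hε.push_polar hp, polarMap, radial_smul hp.1]
    refine hε.radial_mem_M ?_ ?_
    · simp only
      rw [norm_mul, norm_circ, mul_one, Complex.norm_real]
      exact (one_le_collarPush hτ hρ).trans (le_abs_self _)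
    · exact IsPolar.norm_lt (p := (p.1, p.2.1, collarPush ε τ p.2.2.1, p.2.2.2))
        ⟨hp.1, collarPush_pos hτ hp.2.1, collarPush_lt hε.pos hτ hp.2.2⟩
  · rw [retract, push_of_not h]
    simp only
    rw [radial_smul hr, radial_of_mem (mem_M_iff.1 hx).1]
    exact hx

/-- At time one every positive radius in the collar region is sent to a radius at least 1. Thus even
points inside the solid tori, off the cores, land in `M`. -/
theorem IsCollarWidth.retract_one_mem_M (hε : IsCollarWidth K ε) {y : E4} (hy : y ∈ coreFree K) :
    retract K ε (1, y) ∈ K.M := by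
  have hτ : (1 : ℝ) ∈ Icc (0 : ℝ) 1 := by simp
  by_cases h : ∃ j p, IsPolar ε p ∧ polarMap (K.Ψ j) p = y
  · obtain ⟨j, p, hp, rfl⟩ := h
    rw [retract, hε.push_polar hp, polarMap, radial_smul hp.1]
    refine hε.radial_mem_M ?_ ?_
    · simp only
      rw [norm_mul, norm_circ, mul_one, Complex.norm_real]
      exact (one_le_collarPush_one hε.pos).trans (le_abs_self _)
    · exact IsPolar.norm_lt (p := (p.1, p.2.1, collarPush ε 1 p.2.2.1, p.2.2.2))
        ⟨hp.1, collarPush_pos hτ hp.2.1, collarPush_lt hε.pos hτ hp.2.2⟩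
  · rw [retract, push_of_not h]
    refine mem_M_iff.2 ⟨radial_mem hy.1, fun j s z hz he => h ?_⟩
    have hcone : y ∈ closedCone K j 1 := by
      refine ⟨‖y‖, norm_pos_iff.2 hy.1, s, z, hz.le, ?_⟩
      rw [he, radial, smul_smul, mul_inv_cancel₀ (norm_ne_zero_iff.2 hy.1), one_smul]
    obtain ⟨p, hp, -, hpy⟩ := polarMap_of_mem_closedCone (ε := ε) hy (by linarith [hε.pos]) hcone
    exact ⟨j, p, hp, hpy⟩

theorem IsCollarWidth.push_zero (hε : IsCollarWidth K ε) (y : E4) : push K ε (0, y) = y := by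
  by_cases h : ∃ j p, IsPolar ε p ∧ polarMap (K.Ψ j) p = y
  · obtain ⟨j, p, hp, rfl⟩ := h
    rw [hε.push_polar hp, collarPush, zero_mul, zero_mul, add_zero]
  · exact push_of_not h

theorem IsCollarWidth.push_knot (hε : IsCollarWidth K ε) (τ t : ℝ) :
    push K ε (τ, K.p t) = K.p t := by
  refine push_of_not ?_
  rintro ⟨j, p, hp, he⟩
  refine hε.knot j p.2.1 (p.2.2.1 * circ p.2.2.2) t 1 p.1 one_pos hp.1 hp.norm_lt ?_
  rw [one_smul]; exact he.symm

theorem IsCollarWidth.push_torus (hε : IsCollarWidth K ε) (τ : ℝ) {j : Fin m} {x : E4}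
    (hx : x ∈ torus (K.Ψ j)) : push K ε (τ, x) = x := by
  obtain ⟨⟨s, z⟩, hz, rfl⟩ := hx
  obtain ⟨θ, hθ⟩ := exists_eq_norm_mul_circ z
  have hz : ‖z‖ = 1 := hz
  have hp : IsPolar ε (1, s, 1, θ) := ⟨one_pos, one_pos, by simpa using hε.pos⟩
  have e : polarMap (K.Ψ j) (1, s, 1, θ) = K.Ψ j (s, z) := by
    rw [polarMap, hθ, hz]; simp
  rw [← e, hε.push_polar hp]
  simp [collarPush]

theorem mem_coreFree {x : E4} (hx : x ∈ K.M) :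
    x ∈ coreFree K := by
  have h0 : x ≠ 0 := by
    rintro rfl
    have := norm_eq_one_of_mem_S3 (mem_M_iff.1 hx).1
    simp at this
  refine ⟨h0, ?_⟩
  rintro j ⟨r, hr, s, z, hz, rfl⟩
  have hz1 : ‖z‖ < 1 := hz.trans_lt one_pos
  refine (mem_M_iff.1 hx).2 j s z hz1 ?_
  have := radial_smul hr (K.Ψ j (s, z))
  rw [radial_of_mem (mem_M_iff.1 hx).1, radial_of_mem ((K.solidTorus j).mem _ _ hz1.le)] at this
  exact this.symm

theorem torus_subset_M (hε : IsCollarWidth K ε) (j : Fin m) : torus (K.Ψ j) ⊆ K.M := by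
  rintro x ⟨⟨s, z⟩, hz, rfl⟩
  have hz : ‖z‖ = 1 := hz
  have := hε.radial_mem_M (j := j) (s := s) hz.ge (by linarith [hε.pos])
  rwa [radial_of_mem ((K.solidTorus j).mem _ _ hz.le)] at this

theorem knot_mem_M (K : Configuration m) (t : ℝ) : K.p t ∈ K.M :=
  mem_M_iff.2 ⟨K.knot.mem t, fun j _ _ hz he => K.disjoint_knot j t ⟨_, le_of_lt hz, he⟩⟩

/-- On the sphere the open solid tori are cut out by the open cones, so `M` is closed in the sphere.
-/
theorem IsCollarWidth.isCompact_M (hε : IsCollarWidth K ε) : IsCompact K.M := by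
  have h : K.M = S3 ∩ ⋂ j, (openCone K j 1)ᶜ := by
    ext x
    rw [mem_M_iff, mem_inter_iff, mem_iInter]
    refine and_congr_right fun hx => ⟨fun h j => ?_, fun h j s z hz he => ?_⟩
    · rintro ⟨r, hr, s, z, hz, rfl⟩
      refine h j s z hz ?_
      have := radial_smul hr (K.Ψ j (s, z))
      rw [radial_of_mem hx, radial_of_mem ((K.solidTorus j).mem _ _ hz.le)] at this
      exact this.symm
    · exact h j ⟨1, one_pos, s, z, hz, by rw [one_smul, he]⟩
  rw [h]
  exact (isCompact_sphere 0 1).inter_right (isClosed_iInter fun j =>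
    (hε.isOpen_openCone j (by linarith [hε.pos])).isClosed_compl)

end

/-! ### Pullback of 2-forms and tangency to the sphere -/

section

section PullTwo

variable {E F G : Type*} [NormedAddCommGroup E] [NormedSpace ℝ E] [NormedAddCommGroup F]
  [NormedSpace ℝ F] [NormedAddCommGroup G] [NormedSpace ℝ G]

variable (E) in
/-- The projection of the bilinear forms onto the alternating forms. -/
def skewPart : ContinuousMultilinearMap ℝ (fun _ : Fin 2 => E) ℝ →L[ℝ] E [⋀^Fin 2]→L[ℝ] ℝ :=
  LinearMap.mkContinuous
    { toFun := fun f => (2⁻¹ : ℝ) • ContinuousMultilinearMap.alternatization f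
      map_add' := fun f g => by rw [map_add, smul_add]
      map_smul' := fun c f => by
        ext v
        change (2⁻¹ : ℝ) * ContinuousMultilinearMap.alternatization (c • f) v
          = c * (2⁻¹ * ContinuousMultilinearMap.alternatization f v)
        rw [mul_left_comm, ContinuousMultilinearMap.alternatization_apply_apply,
          ContinuousMultilinearMap.alternatization_apply_apply]
        congr 1
        rw [Finset.mul_sum]
        refine Finset.sum_congr rfl fun σ _ => ?_
        rw [mul_smul_comm]
        rfl } 1 fun f => by
    refine ContinuousAlternatingMap.opNorm_le_bound _ (by positivity) fun v => ?_
    have h (σ : Equiv.Perm (Fin 2)) : ‖Equiv.Perm.sign σ • f (v ∘ σ)‖ ≤ ‖f‖ * ∏ i, ‖v i‖ := by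
      have h1 : ‖Equiv.Perm.sign σ • f (v ∘ σ)‖ = ‖f (v ∘ σ)‖ := by
        rcases Int.units_eq_one_or (Equiv.Perm.sign σ) with h | h <;> simp [h]
      rw [h1]
      refine (f.le_opNorm _).trans_eq ?_
      rw [← Equiv.prod_comp σ fun i => ‖v i‖]; rfl
    change ‖(2⁻¹ : ℝ) • ContinuousMultilinearMap.alternatization f v‖ ≤ _
    rw [ContinuousMultilinearMap.alternatization_apply_apply, norm_smul]
    have h2 := (norm_sum_le Finset.univ fun σ : Equiv.Perm (Fin 2) =>
      Equiv.Perm.sign σ • f (v ∘ σ)).trans (Finset.sum_le_sum fun σ _ => h σ)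
    rw [Finset.sum_const, Finset.card_univ, Fintype.card_perm, Fintype.card_fin] at h2
    norm_num at h2 ⊢
    linarith

/-- Being a continuous linear left inverse of the inclusion into multilinear forms, `skewPart`
transfers smoothness from the multilinear pullback to the alternating one. -/
theorem skewPart_coe (b : E [⋀^Fin 2]→L[ℝ] ℝ) : skewPart E b.toContinuousMultilinearMap = b := by
  ext v
  change (2⁻¹ : ℝ) • ContinuousMultilinearMap.alternatization b.toContinuousMultilinearMap v = b v
  rw [ContinuousMultilinearMap.alternatization_apply_apply]
  have h (σ : Equiv.Perm (Fin 2)) : Equiv.Perm.sign σ • b.toContinuousMultilinearMap (v ∘ σ)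
      = b v := by
    have := b.toAlternatingMap.map_perm v σ
    change Equiv.Perm.sign σ • b.toAlternatingMap (v ∘ σ) = b v
    rw [this, smul_smul, Int.units_mul_self, one_smul]; rfl
  simp only [h, Finset.sum_const, Finset.card_univ, Fintype.card_perm, Fintype.card_fin]
  simp

/-- The pullback `f^* b` of a `2`-form. -/
def pullTwo (f : E → F) (b : F → F [⋀^Fin 2]→L[ℝ] ℝ) (x : E) : E [⋀^Fin 2]→L[ℝ] ℝ :=
  (b (f x)).compContinuousLinearMap (fderiv ℝ f x)

theorem pullTwo_apply (f : E → F) (b : F → F [⋀^Fin 2]→L[ℝ] ℝ) (x v w : E) :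
    pullTwo f b x ![v, w] = b (f x) ![fderiv ℝ f x v, fderiv ℝ f x w] := by
  rw [pullTwo, ContinuousAlternatingMap.compContinuousLinearMap_apply]
  congr 1
  ext i; fin_cases i <;> rfl

theorem contDiffAt_pullTwo {f : E → F} {b : F → F [⋀^Fin 2]→L[ℝ] ℝ} {x : E}
    (hf : ContDiffAt ℝ ∞ f x) (hb : ContDiffAt ℝ ∞ b (f x)) : ContDiffAt ℝ ∞ (pullTwo f b) x := by
  have h1 : ContDiffAt ℝ ∞ (fderiv ℝ f) x := hf.fderiv_right (m := ∞) (by simp)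
  have h2 : ContDiffAt ℝ ∞ (fun y => (b (f y)).toContinuousMultilinearMap) x :=
    (ContinuousLinearMap.contDiff (ContinuousAlternatingMap.toContinuousMultilinearMapCLM
      (𝕜 := ℝ) (E := F) (F := ℝ) (ι := Fin 2) ℝ)).contDiffAt.comp x (hb.comp x hf)
  have h3 : ContDiffAt ℝ ∞ (fun y =>
      ContinuousMultilinearMap.compContinuousLinearMapContinuousMultilinear ℝ
        (fun _ : Fin 2 => E) (fun _ => F) ℝ (fun _ => fderiv ℝ f y)) x :=
    (ContinuousMultilinearMap.contDiff _).contDiffAt.comp x (contDiffAt_pi.2 fun _ => h1)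
  have h4 := (ContinuousLinearMap.contDiff (skewPart E)).contDiffAt.comp x (h3.clm_apply h2)
  refine h4.congr_of_eventuallyEq (Eventually.of_forall fun y => ?_)
  change _ = skewPart E _
  rw [← skewPart_coe (pullTwo f b y)]
  rfl

theorem extDeriv_pullTwo {f : E → F} {b : F → F [⋀^Fin 2]→L[ℝ] ℝ} {x : E}
    (hf : ContDiffAt ℝ ∞ f x) (hb : DifferentiableAt ℝ b (f x)) (u : Fin 3 → E) :
    extDeriv (pullTwo f b) x u = extDeriv b (f x) (fun i => fderiv ℝ f x (u i)) := by
  have h := extDeriv_pullback hb hf (r := ∞) (by simpa using two_le_infty)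
  change extDeriv (fun x => (b (f x)).compContinuousLinearMap (fderiv ℝ f x)) x u = _
  rw [h]; rfl

theorem norm_pullTwo_le (f : E → F) (b : F → F [⋀^Fin 2]→L[ℝ] ℝ) (x : E) :
    ‖pullTwo f b x‖ ≤ ‖b (f x)‖ * ‖fderiv ℝ f x‖ ^ 2 := by
  simpa [pullTwo] using
    ContinuousAlternatingMap.norm_compContinuousLinearMap_le (b (f x)) (fderiv ℝ f x)

theorem abs_vecTwo_le (b : E [⋀^Fin 2]→L[ℝ] ℝ) (v w : E) : |b ![v, w]| ≤ ‖b‖ * ‖v‖ * ‖w‖ := by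
  have := b.le_opNorm ![v, w]
  simpa [Fin.prod_univ_two, mul_assoc] using this

end PullTwo

theorem mem_tangentS3 {x v : E4} : v ∈ tangentS3 x ↔ inner ℝ x v = 0 := by
  rw [tangentS3, Submodule.mem_orthogonal_singleton_iff_inner_right]

/-- A map with values in the sphere has derivatives tangent to the sphere. -/
theorem fderiv_mem_tangentS3 {E : Type*} [NormedAddCommGroup E] [NormedSpace ℝ E] {f : E → E4}
    {x : E} (hf : DifferentiableAt ℝ f x) (h : ∀ᶠ y in 𝓝 x, f y ∈ S3) (v : E) :
    fderiv ℝ f x v ∈ tangentS3 (f x) := by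
  rw [mem_tangentS3]
  have h1 : (fun y => inner ℝ (f y) (f y)) =ᶠ[𝓝 x] fun _ => (1 : ℝ) := by
    filter_upwards [h] with y hy
    rw [real_inner_self_eq_norm_sq, norm_eq_one_of_mem_S3 hy, one_pow]
  have h2 := h1.fderiv_eq (𝕜 := ℝ)
  have h3 := congrArg (fun L => L v) h2
  simp only [fderiv_fun_const, Pi.zero_apply, zero_apply] at h3
  rw [fderiv_inner_apply ℝ hf hf] at h3
  linarith [real_inner_comm (f x) (fderiv ℝ f x v)]

/-- In directions tangent to the unit sphere the norm has derivative zero, so only the identity part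
of the product rule survives. -/
theorem fderiv_radial {x v : E4} (hx : x ∈ S3) (hv : v ∈ tangentS3 x) :
    fderiv ℝ radial x v = v := by
  have hx1 := norm_eq_one_of_mem_S3 hx
  have hx0 : x ≠ 0 := by rintro rfl; simp at hx1
  have hn : DifferentiableAt ℝ (fun y : E4 => ‖y‖) x := (contDiffAt_norm ℝ hx0 (n := 1)).differentiableAt one_ne_zero
  have hfn : fderiv ℝ (fun y : E4 => ‖y‖) x v = 0 := by
    have h1 : fderiv ℝ (fun y : E4 => ‖y‖ ^ 2) x v = 2 * inner ℝ x v := by simp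
    have h2 : fderiv ℝ (fun y : E4 => ‖y‖ ^ 2) x = _ := fderiv_fun_pow 2 hn
    rw [h2, mem_tangentS3.1 hv] at h1
    simpa [hx1] using h1
  have hni : DifferentiableAt ℝ (fun y : E4 => ‖y‖⁻¹) x := hn.fun_inv (by simp [hx1])
  have hfi : fderiv ℝ (fun y : E4 => ‖y‖⁻¹) x v = 0 := by
    have := (hasDerivAt_inv (x := ‖x‖) (by simp [hx1])).comp_hasFDerivAt x hn.hasFDerivAt
    have h3 : HasFDerivAt (fun y : E4 => ‖y‖⁻¹) _ x := this
    rw [h3.fderiv]; simp [hfn]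
  have h4 : fderiv ℝ radial x = _ := fderiv_fun_smul hni differentiableAt_id
  rw [h4]
  simp [hx1, hfi]

end

/-! ### Extension of a toric form over the solid tori -/

section

variable {m : ℕ} {K : Configuration m} {ε : ℝ} {b : E4 → E4 [⋀^Fin 2]→L[ℝ] ℝ}

/-- A smooth `2`-form which is closed on `M` and vanishes on the tori. -/
structure IsToricForm (K : Configuration m) (b : E4 → E4 [⋀^Fin 2]→L[ℝ] ℝ) : Prop where
  smooth : ContDiff ℝ ∞ b
  closed : ∀ x ∈ K.M, ∀ v : Fin 3 → E4, (∀ i, v i ∈ tangentS3 x) → extDeriv b x v = 0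
  torus : ∀ j s z, ‖z‖ = 1 → ∀ v ∈ tangentTorus (K.Ψ j) s z, ∀ w ∈ tangentTorus (K.Ψ j) s z,
    b (K.Ψ j (s, z)) ![v, w] = 0

theorem IsCollarWidth.mem_retractDomain (hε : IsCollarWidth K ε) {τ : ℝ} {y : E4}
    (hτ : τ ∈ Icc (0 : ℝ) 1) (hy : y ∈ coreFree K) : (τ, y) ∈ retractDomain K ε :=
  ⟨hy, hε.push_ne_zero hτ hy.1⟩

theorem IsCollarWidth.coreFree_subset (hε : IsCollarWidth K ε) :
    coreFree K ⊆ segmentCore (retractDomain K ε) := fun _ hy _ ht => hε.mem_retractDomain ht hy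

theorem IsCollarWidth.eventually_retract_mem (hε : IsCollarWidth K ε) {q : ℝ × E4}
    (hq : q ∈ retractDomain K ε) : ∀ᶠ q' in 𝓝 q, retract K ε q' ∈ S3 := by
  filter_upwards [hε.isOpen_retractDomain.mem_nhds hq] with q' hq' using radial_mem hq'.2

/-- The restriction of a smooth map on `ℝ × E` to `{τ} × E`. -/
theorem fderiv_slice {E F : Type*} [NormedAddCommGroup E] [NormedSpace ℝ E]
    [NormedAddCommGroup F] [NormedSpace ℝ F] {f : ℝ × E → F} {τ : ℝ} {y : E}
    (hf : DifferentiableAt ℝ f (τ, y)) (v : E) :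
    fderiv ℝ (fun y => f (τ, y)) y v = fderiv ℝ f (τ, y) (0, v) := by
  have h1 : HasFDerivAt (fun y : E => (τ, y)) (ContinuousLinearMap.inr ℝ ℝ E) y :=
    hasFDerivAt_prodMk_right τ y
  have h2 : HasFDerivAt (fun y => f (τ, y)) _ y := hf.hasFDerivAt.comp y h1
  rw [h2.fderiv]
  simp

theorem contDiffAt_slice {E F : Type*} [NormedAddCommGroup E] [NormedSpace ℝ E]
    [NormedAddCommGroup F] [NormedSpace ℝ F] {f : ℝ × E → F} {τ : ℝ} {y : E}
    {n : WithTop ℕ∞} (hf : ContDiffAt ℝ n f (τ, y)) : ContDiffAt ℝ n (fun y => f (τ, y)) y :=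
  hf.comp y (contDiffAt_const.prodMk contDiffAt_id)

/-- The difference form of the isotopy of `M` which pushes the collar to the tori. -/
def collarForm (K : Configuration m) (ε : ℝ) (b : E4 → E4 [⋀^Fin 2]→L[ℝ] ℝ) : E4 → E4 →L[ℝ] ℝ :=
  homotopyForm (pullTwo (retract K ε) b) (retractDomain K ε)

open Classical in
/-- The pullback of a `2`-form on `M` under the retraction of `ℝ⁴ ∖ 0` to `M`, which is extended
by zero to the cones over the cores. -/
def pushForm (K : Configuration m) (ε : ℝ) (b : E4 → E4 [⋀^Fin 2]→L[ℝ] ℝ) (y : E4) :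
    E4 [⋀^Fin 2]→L[ℝ] ℝ :=
  if y ∈ coreFree K then pullTwo (fun y => retract K ε (1, y)) b y else 0

theorem IsToricForm.contDiffOn_pull (hb : IsToricForm K b) (hε : IsCollarWidth K ε) :
    ContDiffOn ℝ ∞ (pullTwo (retract K ε) b) (retractDomain K ε) := fun _ hq =>
  (contDiffAt_pullTwo (hε.contDiffAt_retract hq) hb.smooth.contDiffAt).contDiffWithinAt

theorem IsToricForm.contDiffOn_collarForm (hb : IsToricForm K b) (hε : IsCollarWidth K ε) :
    ContDiffOn ℝ 1 (collarForm K ε b) (coreFree K) :=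
  (contDiffOn_homotopyForm hε.isOpen_retractDomain
    ((hb.contDiffOn_pull hε).of_le (one_le_two.trans two_le_infty))).mono hε.coreFree_subset

/-- The homotopy formula from time 0, where the map is the radial projection and changes nothing on
tangent vectors, to time 1. Closedness along `M` suffices because the isotopy keeps `M` invariant
and has sphere-valued image. -/
theorem IsToricForm.dOne_collarForm (hb : IsToricForm K b) (hε : IsCollarWidth K ε) {x v w : E4}
    (hx : x ∈ K.M) (hv : v ∈ tangentS3 x) (hw : w ∈ tangentS3 x) :
    dOne (collarForm K ε b) x v w = pushForm K ε b x ![v, w] - b x ![v, w] := by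
  have hxc := mem_coreFree hx
  have h0 : (0 : ℝ) ∈ Icc (0 : ℝ) 1 := by simp
  have h1 : (1 : ℝ) ∈ Icc (0 : ℝ) 1 := by simp
  have hd {τ : ℝ} (hτ : τ ∈ Icc (0 : ℝ) 1) : ContDiffAt ℝ ∞ (retract K ε) (τ, x) :=
    hε.contDiffAt_retract (hε.mem_retractDomain hτ hxc)
  have hd' {τ : ℝ} (hτ : τ ∈ Icc (0 : ℝ) 1) : DifferentiableAt ℝ (retract K ε) (τ, x) :=
    (hd hτ).differentiableAt (by simp)
  rw [collarForm, dOne_homotopyForm hε.isOpen_retractDomain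
    ((hb.contDiffOn_pull hε).of_le (one_le_two.trans two_le_infty)) (hε.coreFree_subset hxc)]
  · rw [pullTwo_apply, pullTwo_apply, ← fderiv_slice (hd' h0), ← fderiv_slice (hd' h0),
      ← fderiv_slice (hd' h1), ← fderiv_slice (hd' h1), pushForm, if_pos hxc, pullTwo_apply]
    have e : (fun y => retract K ε (0, y)) = radial := by
      ext1 y; rw [retract, hε.push_zero]
    have hS := (mem_M_iff.1 hx).1
    have e0 : retract K ε (0, x) = x := by rw [retract, hε.push_zero, radial_of_mem hS]
    rw [e, fderiv_radial hS hv, fderiv_radial hS hw, e0]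
  · intro t ht
    rw [extDeriv_pullTwo (hd ht) (hb.smooth.differentiable (by simp) _)]
    refine hb.closed _ ?_ _ fun i => ?_
    · have := hε.retract_mem_M ht one_pos hx
      rwa [one_smul] at this
    · exact fderiv_mem_tangentS3 (hd' ht)
        (hε.eventually_retract_mem (hε.mem_retractDomain ht hxc)) _

/-- At a point fixed for all times the time derivative of the isotopy is zero, and the integrand
contracts `b` with that vector. -/
theorem IsToricForm.collarForm_eq_zero (hb : IsToricForm K b) (hε : IsCollarWidth K ε) {x : E4}
    (hx : x ∈ K.M) (hfix : ∀ τ, push K ε (τ, x) = x) : collarForm K ε b x = 0 := by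
  have hxc := mem_coreFree hx
  ext v
  rw [collarForm, homotopyForm_apply (hb.contDiffOn_pull hε).continuousOn (hε.coreFree_subset hxc),
    zero_apply]
  refine (intervalIntegral.integral_congr (g := fun _ => (0 : ℝ)) fun t ht => ?_).trans (by simp)
  rw [uIcc_of_le zero_le_one] at ht
  have hd : DifferentiableAt ℝ (retract K ε) (t, x) :=
    (hε.contDiffAt_retract (hε.mem_retractDomain ht hxc)).differentiableAt (by simp)
  have h1 : HasDerivAt (fun τ : ℝ => (τ, x)) ((1 : ℝ), (0 : E4)) t :=
    (hasDerivAt_id t).prodMk (hasDerivAt_const t x)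
  have h2 : HasDerivAt (fun τ => retract K ε (τ, x)) (fderiv ℝ (retract K ε) (t, x) (1, 0)) t :=
    HasFDerivAt.comp_hasDerivAt (l := retract K ε) t hd.hasFDerivAt h1
  have h3 : (fun τ => retract K ε (τ, x)) = fun _ => radial x := by
    ext1 τ; rw [retract, hfix]
  rw [h3] at h2
  have h4 := h2.unique (hasDerivAt_const t _)
  simp only [timeCoeff]
  rw [pullTwo_apply, h4, vecTwo_swap]
  have := vecTwo_smul (b (retract K ε (t, x))) (fderiv ℝ (retract K ε) (t, x) (0, v)) 0 0
  rw [zero_smul, zero_mul] at this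
  rw [this, neg_zero]

/-- Near the tori and inside of them, `pushForm` vanishes. -/
theorem IsToricForm.pushForm_eq_zero (hb : IsToricForm K b) (hε : IsCollarWidth K ε) {j : Fin m}
    {y : E4} (hy : y ∈ openCone K j (1 + ε / 3)) : pushForm K ε b y = 0 := by
  by_cases hyc : y ∈ coreFree K
  swap
  · rw [pushForm, if_neg hyc]
  have hpos := hε.pos
  rw [pushForm, if_pos hyc]
  obtain ⟨r, hr, s, z, hz, rfl⟩ := hy
  obtain ⟨p, hp, hpc, hpe⟩ := polarMap_of_mem_closedCone hyc (by linarith : ‖z‖ < 1 + ε)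
    ⟨r, hr, s, z, le_rfl, rfl⟩
  rw [← hpe]
  have hlt : p.2.2.1 < 1 + ε / 3 := hpc.trans_lt hz
  obtain ⟨g, hg1, hg2, hg3, -⟩ := exists_localInverse_polarMap (K.solidTorus j).smooth hp.1.ne'
    hp.2.1.ne' (hε.det j _ _ hp.norm_lt).ne'
  have ht : Tendsto g (𝓝 (polarMap (K.Ψ j) p)) (𝓝 p) := by
    have := hg2.continuousAt.tendsto
    rwa [hg1] at this
  have h1 : ∀ᶠ p' : ℝ × ℝ × ℝ × ℝ in 𝓝 p, 0 < p'.1 :=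
    continuous_fst.continuousAt.eventually (lt_mem_nhds hp.1)
  have h2 : ∀ᶠ p' : ℝ × ℝ × ℝ × ℝ in 𝓝 p, 0 < p'.2.2.1 :=
    (continuous_snd.snd.fst.continuousAt (x := p)).eventually (lt_mem_nhds hp.2.1)
  have h3 : ∀ᶠ p' : ℝ × ℝ × ℝ × ℝ in 𝓝 p, p'.2.2.1 < 1 + ε / 3 :=
    (continuous_snd.snd.fst.continuousAt (x := p)).eventually (gt_mem_nhds hlt)
  -- Near this point the time-one map takes values in the torus itself, since the cutoff is 1 up to
  -- radius `1 + ε/3`. Its differential then lies in the tangent plane of the torus, on which `b`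
  -- vanishes.
  have hev : (fun y => retract K ε (1, y)) =ᶠ[𝓝 (polarMap (K.Ψ j) p)]
      fun y => K.Ψ j ((g y).2.1, circ (g y).2.2.2) := by
    filter_upwards [hg3, ht.eventually h1, ht.eventually h2, ht.eventually h3] with y hy hy1 hy2 hy3
    have hpol : IsPolar ε (g y) := ⟨hy1, hy2, by linarith⟩
    rw [retract, ← hy, hε.push_polar hpol, collarPush_one_eq hpos hy3.le, hy, polarMap,
      radial_smul hy1]
    simp only [Complex.ofReal_one, one_mul]
    exact radial_of_mem ((K.solidTorus j).mem _ _ (norm_circ _).le)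
  have hgd : HasFDerivAt g (fderiv ℝ g (polarMap (K.Ψ j) p)) (polarMap (K.Ψ j) p) :=
    (hg2.differentiableAt (by simp)).hasFDerivAt
  have hcirc : HasFDerivAt (fun y => circ (g y).2.2.2) _ (polarMap (K.Ψ j) p) :=
    (hasDerivAt_circ _).hasFDerivAt.comp _ hgd.snd.snd.snd
  have hpair := hgd.snd.fst.prodMk hcirc
  let q₀ : ℝ × ℂ := ((g (polarMap (K.Ψ j) p)).2.1, circ (g (polarMap (K.Ψ j) p)).2.2.2)
  have hΨd : HasFDerivAt (K.Ψ j) (fderiv ℝ (K.Ψ j) q₀) q₀ :=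
    ((K.solidTorus j).smooth.differentiable (by simp) q₀).hasFDerivAt
  have hder := (HasFDerivAt.comp (g := K.Ψ j) (polarMap (K.Ψ j) p) hΨd hpair).congr_of_eventuallyEq hev
  have hval : retract K ε (1, polarMap (K.Ψ j) p) = K.Ψ j (p.2.1, circ p.2.2.2) := by
    have := hev.self_of_nhds
    simp only [hg1] at this
    exact this
  have hmem (v : E4) : fderiv ℝ (fun y => retract K ε (1, y)) (polarMap (K.Ψ j) p) v
      ∈ tangentTorus (K.Ψ j) p.2.1 (circ p.2.2.2) := by
    rw [hder.fderiv]
    simp only [q₀, hg1]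
    generalize fderiv ℝ g (polarMap (K.Ψ j) p) = A
    rw [tangentTorus, Submodule.mem_span_pair]
    refine ⟨(A v).2.1, (A v).2.2.2 * (2 * Real.pi), ?_⟩
    rw [← map_smul, ← map_smul, ← map_add]
    simp only [ContinuousLinearMap.comp_apply]
    congr 1
    ext1
    · simp
    · simp
      ring
  refine ContinuousAlternatingMap.ext fun v => ?_
  have e : v = ![v 0, v 1] := by ext i; fin_cases i <;> rfl
  rw [e, pullTwo_apply, hval, hb.torus j _ _ (norm_circ _) _ (hmem _) _ (hmem _)]
  rfl

theorem IsCollarWidth.mem_openCone_of_not_mem (hε : IsCollarWidth K ε) {y : E4} (hy : y ≠ 0)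
    (hyc : y ∉ coreFree K) : ∃ j, y ∈ openCone K j (1 + ε / 3) := by
  have : ∃ j, y ∈ closedCone K j 0 := by
    by_contra h
    exact hyc ⟨hy, not_exists.1 h⟩
  obtain ⟨j, r, hr, s, z, hz, rfl⟩ := this
  exact ⟨j, r, hr, s, z, by linarith [hε.pos], rfl⟩

theorem IsToricForm.contDiffAt_pushForm (hb : IsToricForm K b) (hε : IsCollarWidth K ε) {y : E4}
    (hy : y ≠ 0) : ContDiffAt ℝ ∞ (pushForm K ε b) y := by
  by_cases hyc : y ∈ coreFree K
  · have h := hε.contDiffAt_retract (hε.mem_retractDomain (τ := 1) (by simp) hyc)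
    refine (contDiffAt_pullTwo (contDiffAt_slice h) hb.smooth.contDiffAt).congr_of_eventuallyEq ?_
    filter_upwards [hε.isOpen_coreFree.mem_nhds hyc] with y' hy'
    rw [pushForm, if_pos hy']
  · obtain ⟨j, hj⟩ := hε.mem_openCone_of_not_mem hy hyc
    refine (contDiffAt_const (c := 0)).congr_of_eventuallyEq ?_
    filter_upwards [(hε.isOpen_openCone j (by linarith [hε.pos])).mem_nhds hj] with y' hy'
    exact hb.pushForm_eq_zero hε hy'

/-- Off the cores this is a pullback by a map into `M`, where `b` is closed on tangent vectors. Near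
the cores the form is identically zero. -/
theorem IsToricForm.extDeriv_pushForm (hb : IsToricForm K b) (hε : IsCollarWidth K ε) {y : E4}
    (hy : y ≠ 0) : extDeriv (pushForm K ε b) y = 0 := by
  by_cases hyc : y ∈ coreFree K
  · have hm := hε.mem_retractDomain (τ := 1) (by simp) hyc
    have h := hε.contDiffAt_retract hm
    have hev : pushForm K ε b =ᶠ[𝓝 y] pullTwo (fun y => retract K ε (1, y)) b := by
      filter_upwards [hε.isOpen_coreFree.mem_nhds hyc] with y' hy'
      rw [pushForm, if_pos hy']
    rw [hev.extDeriv_eq]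
    ext v
    rw [extDeriv_pullTwo (contDiffAt_slice h) (hb.smooth.differentiable (by simp) _)]
    refine hb.closed _ (hε.retract_one_mem_M hyc) _ fun i => ?_
    rw [fderiv_slice (h.differentiableAt (by simp))]
    exact fderiv_mem_tangentS3 (h.differentiableAt (by simp)) (hε.eventually_retract_mem hm) _
  · obtain ⟨j, hj⟩ := hε.mem_openCone_of_not_mem hy hyc
    have hev : pushForm K ε b =ᶠ[𝓝 y] 0 := by
      filter_upwards [(hε.isOpen_openCone j (by linarith [hε.pos])).mem_nhds hj] with y' hy'
      exact hb.pushForm_eq_zero hε hy'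
    rw [hev.extDeriv_eq, extDeriv, fderiv_zero]
    exact map_zero (ContinuousAlternatingMap.alternatizeUncurryFinCLM ℝ E4 ℝ)

end

/-! ### Primitives on the complement of a ray -/

section

variable {m : ℕ} {K : Configuration m} {ε : ℝ} {b : E4 → E4 [⋀^Fin 2]→L[ℝ] ℝ}

/-- The integral of a closed `1`-form along a path in a convex set, in terms of a potential. -/
theorem exists_potential {E F : Type*} [NormedAddCommGroup E] [NormedSpace ℝ E]
    [NormedAddCommGroup F] [NormedSpace ℝ F] {U : Set E}
    (hU : Convex ℝ U) (hUo : IsOpen U) {Φ : E → F} (hΦ : ContDiff ℝ ∞ Φ)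
    {a : F → F →L[ℝ] ℝ} (ha : ∀ x ∈ U, ContDiffAt ℝ 1 a (Φ x))
    (hclosed : ∀ x ∈ U, ∀ v w, dOne (pullOne Φ a) x v w = 0) :
    ∃ f : E → ℝ, (∀ x ∈ U, HasFDerivAt f (pullOne Φ a x) x) ∧
      ∀ (g : ℝ → E) (c' : ℝ → F), (∀ t ∈ Icc (0 : ℝ) 1, g t ∈ U) → (∀ t, DifferentiableAt ℝ g t) →
        (∀ t, HasDerivAt (fun t => Φ (g t)) (c' t) t) → Continuous c' →
        ∫ t in (0 : ℝ)..1, a (Φ (g t)) (c' t) = f (g 1) - f (g 0) := by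
  have h1 (x : E) (hx : x ∈ U) : ContDiffAt ℝ 1 (pullOne Φ a) x :=
    contDiffAt_pullOne (hΦ.contDiffAt.of_le two_le_infty) (ha x hx)
  obtain ⟨f, hf⟩ := hU.exists_forall_hasFDerivAt_of_fderiv_symmetric hUo
    (fun x hx => ((h1 x hx).differentiableAt one_ne_zero).differentiableWithinAt)
    (fun x hx v w => sub_eq_zero.1 (hclosed x hx v w))
  refine ⟨f, hf, fun g c' hg hd hc hc' => ?_⟩
  refine intervalIntegral.integral_eq_sub_of_hasDerivAt (f := fun t => f (g t)) ?_ ?_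
  · intro t ht
    rw [uIcc_of_le zero_le_one] at ht
    have h2 := HasFDerivAt.comp_hasDerivAt (l := f) t (hf _ (hg t ht)) (hd t).hasDerivAt
    have h3 := HasFDerivAt.comp_hasDerivAt (l := Φ) t
      (hΦ.differentiable (by simp) (g t)).hasFDerivAt (hd t).hasDerivAt
    have h4 : c' t = fderiv ℝ Φ (g t) (deriv g t) := (hc t).unique h3
    rw [h4]
    exact h2
  · refine ContinuousOn.intervalIntegrable ?_
    rw [uIcc_of_le zero_le_one]
    refine ContinuousOn.clm_apply (fun t ht => ?_) hc'.continuousOn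
    exact ((ha _ (hg t ht)).continuousAt.comp (f := fun t => Φ (g t))
      (hc t).continuousAt).continuousWithinAt

/-- The contraction of `ℝ⁴` to the point `-q`. -/
def coneContract (q : E4) (p : ℝ × E4) : E4 := -q + p.1 • (p.2 + q)

theorem contDiff_coneContract (q : E4) : ContDiff ℝ ∞ (coneContract q) := by
  unfold coneContract; fun_prop

theorem fderiv_coneContract (q : E4) (t : ℝ) (x : E4) (r : ℝ) (v : E4) :
    fderiv ℝ (coneContract q) (t, x) (r, v) = r • (x + q) + t • v := by
  have h : HasFDerivAt (coneContract q) _ (t, x) :=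
    ((hasFDerivAt_fst (𝕜 := ℝ) (p := (t, x))).smul
      ((hasFDerivAt_snd (𝕜 := ℝ) (p := (t, x))).add_const q)).const_add (-q)
  rw [h.fderiv]
  simp [add_comm]

/-- The domain of the contraction of `ℝ⁴ ∖ 0`. -/
def contractDomain (q : E4) : Set (ℝ × E4) := {p | coneContract q p ≠ 0}

theorem isOpen_contractDomain (q : E4) : IsOpen (contractDomain q) :=
  isOpen_ne.preimage (contDiff_coneContract q).continuous

/-- The complement of the closed ray from the origin through `q` is star-shaped about `-q`: the
segment from `-q` to `x` meets the origin only if `x` is a nonnegative multiple of `q`. -/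
theorem mem_segmentCore_contract {q x : E4} (hq : q ≠ 0) (hx : ∀ c : ℝ, 0 ≤ c → x ≠ c • q) :
    x ∈ segmentCore (contractDomain q) := by
  intro t ht h
  simp only [coneContract] at h
  rcases ht.1.eq_or_lt with h0 | h0
  · rw [← h0] at h
    simp [hq] at h
  · refine hx ((1 - t) / t) (div_nonneg (by linarith [ht.2]) h0.le) ?_
    have h2 : t • x = (1 - t) • q := by
      rw [smul_add] at h
      rw [sub_smul, one_smul]
      rw [← sub_eq_zero, ← h]; module
    rw [div_eq_inv_mul, mul_smul, ← h2, smul_smul, inv_mul_cancel₀ h0.ne', one_smul]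

/-- The primitive of `pushForm` on the complement of the ray through `q`. -/
def conePrimitive (K : Configuration m) (ε : ℝ) (q : E4) (b : E4 → E4 [⋀^Fin 2]→L[ℝ] ℝ) :
    E4 → E4 →L[ℝ] ℝ :=
  homotopyForm (pullTwo (coneContract q) (pushForm K ε b)) (contractDomain q)

theorem IsToricForm.contDiffOn_pullCone (hb : IsToricForm K b) (hε : IsCollarWidth K ε) (q : E4) :
    ContDiffOn ℝ 1 (pullTwo (coneContract q) (pushForm K ε b)) (contractDomain q) := fun _ hp =>
  ((contDiffAt_pullTwo (contDiff_coneContract q).contDiffAt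
    (hb.contDiffAt_pushForm hε hp)).of_le (one_le_two.trans two_le_infty)).contDiffWithinAt

theorem IsToricForm.contDiffOn_conePrimitive (hb : IsToricForm K b) (hε : IsCollarWidth K ε)
    (q : E4) : ContDiffOn ℝ 1 (conePrimitive K ε q b) (segmentCore (contractDomain q)) :=
  contDiffOn_homotopyForm (isOpen_contractDomain q) (hb.contDiffOn_pullCone hε q)

/-- The Poincaré lemma for the contraction to `-q`: at time 0 the map is constant and pulls the form
back to zero, at time 1 it is the identity. -/
theorem IsToricForm.dOne_conePrimitive (hb : IsToricForm K b) (hε : IsCollarWidth K ε)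
    {q x : E4} (hx : x ∈ segmentCore (contractDomain q)) (v w : E4) :
    dOne (conePrimitive K ε q b) x v w = pushForm K ε b x ![v, w] := by
  rw [conePrimitive, dOne_homotopyForm (isOpen_contractDomain q) (hb.contDiffOn_pullCone hε q) hx]
  · rw [pullTwo_apply, pullTwo_apply]
    simp only [fderiv_coneContract]
    have e : coneContract q (1, x) = x := by simp [coneContract]
    have e0 := vecTwo_smul (pushForm K ε b (coneContract q (0, x))) 0 0 0
    simp only [zero_smul, zero_mul] at e0
    simp only [e, zero_smul, one_smul, zero_add, e0, sub_zero]
  · intro t ht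
    rw [extDeriv_pullTwo (contDiff_coneContract q).contDiffAt
      ((hb.contDiffAt_pushForm hε (hx t ht)).differentiableAt (by simp)),
      hb.extDeriv_pushForm hε (hx t ht)]
    rfl

/-- A bound for the primitive on a compact set, uniform in the form. -/
theorem IsCollarWidth.exists_bound (hε : IsCollarWidth K ε) {q : E4} {Y : Set E4}
    (hY : IsCompact Y) (hYq : Y ⊆ segmentCore (contractDomain q)) :
    ∃ B : ℝ, 0 ≤ B ∧ ∀ b, IsToricForm K b → ∀ C, 0 ≤ C → (∀ x ∈ K.M, ‖b x‖ ≤ C) → ∀ x ∈ Y, ∀ v,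
      |conePrimitive K ε q b x v| ≤ B * C * ‖v‖ := by
  -- The differential of the retraction is controlled only on compact sets off the cores. Removing
  -- the cones on which the form vanishes anyway leaves such a set.
  let Z : Set E4 := coneContract q '' (Icc 0 1 ×ˢ Y) ∩ ⋂ j, (openCone K j (1 + ε / 3))ᶜ
  have hZ : IsCompact Z :=
    ((isCompact_Icc.prod hY).image (contDiff_coneContract q).continuous).inter_right
      (isClosed_iInter fun j => (hε.isOpen_openCone j (by linarith [hε.pos])).isClosed_compl)
  have hne : ∀ y ∈ coneContract q '' (Icc 0 1 ×ˢ Y), y ≠ 0 := by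
    rintro _ ⟨⟨t, x⟩, ⟨ht, hx⟩, rfl⟩
    exact hYq hx t ht
  have hZc : Z ⊆ coreFree K := by
    rintro y ⟨hy1, hy2⟩
    by_contra hyc
    obtain ⟨j, hj⟩ := hε.mem_openCone_of_not_mem (hne y hy1) hyc
    exact mem_iInter.1 hy2 j hj
  have hcont : ContinuousOn (fun y => fderiv ℝ (fun y => retract K ε (1, y)) y) Z := fun y hy =>
    ((contDiffAt_slice (hε.contDiffAt_retract (hε.mem_retractDomain (τ := 1) (by simp)
      (hZc hy)))).continuousAt_fderiv (by simp)).continuousWithinAt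
  obtain ⟨B₀, hB₀⟩ := hZ.exists_bound_of_continuousOn hcont
  obtain ⟨B₁, hB₁⟩ := hY.exists_bound_of_continuousOn
    (f := fun x : E4 => x + q) (by fun_prop)
  -- `B₀` bounds the differential of the retraction, which enters in both slots of the form; `B₁`
  -- bounds the velocity `x + q` of the contraction.
  refine ⟨B₀ ^ 2 * |B₁|, by positivity, fun b hb C hC hbC x hx v => ?_⟩
  have hpush : ∀ y ∈ coneContract q '' (Icc 0 1 ×ˢ Y), ‖pushForm K ε b y‖ ≤ C * B₀ ^ 2 := by
    intro y hy
    by_cases h : ∃ j, y ∈ openCone K j (1 + ε / 3)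
    · obtain ⟨j, hj⟩ := h
      rw [hb.pushForm_eq_zero hε hj, norm_zero]
      positivity
    · have hyZ : y ∈ Z := ⟨hy, mem_iInter.2 fun j hj => h ⟨j, hj⟩⟩
      rw [pushForm, if_pos (hZc hyZ)]
      refine (norm_pullTwo_le _ _ _).trans ?_
      have h1 := hB₀ y hyZ
      have h2 := hbC _ (hε.retract_one_mem_M (hZc hyZ))
      gcongr
  rw [conePrimitive, homotopyForm_apply (hb.contDiffOn_pullCone hε q).continuousOn (hYq hx),
    ← Real.norm_eq_abs]
  refine (intervalIntegral.norm_integral_le_of_norm_le_const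
    (C := B₀ ^ 2 * |B₁| * C * ‖v‖) fun t ht => ?_).trans (by simp)
  rw [uIoc_of_le zero_le_one] at ht
  rw [timeCoeff, pullTwo_apply, fderiv_coneContract, fderiv_coneContract]
  simp only [one_smul, smul_zero, add_zero, zero_smul, zero_add, vecTwo_smul]
  rw [norm_mul, Real.norm_of_nonneg ht.1.le, Real.norm_eq_abs]
  have h1 := abs_vecTwo_le (pushForm K ε b (coneContract q (t, x))) (x + q) v
  have h2 := hpush _ ⟨(t, x), ⟨⟨ht.1.le, ht.2⟩, hx⟩, rfl⟩
  have h3 := (hB₁ x hx).trans (le_abs_self B₁)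
  have h4 : ‖pushForm K ε b (coneContract q (t, x))‖ * ‖x + q‖ * ‖v‖
      ≤ (C * B₀ ^ 2) * |B₁| * ‖v‖ := by gcongr
  calc t * _ ≤ 1 * _ := by gcongr; exact ht.2
    _ ≤ _ := by rw [one_mul]; refine (h1.trans h4).trans_eq (by ring)

/-- The ray in generic direction near the knot, which avoids the cones over the given surfaces. -/
theorem IsCollarWidth.exists_ray (hε : IsCollarWidth K ε) {u : ℕ → ℂ → E4}
    (hu : ∀ k, ContDiff ℝ ∞ (u k)) : ∃ q : E4, q ≠ 0 ∧
      (∀ j, q ∉ closedCone K j (1 + 2 * ε / 3)) ∧ (∀ k z (c : ℝ), q ≠ c • u k z) ∧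
      ∀ t (c : ℝ), q ≠ c • K.p t := by
  let f : ℕ → ℝ × ℂ → E4 := fun k x => x.1 • u k x.2
  let g : ℝ × ℝ → E4 := fun x => x.1 • K.p x.2
  have hf (k : ℕ) : ContDiff ℝ 1 (f k) := by
    have := (hu k).of_le (one_le_two.trans two_le_infty)
    fun_prop
  have hg : ContDiff ℝ 1 g := by
    have := K.knot.smooth.of_le (one_le_two.trans two_le_infty)
    fun_prop
  -- The cone over a surface is a `C¹` image of a three-dimensional space and the cone over the knot
  -- of a two-dimensional one. A countable union keeps the dimension below four, so the complement
  -- is dense.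
  have hdim : dimH ((⋃ k, range (f k)) ∪ range g) < Module.finrank ℝ E4 := by
    rw [dimH_union, dimH_iUnion, finrank_E4]
    have h1 (k : ℕ) : dimH (range (f k)) ≤ ((3 : ℕ) : ℝ≥0∞) := by
      refine (hf k).dimH_range_le.trans ?_
      rw [Module.finrank_prod, Complex.finrank_real_complex, Module.finrank_self]
    have h2 : dimH (range g) ≤ ((3 : ℕ) : ℝ≥0∞) := by
      refine hg.dimH_range_le.trans ?_
      rw [Module.finrank_prod, Module.finrank_self]
      norm_num
    exact (max_le (iSup_le h1) h2).trans_lt (by norm_num)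
  have hdense := dense_compl_of_dimH_lt_finrank hdim
  have hp0 : K.p 0 ≠ 0 := by
    intro h
    have := norm_eq_one_of_mem_S3 (K.knot.mem 0)
    rw [h] at this
    simp at this
  -- Points of the knot lie off the enlarged solid tori, so a neighbourhood of `K.p 0` is open room
  -- for a generic direction.
  have hev : ∀ᶠ y in 𝓝 (K.p 0), y ≠ 0 ∧ ∀ j, y ∉ closedCone K j (1 + 2 * ε / 3) := by
    refine (isOpen_ne.eventually_mem hp0).and (eventually_all.2 fun j =>
      hε.eventually_not_mem_closedCone j (by linarith [hε.pos]) hp0 ?_)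
    rintro ⟨r, hr, s, z, hz, he⟩
    refine hε.knot j s z 0 1 r one_pos hr (by linarith [hε.pos]) ?_
    rw [one_smul, he]
  obtain ⟨q, hq3, hq1, hq2⟩ := hdense.inter_nhds_nonempty hev
  refine ⟨q, hq1, hq2, fun k z c h => hq3 ?_, fun t c h => hq3 ?_⟩
  · exact Or.inl (mem_iUnion.2 ⟨k, (c, z), h.symm⟩)
  · exact Or.inr ⟨(c, t), h.symm⟩

end

/-! ### Primitives that vanish on contractible boundary loops -/

section

variable {m : ℕ} {K : Configuration m} {ε : ℝ} {b : E4 → E4 [⋀^Fin 2]→L[ℝ] ℝ}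

/-- The `1`-form `a` on `V` is a primitive on `M` of the `2`-form `b`; its integrals over the
contractible loops in the solid tori which stay on their boundaries vanish. -/
structure IsToricPrimitive (K : Configuration m) (V : Set E4) (b : E4 → E4 [⋀^Fin 2]→L[ℝ] ℝ)
    (a : E4 → E4 →L[ℝ] ℝ) : Prop where
  contDiffOn : ContDiffOn ℝ 1 a V
  dOne_eq : ∀ x ∈ K.M, x ∈ V → ∀ v ∈ tangentS3 x, ∀ w ∈ tangentS3 x, dOne a x v w = b x ![v, w]
  loop : ∀ j, ∀ (σ : ℝ → ℝ) (ζ : ℝ → ℂ) (c' : ℝ → E4), (∀ t, DifferentiableAt ℝ σ t) →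
    (∀ t, DifferentiableAt ℝ ζ t) → (∀ t, ‖ζ t‖ = 1) → σ 1 = σ 0 → ζ 1 = ζ 0 →
    (∀ t, HasDerivAt (fun t => K.Ψ j (σ t, ζ t)) (c' t) t) → Continuous c' →
    ∫ t in (0 : ℝ)..1, a (K.Ψ j (σ t, ζ t)) (c' t) = 0

/-- The primitive is `conePrimitive` minus `collarForm`: their differentials are the extended form
and the extended form minus `b`. The domain `V` and the constant `B` come from a single ray and
precede the choice of `b`, which is where uniformity along the sequence originates. -/
theorem exists_toricPrimitives (hε : IsCollarWidth K ε) {u : ℕ → ℂ → E4}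
    (hu : ∀ k, ContDiff ℝ ∞ (u k)) : ∃ (V : Set E4) (B : ℝ), IsOpen V ∧ 0 ≤ B ∧
      (∀ k z, u k z ∈ K.M → u k z ∈ V) ∧ (∀ t, K.p t ∈ V) ∧
      ∀ b, IsToricForm K b → ∃ a, IsToricPrimitive K V b a ∧
        ∀ C, 0 ≤ C → (∀ x ∈ K.M, ‖b x‖ ≤ C) → ∀ t v, |a (K.p t) v| ≤ B * C * ‖v‖ := by
  have hpos := hε.pos
  obtain ⟨q, hq0, hqc, hqu, hqp⟩ := hε.exists_ray hu
  have hcore {x : E4} (hx0 : x ≠ 0) (h : ∀ c : ℝ, q ≠ c • x) :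
      x ∈ segmentCore (contractDomain q) := by
    refine mem_segmentCore_contract hq0 fun c hc he => ?_
    rcases hc.eq_or_lt with h0 | h0
    · rw [← h0, zero_smul] at he
      exact hx0 he
    · refine h c⁻¹ ?_
      rw [he, smul_smul, inv_mul_cancel₀ h0.ne', one_smul]
  have hM0 {x : E4} (hx : x ∈ K.M) : x ≠ 0 := (mem_coreFree hx).1
  have hp (t : ℝ) : K.p t ∈ segmentCore (contractDomain q) := hcore (hM0 (knot_mem_M K t)) (hqp t)
  have hYc : IsCompact (range K.p) := by
    have hper : Function.Periodic K.p 1 := K.knot.periodic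
    rw [← hper.image_Icc zero_lt_one 0]
    exact isCompact_Icc.image K.knot.smooth.continuous
  obtain ⟨B, hB, hbound⟩ := hε.exists_bound hYc (q := q) (by rintro _ ⟨t, rfl⟩; exact hp t)
  have hVo := isOpen_segmentCore (isOpen_contractDomain q)
  refine ⟨coreFree K ∩ segmentCore (contractDomain q), B, hε.isOpen_coreFree.inter hVo, hB,
    fun k z hz => ⟨mem_coreFree hz, hcore (hM0 hz) (hqu k z)⟩,
    fun t => ⟨mem_coreFree (knot_mem_M K t), hp t⟩, fun b hb => ?_⟩
  refine ⟨fun x => conePrimitive K ε q b x - collarForm K ε b x, ⟨?_, ?_, ?_⟩, ?_⟩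
  · exact ((hb.contDiffOn_conePrimitive hε q).mono inter_subset_right).sub
      ((hb.contDiffOn_collarForm hε).mono inter_subset_left)
  · intro x hx hxV v hv w hw
    rw [dOne_sub, hb.dOne_conePrimitive hε hxV.2, hb.dOne_collarForm hε hx hv hw]
    · ring
    · exact ((hb.contDiffOn_conePrimitive hε q).contDiffAt (hVo.mem_nhds hxV.2)).differentiableAt
        one_ne_zero
    · exact ((hb.contDiffOn_collarForm hε).contDiffAt
        (hε.isOpen_coreFree.mem_nhds hxV.1)).differentiableAt one_ne_zero
  · intro j σ ζ c' hσ hζ hn h1 h2 hc hc'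
    -- The universal cover of an enlarged solid torus is convex and the extended form vanishes over
    -- it. The primitive is thus exact there, and the loop closes up already in this cover.
    let U : Set (ℝ × ℂ) := univ ×ˢ Metric.ball 0 (1 + ε / 3)
    have hU : Convex ℝ U := convex_univ.prod (convex_ball _ _)
    have hUo : IsOpen U := isOpen_univ.prod Metric.isOpen_ball
    have hmem (x : ℝ × ℂ) (hx : x ∈ U) : ‖x.2‖ < 1 + ε / 3 := by simpa using hx.2
    have hmem' (x : ℝ × ℂ) (hx : x ∈ U) : K.Ψ j x ∈ segmentCore (contractDomain q) := by
      have hx' := hmem x hx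
      have hne : K.Ψ j x ≠ 0 := hε.ne_zero (s := x.1) (z := x.2) (by linarith)
      refine mem_segmentCore_contract hq0 fun c hc he => hqc j ?_
      rcases hc.eq_or_lt with h0 | h0
      · rw [← h0, zero_smul] at he
        exact absurd he hne
      · refine ⟨c⁻¹, inv_pos.2 h0, x.1, x.2, by linarith, ?_⟩
        rw [he, smul_smul, inv_mul_cancel₀ h0.ne', one_smul]
    have hsm (x : ℝ × ℂ) (hx : x ∈ U) : ContDiffAt ℝ 1 (conePrimitive K ε q b) (K.Ψ j x) :=
      (hb.contDiffOn_conePrimitive hε q).contDiffAt (hVo.mem_nhds (hmem' x hx))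
    have hΨ := (K.solidTorus j).smooth
    obtain ⟨f, -, hf⟩ := exists_potential hU hUo hΨ hsm fun x hx v w => by
      rw [dOne_pullOne (hΨ.contDiffAt.of_le two_le_infty)
        ((hsm x hx).differentiableAt one_ne_zero), hb.dOne_conePrimitive hε (hmem' x hx),
        hb.pushForm_eq_zero hε (j := j) ⟨1, one_pos, x.1, x.2, hmem x hx, by simp⟩]
      rfl
    have h3 := hf (fun t => (σ t, ζ t)) c' (fun t _ => ⟨mem_univ _, by simp [hn t]; positivity⟩)
      (fun t => (hσ t).prodMk (hζ t)) hc hc'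
    simp only [h1, h2, sub_self] at h3
    refine Eq.trans (intervalIntegral.integral_congr fun t _ => ?_) h3
    have hT : K.Ψ j (σ t, ζ t) ∈ torus (K.Ψ j) := ⟨(σ t, ζ t), hn t, rfl⟩
    rw [hb.collarForm_eq_zero hε (torus_subset_M hε j hT) fun τ => hε.push_torus τ hT, sub_zero]
  · intro C hC hbC t v
    simp only
    rw [hb.collarForm_eq_zero hε (knot_mem_M K t) fun τ => hε.push_knot τ t, sub_zero]
    exact hbound b hb C hC hbC _ ⟨t, rfl⟩ v

end

/-! ### Lifting boundary loops to the universal cover of a torus -/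

section

variable {m : ℕ} {K : Configuration m} {ε : ℝ}

theorem eq_of_continuous_of_int {X : Type*} [TopologicalSpace X] [PreconnectedSpace X] {f : X → ℝ}
    (hf : Continuous f) (h : ∀ x, ∃ n : ℤ, f x = n) (x y : X) : f x = f y := by
  choose n hn using h
  have hc : Continuous n := by
    rw [Int.isClosedEmbedding_coe_real.isEmbedding.continuous_iff]
    have : (fun z : ℤ => (z : ℝ)) ∘ n = f := by ext x; exact (hn x).symm
    rwa [this]
  rw [hn, hn, PreconnectedSpace.constant inferInstance hc]

/-- A continuous map from the plane to the circle lifts to the line. -/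
theorem exists_lift_addCircle {f : ℝ × ℝ → UnitAddCircle} (hf : Continuous f) :
    ∃ g : ℝ × ℝ → ℝ, Continuous g ∧ ∀ x, (g x : UnitAddCircle) = f x := by
  have hcov := AddCircle.isCoveringMap_coe (1 : ℝ)
  obtain ⟨e₀, he₀⟩ := QuotientAddGroup.mk_surjective (f 0)
  obtain ⟨F, ⟨-, hF⟩, -⟩ := hcov.existsUnique_continuousMap_lifts (f := ⟨f, hf⟩) (a₀ := 0)
    (e₀ := e₀) he₀
  exact ⟨F, F.continuous, fun x => congrFun hF x⟩

/-- A continuous map from the plane to a torus lifts to the universal cover. -/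
theorem IsSolidTorus.exists_lift {Ψ : ℝ × ℂ → E4} (hΨ : IsSolidTorus Ψ) {H : ℝ × ℝ → E4}
    (hH : Continuous H) (hmem : ∀ x, H x ∈ torus Ψ) :
    ∃ σ θ : ℝ × ℝ → ℝ, Continuous σ ∧ Continuous θ ∧ ∀ x, H x = Ψ (σ x, circ (θ x)) := by
  let Q : ℝ × ℝ → UnitAddCircle × UnitAddCircle := Prod.map (fun s => (s : UnitAddCircle)) fun s => s
  have hQ : IsOpenQuotientMap Q :=
    QuotientAddGroup.isOpenQuotientMap_mk.prodMap QuotientAddGroup.isOpenQuotientMap_mk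
  let e : ℝ × ℝ → E4 := fun x => Ψ (x.1, circ x.2)
  have he : Continuous e := hΨ.smooth.continuous.comp
    (continuous_fst.prodMk (contDiff_circ.continuous.comp continuous_snd))
  have hint {s t : ℝ} (h : (s : UnitAddCircle) = t) : ∃ n : ℤ, t = s + n := by
    obtain ⟨n, hn⟩ := (AddCircle.coe_eq_zero_iff (1 : ℝ) (x := t - s)).1
      (by rw [AddCircle.coe_sub, h, sub_self])
    refine ⟨n, ?_⟩
    rw [zsmul_eq_mul, mul_one] at hn
    linarith
  have hfac {x y : ℝ × ℝ} (h : Q x = Q y) : e x = e y := by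
    obtain ⟨n, hn⟩ := hint (congrArg Prod.fst h)
    obtain ⟨n', hn'⟩ := hint (congrArg Prod.snd h)
    simp only [e]
    rw [hn, hn', hΨ.add_int, circ_add_int]
  let E : UnitAddCircle × UnitAddCircle → E4 := fun y => e (Function.surjInv hQ.surjective y)
  have hE (x : ℝ × ℝ) : E (Q x) = e x := hfac (Function.surjInv_eq hQ.surjective _)
  have hEc : Continuous E := by
    rw [hQ.isQuotientMap.continuous_iff]
    have : E ∘ Q = e := funext hE
    rwa [this]
  have hEi : Function.Injective E := by
    intro y y' h
    obtain ⟨x, rfl⟩ := hQ.surjective y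
    obtain ⟨x', rfl⟩ := hQ.surjective y'
    rw [hE, hE] at h
    obtain ⟨h1, n, hn⟩ := hΨ.injective _ _ _ _ (norm_circ _).le (norm_circ _).le h
    obtain ⟨n', hn'⟩ := circ_eq_circ h1
    refine Prod.ext ?_ ?_
    · change (x.1 : UnitAddCircle) = x'.1
      rw [hn]; simp
    · change (x.2 : UnitAddCircle) = x'.2
      rw [hn']; simp
  have hemb := (hEc.isClosedEmbedding hEi).isEmbedding
  have hH' (x : ℝ × ℝ) : ∃ y, E y = H x := by
    obtain ⟨⟨s, z⟩, hz, hx⟩ := hmem x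
    obtain ⟨θ, hθ⟩ := exists_eq_norm_mul_circ z
    have hz : ‖z‖ = 1 := hz
    refine ⟨Q (s, θ), ?_⟩
    rw [hE, ← hx, hθ, hz]
    simp [e]
  choose G hG using hH'
  have hGc : Continuous G := by
    rw [hemb.continuous_iff]
    have : E ∘ G = H := funext hG
    rwa [this]
  obtain ⟨σ, hσ, hσ'⟩ := exists_lift_addCircle (continuous_fst.comp hGc)
  obtain ⟨θ, hθ, hθ'⟩ := exists_lift_addCircle (continuous_snd.comp hGc)
  refine ⟨σ, θ, hσ, hθ, fun x => ?_⟩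
  have : Q (σ x, θ x) = G x := Prod.ext (hσ' x) (hθ' x)
  rw [← hG, ← this, hE]

/-- A smooth loop on a torus which is homotopic to a negative meridian, in coordinates. -/
theorem IsSolidTorus.exists_meridian_lift {Ψ : ℝ × ℂ → E4} (hΨ : IsSolidTorus Ψ)
    {h : ℝ × ℝ → E4} (hc : ContinuousOn h (Icc 0 1 ×ˢ univ))
    (hmem : ∀ r ∈ Icc (0 : ℝ) 1, ∀ t, h (r, t) ∈ torus Ψ ∧ h (r, t + 1) = h (r, t))
    (h1 : ∀ t, h (1, t) = Ψ (0, circ (-t))) (h0 : ContDiff ℝ ∞ fun t => h (0, t)) :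
    ∃ σ θ : ℝ → ℝ, (∀ t, DifferentiableAt ℝ σ t) ∧ (∀ t, DifferentiableAt ℝ θ t) ∧
      (∀ t, σ (t + 1) = σ t) ∧ (∀ t, θ (t + 1) = θ t - 1) ∧ ∀ t, h (0, t) = Ψ (σ t, circ (θ t)) := by
  let P : ℝ → ℝ := fun r => projIcc 0 1 zero_le_one r
  have hP : Continuous P := continuous_subtype_val.comp continuous_projIcc
  have hPm (r : ℝ) : P r ∈ Icc (0 : ℝ) 1 := (projIcc 0 1 zero_le_one r).2
  have hP0 : P 0 = 0 := by simp [P]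
  have hP1 : P 1 = 1 := by simp [P]
  have hH : Continuous fun x : ℝ × ℝ => h (P x.1, x.2) :=
    hc.comp_continuous ((hP.comp continuous_fst).prodMk continuous_snd)
      fun x => ⟨hPm _, mem_univ _⟩
  obtain ⟨σ, θ, hσ, hθ, hlift⟩ := hΨ.exists_lift hH fun x => (hmem _ (hPm x.1) x.2).1
  have hinj {s s' t t' : ℝ} (he : Ψ (s, circ t) = Ψ (s', circ t')) :
      (∃ n : ℤ, s' = s + n) ∧ ∃ n : ℤ, t' = t + n := by
    obtain ⟨e1, e2⟩ := hΨ.injective _ _ _ _ (norm_circ _).le (norm_circ _).le he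
    exact ⟨e2, circ_eq_circ e1⟩
  have hper (x : ℝ × ℝ) : Ψ (σ x, circ (θ x))
      = Ψ (σ (x.1, x.2 + 1), circ (θ (x.1, x.2 + 1))) := by
    rw [← hlift, ← hlift, (hmem _ (hPm x.1) x.2).2]
  have hend (t : ℝ) : Ψ (0, circ (-t)) = Ψ (σ (1, t), circ (θ (1, t))) := by
    rw [← h1, ← hlift, hP1]
  have hsh : Continuous fun x : ℝ × ℝ => (x.1, x.2 + 1) := by fun_prop
  have hl : Continuous fun t : ℝ => ((1 : ℝ), t) := by fun_prop
  -- Periodicity of the homotopy changes each lifted coordinate by an integer, which is constant by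
  -- connectedness. Its value is read off at the end `r = 1`, where `σ` and `θ + t` are constant.
  have a1 := eq_of_continuous_of_int (f := fun x => σ (x.1, x.2 + 1) - σ x)
    ((hσ.comp hsh).sub hσ) fun x => by
      obtain ⟨⟨n, hn⟩, -⟩ := hinj (hper x)
      exact ⟨n, by simp only [hn]; ring⟩
  have a2 := eq_of_continuous_of_int (f := fun x => θ (x.1, x.2 + 1) - θ x)
    ((hθ.comp hsh).sub hθ) fun x => by
      obtain ⟨-, n, hn⟩ := hinj (hper x)
      exact ⟨n, by simp only [hn]; ring⟩
  have b1 := eq_of_continuous_of_int (f := fun t => σ (1, t)) (hσ.comp hl) fun t => by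
      obtain ⟨⟨n, hn⟩, -⟩ := hinj (hend t)
      exact ⟨n, by simp only [hn]; ring⟩
  have b2 := eq_of_continuous_of_int (f := fun t => θ (1, t) + t) ((hθ.comp hl).add continuous_id)
    fun t => by
      obtain ⟨-, n, hn⟩ := hinj (hend t)
      exact ⟨n, by simp only [hn]; ring⟩
  have hc0 (t : ℝ) : h (0, t) = Ψ (σ (0, t), circ (θ (0, t))) := by rw [← hlift, hP0]
  have hdiff (t : ℝ) : DifferentiableAt ℝ (fun t => σ (0, t)) t ∧
      DifferentiableAt ℝ (fun t => θ (0, t)) t := by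
    -- The covering lift is only continuous. A local inverse of the polar map expresses its
    -- coordinates through the smooth loop and so makes them differentiable.
    obtain ⟨g, -, hg2, -, hg4⟩ := exists_localInverse_polarMap hΨ.smooth
      (p := (1, σ (0, t), 1, θ (0, t))) one_ne_zero one_ne_zero
      (hΨ.oriented _ _ (by simp [norm_circ])).ne'
    have hpol (t : ℝ) : polarMap Ψ (1, σ (0, t), 1, θ (0, t)) = h (0, t) := by
      rw [hc0, polarMap]; simp
    rw [hpol] at hg2
    have hgd : DifferentiableAt ℝ (fun t => g (h (0, t))) t :=
      (hg2.differentiableAt (by simp)).comp t (h0.differentiable (by simp) t)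
    have hl0 : Continuous fun t : ℝ => ((0 : ℝ), t) := by fun_prop
    have hcont : Continuous fun t => ((1 : ℝ), σ (0, t), (1 : ℝ), θ (0, t)) :=
      continuous_const.prodMk ((hσ.comp hl0).prodMk (continuous_const.prodMk (hθ.comp hl0)))
    have hev : ∀ᶠ t' in 𝓝 t, g (h (0, t')) = (1, σ (0, t'), 1, θ (0, t')) := by
      filter_upwards [(hcont.tendsto t).eventually hg4] with t' ht'
      rwa [hpol] at ht'
    refine ⟨hgd.snd.fst.congr_of_eventuallyEq ?_, hgd.snd.snd.snd.congr_of_eventuallyEq ?_⟩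
    · filter_upwards [hev] with t' ht'
      rw [ht']
    · filter_upwards [hev] with t' ht'
      rw [ht']
  refine ⟨fun t => σ (0, t), fun t => θ (0, t), fun t => (hdiff t).1, fun t => (hdiff t).2,
    fun t => ?_, fun t => ?_, hc0⟩
  · have c1 := a1 (0, t) (1, 0)
    have c2 := b1 (0 + 1) 0
    simp only at c1 c2
    linarith
  · have c1 := a2 (0, t) (1, 0)
    have c2 := b2 (0 + 1) 0
    simp only at c1 c2
    linarith

end

/-! ### The equation `ι_X dλ = 0` -/

section

variable {m : ℕ} {K : Configuration m} {ε : ℝ} {M : Set E4} {H : HamData}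

/-- The component tangential to the concentric spheres of a vector field. -/
def tangentialPart (X : E4 → E4) (y : E4) : E4 := X y - (inner ℝ y (X y) / ‖y‖ ^ 2) • y

theorem inner_tangentialPart (X : E4 → E4) (y : E4) : inner ℝ y (tangentialPart X y) = 0 := by
  rw [tangentialPart, inner_sub_right, inner_smul_right, real_inner_self_eq_norm_sq]
  rcases eq_or_ne y 0 with rfl | h
  · simp
  · rw [div_mul_cancel₀ _ (by simpa using h), sub_self]

theorem contDiffAt_tangentialPart {X : E4 → E4} (hX : ContDiff ℝ ∞ X) {y : E4} (hy : y ≠ 0) :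
    ContDiffAt ℝ 1 (tangentialPart X) y := by
  have hX1 : ContDiff ℝ 1 X := hX.of_le (one_le_two.trans two_le_infty)
  have h1 : ContDiffAt ℝ 1 (fun y => inner ℝ y (X y)) y := contDiffAt_id.inner ℝ hX1.contDiffAt
  have h2 : ContDiffAt ℝ 1 (fun y : E4 => ‖y‖ ^ 2) y := contDiffAt_id.norm_sq ℝ
  exact hX1.contDiffAt.sub ((h1.div h2 (by simpa using hy)).smul contDiffAt_id)

/-- Integral curves of `X` through interior points of `M`, and the linearized flow along them. -/
theorem exists_linearizedFlow (hX : ContDiff ℝ ∞ H.X) (htan : ∀ x ∈ M, H.X x ∈ tangentS3 x)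
    {x₀ : E4} (hx₀ : x₀ ∈ S3) (hM : ∀ᶠ y in 𝓝 x₀, y ∈ S3 → y ∈ M) (v₀ : E4) :
    ∃ δ > 0, ∃ x v : ℝ → E4, IsLinearizedFlow M H.X (Ioo (-δ) δ) x v ∧ x 0 = x₀ ∧ v 0 = v₀ := by
  have hne : x₀ ≠ 0 := by
    rintro rfl
    simpa using norm_eq_one_of_mem_S3 hx₀
  -- The extension of `X` need not be tangent to spheres away from `M`. Its tangential part keeps
  -- integral curves on the sphere and agrees with `X` on `M`.
  let f : E4 × E4 → E4 × E4 := fun p => (tangentialPart H.X p.1, fderiv ℝ H.X p.1 p.2)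
  have hf : ContDiffAt ℝ 1 f (x₀, v₀) := by
    refine ContDiffAt.prodMk (ContDiffAt.comp (g := tangentialPart H.X) (x₀, v₀)
      (contDiffAt_tangentialPart hX hne) contDiffAt_fst) ?_
    have h1 : ContDiff ℝ 1 (fderiv ℝ H.X) := hX.fderiv_right (m := 1) (by
      rw [one_add_one_eq_two]; exact two_le_infty)
    exact ((h1.comp contDiff_fst).clm_apply contDiff_snd).contDiffAt
  obtain ⟨α, hα0, δ, hδ, hα⟩ :=
    hf.exists_forall_mem_closedBall_exists_eq_forall_mem_Ioo_hasDerivAt₀ 0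
  simp only [zero_sub, zero_add] at hα
  have hd1 (t : ℝ) (ht : t ∈ Ioo (-δ) δ) :
      HasDerivAt (fun t => (α t).1) (tangentialPart H.X (α t).1) t := (hα t ht).fst
  have hd2 (t : ℝ) (ht : t ∈ Ioo (-δ) δ) :
      HasDerivAt (fun t => (α t).2) (fderiv ℝ H.X (α t).1 (α t).2) t := (hα t ht).snd
  have h0 : (0 : ℝ) ∈ Ioo (-δ) δ := ⟨by linarith, hδ⟩
  have hnd (t : ℝ) (ht : t ∈ Ioo (-δ) δ) : HasDerivAt (fun t => ‖(α t).1‖ ^ 2) 0 t := by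
    have := (hd1 t ht).norm_sq
    rwa [inner_tangentialPart, mul_zero] at this
  have hS (t : ℝ) (ht : t ∈ Ioo (-δ) δ) : (α t).1 ∈ S3 := by
    have h1 := isOpen_Ioo.is_const_of_deriv_eq_zero isPreconnected_Ioo
      (fun t ht => (hnd t ht).differentiableAt.differentiableWithinAt)
      (fun t ht => (hnd t ht).deriv) ht h0
    simp only [hα0] at h1
    rw [norm_eq_one_of_mem_S3 hx₀, one_pow] at h1
    simpa [S3] using (pow_eq_one_iff_of_nonneg (norm_nonneg _) two_ne_zero).1 h1
  have hcont : Tendsto (fun t => (α t).1) (𝓝 0) (𝓝 x₀) := by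
    have := (hd1 0 h0).continuousAt.tendsto
    rwa [hα0] at this
  obtain ⟨δ', hδ', hball⟩ := Metric.eventually_nhds_iff.1 (hcont.eventually hM)
  refine ⟨min δ δ', lt_min hδ hδ', fun t => (α t).1, fun t => (α t).2, fun t ht => ?_,
    by simp only [hα0], by simp only [hα0]⟩
  have ht1 : t ∈ Ioo (-δ) δ :=
    ⟨by linarith [ht.1, min_le_left δ δ'], ht.2.trans_le (min_le_left _ _)⟩
  have hmem : (α t).1 ∈ M := by
    refine hball ?_ (hS t ht1)
    rw [dist_zero_right, Real.norm_eq_abs, abs_lt]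
    exact ⟨by linarith [ht.1, min_le_right δ δ'], ht.2.trans_le (min_le_right _ _)⟩
  refine ⟨hmem, ?_, hd2 t ht1⟩
  have h1 := hd1 t ht1
  rwa [tangentialPart, mem_tangentS3.1 (htan _ hmem), zero_div, zero_smul, sub_zero] at h1

/-- Invariance of `ξ` and the normalization `λ(X) = 1` each give a first-order identity containing
`λ(DX w)`; subtracting them leaves `dλ(X, w)` for `w` in `ξ`. The direction `X` contributes nothing
by antisymmetry. -/
theorem IsStableHamiltonian.dOne_lam_interior (h : IsStableHamiltonian M H) {x₀ v₀ : E4}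
    (hx₀ : x₀ ∈ S3) (hM : ∀ᶠ y in 𝓝 x₀, y ∈ S3 → y ∈ M) (hv₀ : v₀ ∈ tangentS3 x₀) :
    dOne H.lam x₀ (H.X x₀) v₀ = 0 := by
  have hx₀M : x₀ ∈ M := hM.self_of_nhds hx₀
  have hne : x₀ ≠ 0 := by
    rintro rfl
    simpa using norm_eq_one_of_mem_S3 hx₀
  have hlam : HasFDerivAt H.lam (fderiv ℝ H.lam x₀) x₀ :=
    (h.smooth_lam.differentiable (by simp) x₀).hasFDerivAt
  have hXd : HasFDerivAt H.X (fderiv ℝ H.X x₀) x₀ :=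
    (h.smooth_X.differentiable (by simp) x₀).hasFDerivAt
  have key : ∀ w ∈ H.xi x₀, dOne H.lam x₀ (H.X x₀) w = 0 := by
    intro w hw
    obtain ⟨δ, hδ, x, v, hflow, hx0, hv0⟩ :=
      exists_linearizedFlow h.smooth_X h.tangent hx₀ hM w
    have h0 : (0 : ℝ) ∈ Ioo (-δ) δ := ⟨by linarith, hδ⟩
    have hpres := h.flow_preserves δ hδ x v hflow (by rw [hx0, hv0]; exact hw)
    obtain ⟨-, hxd, hvd⟩ := hflow 0 h0
    -- Differentiation at time zero of `λ(v) = 0` along the linearized flow.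
    have e1 : HasDerivAt (fun t => H.lam (x t)) (fderiv ℝ H.lam x₀ (H.X x₀)) 0 := by
      have := HasFDerivAt.comp_hasDerivAt (l := H.lam) (f := x) 0 (by rw [hx0]; exact hlam) hxd
      rwa [hx0] at this
    have e2 := e1.clm_apply hvd
    have e3 : (fun t => H.lam (x t) (v t)) =ᶠ[𝓝 0] fun _ => (0 : ℝ) := by
      filter_upwards [Ioo_mem_nhds h0.1 h0.2] with t ht
      exact (hpres t ht).2
    have e4 := (e2.congr_of_eventuallyEq e3.symm).unique (hasDerivAt_const 0 0)
    -- A curve on the sphere in direction `w`, along which `λ(X) = 1` is differentiated.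
    have hcurve : HasDerivAt (fun t : ℝ => radial (x₀ + t • w)) w 0 := by
      have a1 : HasDerivAt (fun t : ℝ => x₀ + t • w) w 0 := by
        simpa using ((hasDerivAt_id (0 : ℝ)).smul_const w).const_add x₀
      have a2 : HasFDerivAt radial (fderiv ℝ radial x₀) (x₀ + (0 : ℝ) • w) := by
        rw [zero_smul, add_zero]
        exact ((contDiffAt_radial hne).differentiableAt (by simp)).hasFDerivAt
      have a3 := HasFDerivAt.comp_hasDerivAt (l := radial) 0 a2 a1
      rwa [fderiv_radial hx₀ hw.1] at a3
    have hc0 : radial (x₀ + (0 : ℝ) • w) = x₀ := by rw [zero_smul, add_zero, radial_of_mem hx₀]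
    have f1 := HasFDerivAt.comp_hasDerivAt (l := H.lam) (f := fun t : ℝ => radial (x₀ + t • w)) 0
      (by rw [hc0]; exact hlam) hcurve
    have f2 := HasFDerivAt.comp_hasDerivAt (l := H.X) (f := fun t : ℝ => radial (x₀ + t • w)) 0
      (by rw [hc0]; exact hXd) hcurve
    have f3 := f1.clm_apply f2
    have f4 : (fun t : ℝ => H.lam (radial (x₀ + t • w)) (H.X (radial (x₀ + t • w))))
        =ᶠ[𝓝 0] fun _ => (1 : ℝ) := by
      have hc := hcurve.continuousAt.tendsto
      rw [hc0] at hc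
      have hne' : ∀ᶠ t : ℝ in 𝓝 0, x₀ + t • w ≠ 0 := by
        have : Continuous fun t : ℝ => x₀ + t • w := by fun_prop
        refine this.continuousAt.eventually_ne ?_
        simpa using hne
      filter_upwards [hc.eventually hM, hne'] with t ht1 ht2
      exact h.lam_X _ (ht1 (radial_mem ht2))
    have f5 := (f3.congr_of_eventuallyEq f4.symm).unique (hasDerivAt_const 0 1)
    simp only [Function.comp_apply, hc0, hx0, hv0] at e4 f5
    rw [dOne]
    linarith
  have hw : v₀ - H.lam x₀ v₀ • H.X x₀ ∈ H.xi x₀ := by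
    refine ⟨sub_mem hv₀ (Submodule.smul_mem _ _ (h.tangent _ hx₀M)), ?_⟩
    change H.lam x₀ (v₀ - H.lam x₀ v₀ • H.X x₀) = 0
    rw [map_sub, map_smul, h.lam_X _ hx₀M, smul_eq_mul, mul_one, sub_self]
  have := key _ hw
  simp only [dOne, map_sub, map_smul, sub_apply, smul_apply, smul_eq_mul] at this ⊢
  linarith

/-- The Reeb type equation `ι_X dλ = 0` on `M`. -/
theorem IsStableHamiltonian.dOne_lam_X (hε : IsCollarWidth K ε) (h : IsStableHamiltonian K.M H)
    {x v : E4} (hx : x ∈ K.M) (hv : v ∈ tangentS3 x) : dOne H.lam x (H.X x) v = 0 := by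
  have hint {y : E4} (hy : y ∈ S3) (hn : ∀ j, y ∉ solid (K.Ψ j)) :
      ∀ᶠ y' in 𝓝 y, y' ∈ S3 → y' ∈ K.M := by
    have hy0 : y ≠ 0 := by
      rintro rfl
      simpa using norm_eq_one_of_mem_S3 hy
    have := eventually_all.2 fun j => hε.eventually_not_mem_closedCone j (c := 1)
      (by linarith [hε.pos]) hy0 (by
        rintro ⟨r, hr, s, z, hz, he⟩
        refine hn j ⟨(s, z), hz, ?_⟩
        have e := radial_smul hr (K.Ψ j (s, z))
        rw [← he, radial_of_mem hy, radial_of_mem ((K.solidTorus j).mem _ _ hz)] at e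
        exact e.symm)
    filter_upwards [this] with y' hy' hS
    exact mem_M_iff.2 ⟨hS, fun j s z hz he =>
      hy' j ⟨1, one_pos, s, z, hz.le, by rw [one_smul, he]⟩⟩
  have hxS := (mem_M_iff.1 hx).1
  by_cases hn : ∀ j, x ∉ solid (K.Ψ j)
  · exact h.dOne_lam_interior hxS (hint hxS hn) hv
  push Not at hn
  obtain ⟨j, ⟨s, z⟩, hz, rfl⟩ := hn
  have hz1 : ‖z‖ = 1 := le_antisymm hz (not_lt.1 fun hlt => (mem_M_iff.1 hx).2 j s z hlt rfl)
  let y : ℝ → E4 := fun ρ => radial (K.Ψ j (s, ρ • z))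
  have hy1 : y 1 = K.Ψ j (s, z) := by simp only [y, one_smul]; exact radial_of_mem hxS
  have hyc : ContinuousAt y 1 := by
    refine ContinuousAt.comp (g := radial) ?_ ?_
    · rw [one_smul]
      exact (contDiffAt_radial (mem_coreFree hx).1).continuousAt
    · exact ((K.solidTorus j).smooth.continuous.comp (by fun_prop)).continuousAt
  have hdl : Continuous (fderiv ℝ H.lam) := h.smooth_lam.continuous_fderiv (by simp)
  -- The flow argument needs room inside `M`, so boundary points are reached as limits of interior
  -- ones. On the sphere the argument of `g` is the tangential projection of `v`, which makes the
  -- function continuous and leaves `v` itself unchanged at the limit.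
  let g : E4 → ℝ := fun x' => dOne H.lam x' (H.X x') (v - (inner ℝ x' v : ℝ) • x')
  have hg : Continuous g := by
    have h1 : Continuous fun x' : E4 => v - (inner ℝ x' v : ℝ) • x' := by fun_prop
    exact ((hdl.clm_apply h.smooth_X.continuous).clm_apply h1).sub
      ((hdl.clm_apply h1).clm_apply h.smooth_X.continuous)
  have hgy : Tendsto (fun ρ => g (y ρ)) (𝓝[>] 1) (𝓝 (g (y 1))) :=
    ((hg.continuousAt.comp hyc).tendsto).mono_left nhdsWithin_le_nhds
  have hzero : (fun ρ => g (y ρ)) =ᶠ[𝓝[>] 1] fun _ => 0 := by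
    filter_upwards [Ioo_mem_nhdsGT (by linarith [hε.pos] : (1 : ℝ) < 1 + ε)] with ρ hρ
    have hnorm : ‖(ρ • z : ℂ)‖ = ρ := by
      rw [norm_smul, hz1, mul_one, Real.norm_of_nonneg (by linarith [hρ.1])]
    have hne := hε.ne_zero (j := j) (s := s) (z := ρ • z) (by rw [hnorm]; exact hρ.2)
    have hyS : y ρ ∈ S3 := radial_mem hne
    refine h.dOne_lam_interior hyS (hint hyS fun i => ?_) ?_
    · rintro ⟨⟨s', z'⟩, hz', he⟩
      have hz' : ‖z'‖ ≤ 1 := hz'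
      simp only [y] at he
      rw [radial, ← one_smul ℝ (K.Ψ i (s', z'))] at he
      have := (hε.inj i j _ _ _ _ _ _ one_pos (inv_pos.2 (norm_pos_iff.2 hne))
        (by linarith [hε.pos]) (by rw [hnorm]; exact hρ.2) he).2.2.1
      rw [this, hnorm] at hz'
      linarith [hρ.1]
    · rw [mem_tangentS3, inner_sub_right, inner_smul_right, real_inner_self_eq_norm_sq,
        norm_eq_one_of_mem_S3 hyS]
      ring
  have h2 := tendsto_nhds_unique hgy ((tendsto_congr' hzero).2 tendsto_const_nhds)
  rw [hy1] at h2
  simp only [g] at h2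
  rwa [mem_tangentS3.1 hv, zero_smul, sub_zero] at h2

end

/-! ### Restriction of `ω` and `λ` to the tori -/

section

variable {m : ℕ} {K : Configuration m} {ε : ℝ} {M : Set E4} {H : HamData}

/-- An alternating form on a plane whose kernel contains a nonzero vector vanishes. -/
theorem eq_zero_on_span_pair {V : Type*} [AddCommGroup V] [Module ℝ V] {B : V →ₗ[ℝ] V →ₗ[ℝ] ℝ}
    (hB : ∀ v w, B v w = - B w v) {a b X : V} (hX : X ∈ Submodule.span ℝ {a, b}) (hX0 : X ≠ 0)
    (hBX : ∀ v ∈ Submodule.span ℝ {a, b}, B X v = 0) {v w : V}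
    (hv : v ∈ Submodule.span ℝ {a, b}) (hw : w ∈ Submodule.span ℝ {a, b}) : B v w = 0 := by
  have haa (v : V) : B v v = 0 := by linarith [hB v v]
  have hba := hB b a
  have ha := hBX a (Submodule.subset_span (by simp))
  have hb := hBX b (Submodule.subset_span (by simp))
  obtain ⟨x, y, rfl⟩ := Submodule.mem_span_pair.1 hX
  have h0 : B a b = 0 := by
    by_contra hne
    simp only [map_add, map_smul, LinearMap.add_apply, LinearMap.smul_apply, smul_eq_mul, haa,
      hba] at ha hb
    have hy : y = 0 := by
      by_contra hy
      exact mul_ne_zero hy hne (by linarith)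
    have hx : x = 0 := by
      by_contra hx
      exact mul_ne_zero hx hne (by linarith)
    exact hX0 (by rw [hx, hy]; simp)
  obtain ⟨p, q, rfl⟩ := Submodule.mem_span_pair.1 hv
  obtain ⟨p', q', rfl⟩ := Submodule.mem_span_pair.1 hw
  simp only [map_add, map_smul, LinearMap.add_apply, LinearMap.smul_apply, smul_eq_mul, haa,
    hba, h0]
  ring

/-- A `2`-form as a bilinear map. -/
def twoBilin (b : E4 [⋀^Fin 2]→L[ℝ] ℝ) : E4 →ₗ[ℝ] E4 →ₗ[ℝ] ℝ :=
  LinearMap.mk₂ ℝ (fun v w => b ![v, w])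
    (fun v v' w => by rw [vecTwo_swap, vecTwo_add, vecTwo_swap b v, vecTwo_swap b v']; ring)
    (fun c v w => by rw [vecTwo_swap, vecTwo_smul, vecTwo_swap b v, smul_eq_mul]; ring)
    (fun v w w' => vecTwo_add b v w w') (fun c v w => vecTwo_smul b v c w)

/-- The exterior derivative of a `1`-form at a point as a bilinear map. -/
def dOneBilin (a : E4 → E4 →L[ℝ] ℝ) (x : E4) : E4 →ₗ[ℝ] E4 →ₗ[ℝ] ℝ :=
  LinearMap.mk₂ ℝ (fun v w => dOne a x v w)
    (fun v v' w => by simp [dOne]; ring) (fun c v w => by simp [dOne]; ring)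
    (fun v w w' => by simp [dOne]; ring) (fun c v w => by simp [dOne]; ring)

/-- The parametrization of the torus by the plane. -/
def torusMap (Ψ : ℝ × ℂ → E4) (x : ℝ × ℝ) : E4 := Ψ (x.1, circ x.2)

theorem IsSolidTorus.contDiff_torusMap {Ψ : ℝ × ℂ → E4} (h : IsSolidTorus Ψ) :
    ContDiff ℝ ∞ (torusMap Ψ) :=
  h.smooth.comp (contDiff_fst.prodMk (contDiff_circ.comp contDiff_snd))

theorem IsSolidTorus.fderiv_torusMap {Ψ : ℝ × ℂ → E4} (h : IsSolidTorus Ψ) (x v : ℝ × ℝ) :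
    fderiv ℝ (torusMap Ψ) x v = v.1 • fderiv ℝ Ψ (x.1, circ x.2) (1, 0)
      + (v.2 * (2 * Real.pi)) • fderiv ℝ Ψ (x.1, circ x.2) (0, Complex.I * circ x.2) := by
  have h1 : HasFDerivAt (fun x : ℝ × ℝ => circ x.2) _ x :=
    (hasDerivAt_circ x.2).hasFDerivAt.comp x hasFDerivAt_snd
  have h2 : HasFDerivAt (fun x : ℝ × ℝ => (x.1, circ x.2)) _ x := hasFDerivAt_fst.prodMk h1
  have h3 : HasFDerivAt (torusMap Ψ) _ x :=
    HasFDerivAt.comp (g := Ψ) x (h.smooth.differentiable (by simp) _).hasFDerivAt h2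
  rw [h3.fderiv, ← map_smul, ← map_smul, ← map_add, ContinuousLinearMap.comp_apply]
  congr 1
  ext1
  · simp
  · simp
    ring

theorem IsSolidTorus.fderiv_torusMap_mem {Ψ : ℝ × ℂ → E4} (h : IsSolidTorus Ψ) (x v : ℝ × ℝ) :
    fderiv ℝ (torusMap Ψ) x v ∈ tangentTorus Ψ x.1 (circ x.2) := by
  rw [h.fderiv_torusMap, tangentTorus, Submodule.mem_span_pair]
  exact ⟨v.1, v.2 * (2 * Real.pi), rfl⟩

theorem IsSolidTorus.tangentTorus_le {Ψ : ℝ × ℂ → E4} (h : IsSolidTorus Ψ) (s θ : ℝ) :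
    tangentTorus Ψ s (circ θ) ≤ tangentS3 (Ψ (s, circ θ)) := by
  have hS (v : ℝ × ℝ) : fderiv ℝ (torusMap Ψ) (s, θ) v ∈ tangentS3 (Ψ (s, circ θ)) :=
    fderiv_mem_tangentS3 (f := torusMap Ψ) (x := (s, θ))
      (h.contDiff_torusMap.differentiable (by simp) (s, θ)) (Eventually.of_forall fun y => h.mem _ _ (norm_circ _).le) v
  rw [tangentTorus, Submodule.span_le]
  rintro v (rfl | rfl)
  · simpa [h.fderiv_torusMap] using hS (1, 0)
  · have h1 := hS (0, (2 * Real.pi)⁻¹)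
    rw [h.fderiv_torusMap] at h1
    simp only [inv_mul_cancel₀ Real.two_pi_pos.ne', zero_smul, zero_add, one_smul] at h1
    exact h1

theorem IsSolidTorus.torusMap_mem {Ψ : ℝ × ℂ → E4} (x : ℝ × ℝ) : torusMap Ψ x ∈ torus Ψ :=
  ⟨(x.1, circ x.2), norm_circ _, rfl⟩

theorem IsStableHamiltonian.X_ne_zero (h : IsStableHamiltonian M H) {x : E4} (hx : x ∈ M) :
    H.X x ≠ 0 := by
  intro h0
  have := h.lam_X x hx
  rw [h0, map_zero] at this
  exact zero_ne_one this

/-- The tangent plane of a torus contains `X`, which lies in the kernel of `ω`; an alternating form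
on a plane with nontrivial kernel is zero. -/
theorem IsStableHamiltonian.isToricForm (hε : IsCollarWidth K ε) (h : IsStableHamiltonian K.M H)
    (hs : SatisfiesSetup K H) : IsToricForm K H.omega where
  smooth := h.smooth_omega
  closed := h.closed
  torus := by
    intro j s z hz v hv w hw
    obtain ⟨θ, hθ⟩ := exists_eq_norm_mul_circ z
    rw [hz, Complex.ofReal_one, one_mul] at hθ
    subst hθ
    have hM := torus_subset_M hε j (IsSolidTorus.torusMap_mem (s, θ))
    exact eq_zero_on_span_pair (B := twoBilin (H.omega (K.Ψ j (s, circ θ))))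
      (fun v w => vecTwo_swap _ v w) (hs.tangent_torus j s _ hz) (h.X_ne_zero hM)
      (fun v hv => h.omega_X _ hM v ((K.solidTorus j).tangentTorus_le s θ hv)) hv hw

/-- The same kernel argument for `dλ`, using `ι_X dλ = 0`: the restriction of `λ` to a torus is
closed. -/
theorem IsStableHamiltonian.dOne_lam_torus (hε : IsCollarWidth K ε)
    (h : IsStableHamiltonian K.M H) (hs : SatisfiesSetup K H) (j : Fin m) (x v w : ℝ × ℝ) :
    dOne (pullOne (torusMap (K.Ψ j)) H.lam) x v w = 0 := by
  have hM := torus_subset_M hε j (IsSolidTorus.torusMap_mem x)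
  have hΨ := K.solidTorus j
  rw [dOne_pullOne (hΨ.contDiff_torusMap.contDiffAt.of_le two_le_infty)
    (h.smooth_lam.differentiable (by simp) _)]
  exact eq_zero_on_span_pair (B := dOneBilin H.lam (torusMap (K.Ψ j) x))
    (fun v w => dOne_swap _ _ v w) (hs.tangent_torus j x.1 _ (norm_circ _)) (h.X_ne_zero hM)
    (fun v hv => h.dOne_lam_X hε hM (hΨ.tangentTorus_le x.1 x.2 hv))
    (hΨ.fderiv_torusMap_mem x v) (hΨ.fderiv_torusMap_mem x w)

theorem IsSolidTorus.exists_bound_torusMap {Ψ : ℝ × ℂ → E4} (h : IsSolidTorus Ψ) :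
    ∃ B : ℝ, 0 ≤ B ∧ ∀ x, ‖fderiv ℝ (torusMap Ψ) x (0, 1)‖ ≤ B := by
  have hd : Continuous fun x => fderiv ℝ (torusMap Ψ) x (0, 1) :=
    (h.contDiff_torusMap.continuous_fderiv (by simp)).clm_apply continuous_const
  obtain ⟨B, hB⟩ := (isCompact_Icc.prod isCompact_Icc : IsCompact
    (Icc (0 : ℝ) 1 ×ˢ Icc (0 : ℝ) 1)).exists_bound_of_continuousOn hd.continuousOn
  refine ⟨|B|, abs_nonneg B, fun x => ?_⟩
  have hper (n n' : ℤ) (x : ℝ × ℝ) : fderiv ℝ (torusMap Ψ) (x + ((n : ℝ), (n' : ℝ)))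
      = fderiv ℝ (torusMap Ψ) x := by
    have h1 : (fun y : ℝ × ℝ => torusMap Ψ (y + ((n : ℝ), (n' : ℝ)))) = torusMap Ψ := by
      ext1 y
      simp only [torusMap, Prod.fst_add, Prod.snd_add]
      rw [h.add_int, circ_add_int]
    have h2 := fderiv_comp_add_right (𝕜 := ℝ) (f := torusMap Ψ) (x := x) ((n : ℝ), (n' : ℝ))
    rw [← h2, h1]
  have hx : x = (Int.fract x.1, Int.fract x.2) + ((⌊x.1⌋ : ℝ), (⌊x.2⌋ : ℝ)) := by
    ext <;> simp
  rw [hx, hper]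
  exact (hB (Int.fract x.1, Int.fract x.2) ⟨⟨Int.fract_nonneg _, (Int.fract_lt_one _).le⟩,
    ⟨Int.fract_nonneg _, (Int.fract_lt_one _).le⟩⟩).trans (le_abs_self B)

/-- The closed form `λ` has a potential on the universal cover of the torus, so only the endpoints
of the lift count. They are joined by a segment of length one in the meridian direction, whatever
the shape of the loop. -/
theorem exists_bound_lam_loop (hε : IsCollarWidth K ε) : ∃ B : ℝ, 0 ≤ B ∧
    ∀ H, IsStableHamiltonian K.M H → SatisfiesSetup K H → ∀ C, (∀ x ∈ K.M, ‖H.lam x‖ ≤ C) →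
      ∀ j, ∀ (σ θ : ℝ → ℝ) (c' : ℝ → E4), (∀ t, DifferentiableAt ℝ σ t) →
        (∀ t, DifferentiableAt ℝ θ t) → σ 1 = σ 0 → |θ 1 - θ 0| = 1 →
        (∀ t, HasDerivAt (fun t => K.Ψ j (σ t, circ (θ t))) (c' t) t) → Continuous c' →
        |∫ t in (0 : ℝ)..1, H.lam (K.Ψ j (σ t, circ (θ t))) (c' t)| ≤ C * B := by
  choose B hB0 hB using fun j => (K.solidTorus j).exists_bound_torusMap
  refine ⟨∑ j, B j, Finset.sum_nonneg fun j _ => hB0 j, ?_⟩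
  intro H h hs C hC j σ θ c' hσ hθ h1 h2 hd hc'
  have hΨ := K.solidTorus j
  obtain ⟨f, hf, hint⟩ := exists_potential convex_univ isOpen_univ hΨ.contDiff_torusMap
    (a := H.lam) (fun x _ => h.smooth_lam.contDiffAt.of_le (one_le_two.trans two_le_infty))
    fun x _ => h.dOne_lam_torus hε hs j x
  have h3 := hint (fun t => (σ t, θ t)) c' (fun _ _ => mem_univ _)
    (fun t => (hσ t).prodMk (hθ t)) hd hc'
  change |∫ t in (0 : ℝ)..1, H.lam (torusMap (K.Ψ j) (σ t, θ t)) (c' t)| ≤ _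
  rw [h3, h1]
  have hder (t : ℝ) : HasDerivAt (fun t => f (σ 0, t))
      (H.lam (torusMap (K.Ψ j) (σ 0, t)) (fderiv ℝ (torusMap (K.Ψ j)) (σ 0, t) (0, 1))) t := by
    have a1 : HasDerivAt (fun t : ℝ => (σ 0, t)) ((0 : ℝ), (1 : ℝ)) t :=
      (hasDerivAt_const t (σ 0)).prodMk (hasDerivAt_id t)
    exact HasFDerivAt.comp_hasDerivAt (l := f) t (hf (σ 0, t) (mem_univ _)) a1
  have hbd (t : ℝ) : ‖H.lam (torusMap (K.Ψ j) (σ 0, t))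
      (fderiv ℝ (torusMap (K.Ψ j)) (σ 0, t) (0, 1))‖ ≤ C * ∑ j, B j := by
    have hM := hC _ (torus_subset_M hε j (IsSolidTorus.torusMap_mem (σ 0, t)))
    refine (ContinuousLinearMap.le_opNorm _ _).trans ?_
    have := (hB j (σ 0, t)).trans (Finset.single_le_sum (f := B) (fun j _ => hB0 j)
      (Finset.mem_univ j))
    have hC0 := (norm_nonneg _).trans hM
    gcongr
  have := convex_univ.norm_image_sub_le_of_norm_hasDerivWithin_le
    (fun t _ => (hder t).hasDerivWithinAt) (fun t _ => hbd t) (mem_univ (θ 0)) (mem_univ (θ 1))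
  rwa [Real.norm_eq_abs, Real.norm_eq_abs, h2, mul_one] at this

/-- The boundary circles of a curve in coordinates on the tori. -/
theorem IsSetupCurve.exists_boundary_lift {D : Disks m} {c : CurveData}
    (hc : IsSetupCurve K D H c) (j : Fin m) :
    ∃ σ θ : ℝ → ℝ, (∀ t, DifferentiableAt ℝ σ t) ∧ (∀ t, DifferentiableAt ℝ θ t) ∧ σ 1 = σ 0 ∧
      θ 1 = θ 0 + 1 ∧ (fun t => c.u (D.center j + D.radius j * circ t))
        = fun t => K.Ψ j (σ t, circ (θ t)) := by
  obtain ⟨h, hcont, hmem, h0, h1⟩ := hc.meridian j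
  have hsm : ContDiff ℝ ∞ fun t => h (0, t) := by
    have : (fun t => h (0, t)) = fun t => c.u (D.center j + D.radius j * circ (-t)) := funext h0
    rw [this]
    exact hc.smooth_u.comp (contDiff_const.add (contDiff_const.mul
      (contDiff_circ.comp contDiff_neg)))
  obtain ⟨σ, θ, hσ, hθ, hσ1, hθ1, hl⟩ :=
    (K.solidTorus j).exists_meridian_lift hcont hmem h1 hsm
  -- The boundary orientation runs clockwise around the disk, whereas the Stokes formula here
  -- traverses the circle counterclockwise.
  refine ⟨fun t => σ (-t), fun t => θ (-t), fun t => (hσ (-t)).comp t differentiableAt_id.neg,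
    fun t => (hθ (-t)).comp t differentiableAt_id.neg, ?_, ?_, ?_⟩
  · have := hσ1 (-1)
    simpa using this.symm
  · have := hθ1 (-1)
    simp only [neg_add_cancel] at this
    simp only [neg_zero]
    linarith
  · ext1 t
    have := h0 (-t)
    rw [neg_neg] at this
    rw [← this, hl]

end

/-! ### Uniform bounds from smooth convergence -/

section

variable {m : ℕ} {K : Configuration m} {ε : ℝ} {M : Set E4} {H : HamData}

/-- Bounds on the data of a stable Hamiltonian structure. -/
structure HasBounds (M : Set E4) (H : HamData) (C δ : ℝ) : Prop where
  lam : ∀ x ∈ M, ‖H.lam x‖ ≤ C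
  dlam : ∀ x ∈ M, ∀ v w, |dOne H.lam x v w| ≤ C * ‖v‖ * ‖w‖
  omega : ∀ x ∈ M, ‖H.omega x‖ ≤ C
  J : ∀ x ∈ M, ‖H.J x‖ ≤ C
  coercive : ∀ x ∈ M, ∀ w ∈ H.xi x, δ * ‖w‖ ^ 2 ≤ H.omega x ![w, H.J x w]

section Convergence

variable {F : Type*} [NormedAddCommGroup F] [NormedSpace ℝ F] {f : ℕ → E4 → F} {g : E4 → F}

theorem ConvergesSmoothlyOn.eventually_norm_iteratedFDeriv_le (h : ConvergesSmoothlyOn M f g)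
    (hM : IsCompact M) (hg : ContDiff ℝ ∞ g) (n : ℕ) :
    ∃ C : ℝ, ∀ᶠ k in atTop, ∀ x ∈ M, ‖iteratedFDeriv ℝ n (f k) x‖ ≤ C := by
  obtain ⟨C, hC⟩ := hM.exists_bound_of_continuousOn
    (hg.continuous_iteratedFDeriv (m := n) (by exact_mod_cast le_top)).continuousOn
  refine ⟨C + 1, ?_⟩
  filter_upwards [Metric.tendstoUniformlyOn_iff.1 (h n) 1 one_pos] with k hk x hx
  have h1 := hk x hx
  rw [dist_eq_norm, norm_sub_rev] at h1
  have h2 := norm_sub_norm_le (iteratedFDeriv ℝ n (f k) x) (iteratedFDeriv ℝ n g x)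
  linarith [hC x hx]

theorem ConvergesSmoothlyOn.eventually_norm_le (h : ConvergesSmoothlyOn M f g)
    (hM : IsCompact M) (hg : ContDiff ℝ ∞ g) :
    ∃ C : ℝ, ∀ᶠ k in atTop, ∀ x ∈ M, ‖f k x‖ ≤ C := by
  obtain ⟨C, hC⟩ := h.eventually_norm_iteratedFDeriv_le hM hg 0
  exact ⟨C, by simpa only [norm_iteratedFDeriv_zero] using hC⟩

theorem ConvergesSmoothlyOn.eventually_norm_fderiv_le (h : ConvergesSmoothlyOn M f g)
    (hM : IsCompact M) (hg : ContDiff ℝ ∞ g) :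
    ∃ C : ℝ, ∀ᶠ k in atTop, ∀ x ∈ M, ‖fderiv ℝ (f k) x‖ ≤ C := by
  obtain ⟨C, hC⟩ := h.eventually_norm_iteratedFDeriv_le hM hg 1
  exact ⟨C, by simpa only [norm_iteratedFDeriv_one] using hC⟩

theorem ConvergesSmoothlyOn.eventually_norm_sub_lt (h : ConvergesSmoothlyOn M f g) {η : ℝ}
    (hη : 0 < η) : ∀ᶠ k in atTop, ∀ x ∈ M, ‖f k x - g x‖ < η := by
  filter_upwards [Metric.tendstoUniformlyOn_iff.1 (h 0) η hη] with k hk x hx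
  have h1 := hk x hx
  simp only [iteratedFDeriv_zero_eq_comp, Function.comp_apply, LinearIsometryEquiv.dist_map] at h1
  rwa [dist_eq_norm, norm_sub_rev] at h1

end Convergence

/-- The planes `ξ` vary with `k`, so positivity of the limit is tested on all unit tangent vectors:
either the limiting `λ` is nonzero or compatibility gives positivity. Compactness makes this
quantitative and therefore stable under small perturbation. -/
theorem HamConverges.eventually_coercive {H : ℕ → HamData} {Hlim : HamData}
    (hM : IsCompact M)
    (hlim : IsStableHamiltonian M Hlim) (hconv : HamConverges M H Hlim) :
    ∃ δ > 0, ∀ᶠ k in atTop, ∀ x ∈ M, ∀ w ∈ (H k).xi x,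
      δ * ‖w‖ ^ 2 ≤ (H k).omega x ![w, (H k).J x w] := by
  let S : Set (E4 × E4) := (M ×ˢ Metric.sphere 0 1) ∩ {p | inner ℝ p.1 p.2 = 0}
  have hS : IsCompact S := (hM.prod (isCompact_sphere 0 1)).inter_right
    (isClosed_eq (by fun_prop) continuous_const)
  let f : E4 × E4 → ℝ := fun p => Hlim.omega p.1 ![p.2, Hlim.J p.1 p.2]
  let g : E4 × E4 → ℝ := fun p => |Hlim.lam p.1 p.2|
  have hJc : Continuous fun p : E4 × E4 => Hlim.J p.1 p.2 :=
    (hlim.smooth_J.continuous.comp continuous_fst).clm_apply continuous_snd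
  have hf : Continuous f := by
    have h1 : Continuous fun p : E4 × E4 => Hlim.omega p.1 :=
      hlim.smooth_omega.continuous.comp continuous_fst
    have h2 : Continuous fun p : E4 × E4 => ![p.2, Hlim.J p.1 p.2] := by
      refine continuous_pi fun i => ?_
      fin_cases i
      · exact continuous_snd
      · exact hJc
    exact h1.eval h2
  have hg : Continuous g :=
    ((hlim.smooth_lam.continuous.comp continuous_fst).clm_apply continuous_snd).abs
  have hpos : ∀ p ∈ S, 0 < max (f p) (g p) := by
    rintro ⟨x, w⟩ ⟨⟨hx, hw⟩, ho⟩
    have hw1 : ‖w‖ = 1 := by simpa using hw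
    by_cases h0 : Hlim.lam x w = 0
    · refine lt_max_of_lt_left (hlim.compat_pos x hx w ⟨mem_tangentS3.2 ho, h0⟩ ?_)
      rintro rfl
      simp at hw1
    · exact lt_max_of_lt_right (abs_pos.2 h0)
  obtain ⟨η, hη, hηS⟩ : ∃ η > 0, ∀ p ∈ S, η ≤ max (f p) (g p) := by
    rcases S.eq_empty_or_nonempty with he | hne
    · exact ⟨1, one_pos, by simp [he]⟩
    · obtain ⟨p, hp, hmin⟩ := hS.exists_isMinOn hne (hf.max hg).continuousOn
      exact ⟨_, hpos p hp, fun p' hp' => hmin hp'⟩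
  obtain ⟨CJ, hCJ⟩ := hconv.J.eventually_norm_le hM hlim.smooth_J
  obtain ⟨Cω, hCω⟩ := hM.exists_bound_of_continuousOn hlim.smooth_omega.continuous.continuousOn
  -- For large `k` a unit vector of `ξ_k` has limiting `λ` below `η/2`, so the limiting quadratic
  -- form is at least `η`. The errors from `ω` and from `J` cost at most `η/4` each.
  refine ⟨η / 2, half_pos hη, ?_⟩
  filter_upwards [hCJ, hconv.lam.eventually_norm_sub_lt (half_pos hη),
    hconv.omega.eventually_norm_sub_lt (η := η / 4 / (|CJ| + 1)) (by positivity),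
    hconv.J.eventually_norm_sub_lt (η := η / 4 / (|Cω| + 1)) (by positivity)]
    with k h1 h2 h3 h4
  have key : ∀ x ∈ M, ∀ w ∈ (H k).xi x, ‖w‖ = 1 → η / 2 ≤ (H k).omega x ![w, (H k).J x w] := by
    intro x hx w hw hw1
    have hp := hηS (x, w) ⟨⟨hx, by simpa using hw1⟩, mem_tangentS3.1 hw.1⟩
    have hlam0 : (H k).lam x w = 0 := hw.2
    have hg' : g (x, w) < η / 2 := by
      have e : Hlim.lam x w = -(((H k).lam x - Hlim.lam x) w) := by
        rw [sub_apply, hlam0]; ring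
      have := ((H k).lam x - Hlim.lam x).le_opNorm w
      rw [hw1, mul_one] at this
      simp only [g]
      rw [e, abs_neg, ← Real.norm_eq_abs]
      exact this.trans_lt (h2 x hx)
    have hf' : η ≤ f (x, w) := by
      rcases le_max_iff.1 hp with h | h
      · exact h
      · linarith
    have e1 : (H k).omega x ![w, (H k).J x w] - f (x, w)
        = ((H k).omega x - Hlim.omega x) ![w, (H k).J x w]
          + Hlim.omega x ![w, ((H k).J x - Hlim.J x) w] := by
      have : (H k).J x w = Hlim.J x w + ((H k).J x - Hlim.J x) w := by rw [sub_apply]; abel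
      have h5 : Hlim.omega x ![w, (H k).J x w] = Hlim.omega x ![w, Hlim.J x w]
          + Hlim.omega x ![w, ((H k).J x - Hlim.J x) w] := by rw [← vecTwo_add, ← this]
      simp only [f]
      rw [ContinuousAlternatingMap.sub_apply, h5]
      ring
    have b1 := abs_vecTwo_le ((H k).omega x - Hlim.omega x) w ((H k).J x w)
    have b2 := abs_vecTwo_le (Hlim.omega x) w (((H k).J x - Hlim.J x) w)
    rw [hw1, mul_one] at b1 b2
    have b3 : ‖(H k).J x w‖ ≤ |CJ| + 1 := by
      have := ((H k).J x).le_opNorm w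
      rw [hw1, mul_one] at this
      linarith [h1 x hx, le_abs_self CJ]
    have b4 : ‖((H k).J x - Hlim.J x) w‖ ≤ η / 4 / (|Cω| + 1) := by
      have := ((H k).J x - Hlim.J x).le_opNorm w
      rw [hw1, mul_one] at this
      exact this.trans (h4 x hx).le
    have b5 : ‖Hlim.omega x‖ ≤ |Cω| + 1 := by linarith [hCω x hx, le_abs_self Cω]
    have b6 : ‖(H k).omega x - Hlim.omega x‖ * ‖(H k).J x w‖
        ≤ (η / 4 / (|CJ| + 1)) * (|CJ| + 1) := by
      have := (h3 x hx).le
      gcongr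
    have b7 : ‖Hlim.omega x‖ * ‖((H k).J x - Hlim.J x) w‖
        ≤ (|Cω| + 1) * (η / 4 / (|Cω| + 1)) := by gcongr
    rw [div_mul_cancel₀ _ (by positivity)] at b6
    rw [mul_div_cancel₀ _ (by positivity)] at b7
    have b8 := (abs_le.1 (b1.trans b6)).1
    have b9 := (abs_le.1 (b2.trans b7)).1
    linarith
  intro x hx w hw
  rcases eq_or_ne w 0 with rfl | hw0
  · have := vecTwo_smul ((H k).omega x) 0 0 0
    simp only [zero_smul, zero_mul] at this
    simp [this]
  · have hn := norm_pos_iff.2 hw0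
    have h5 := key x hx (‖w‖⁻¹ • w) (Submodule.smul_mem _ _ hw) (by
      rw [norm_smul, norm_inv, norm_norm, inv_mul_cancel₀ hn.ne'])
    rw [map_smul, vecTwo_smul, vecTwo_swap, vecTwo_smul, vecTwo_swap] at h5
    have h6 : ‖w‖⁻¹ * -(‖w‖⁻¹ * -(H k).omega x ![w, (H k).J x w])
        = (H k).omega x ![w, (H k).J x w] / ‖w‖ ^ 2 := by
      field_simp
    rw [h6, le_div_iff₀ (by positivity)] at h5
    exact h5

theorem HamConverges.eventually_hasBounds {H : ℕ → HamData} {Hlim : HamData}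
    (hM : IsCompact M)
    (hlim : IsStableHamiltonian M Hlim) (hconv : HamConverges M H Hlim) :
    ∃ C δ : ℝ, 0 ≤ C ∧ 0 < δ ∧ ∀ᶠ k in atTop, HasBounds M (H k) C δ := by
  obtain ⟨δ, hδ, h0⟩ := hconv.eventually_coercive hM hlim
  obtain ⟨C1, h1⟩ := hconv.lam.eventually_norm_le hM hlim.smooth_lam
  obtain ⟨C2, h2⟩ := hconv.lam.eventually_norm_fderiv_le hM hlim.smooth_lam
  obtain ⟨C3, h3⟩ := hconv.omega.eventually_norm_le hM hlim.smooth_omega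
  obtain ⟨C4, h4⟩ := hconv.J.eventually_norm_le hM hlim.smooth_J
  have a1 := le_abs_self C1
  have a2 := le_abs_self C2
  have a3 := le_abs_self C3
  have a4 := le_abs_self C4
  have p1 := abs_nonneg C1
  have p2 := abs_nonneg C2
  have p3 := abs_nonneg C3
  have p4 := abs_nonneg C4
  -- The factor 2 pays for the antisymmetrization in `dλ`.
  refine ⟨|C1| + 2 * |C2| + |C3| + |C4|, δ, by positivity, hδ, ?_⟩
  filter_upwards [h0, h1, h2, h3, h4] with k h0 h1 h2 h3 h4
  refine ⟨fun x hx => by linarith [h1 x hx], fun x hx v w => ?_, fun x hx => by linarith [h3 x hx],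
    fun x hx => by linarith [h4 x hx], h0⟩
  have hb (v w : E4) : |fderiv ℝ (H k).lam x v w| ≤ |C2| * ‖v‖ * ‖w‖ := by
    rw [← Real.norm_eq_abs]
    refine ((fderiv ℝ (H k).lam x).le_opNorm₂ v w).trans ?_
    have := (h2 x hx).trans a2
    gcongr
  have b1 := hb v w
  have b2 := hb w v
  calc |dOne (H k).lam x v w| ≤ |fderiv ℝ (H k).lam x v w| + |fderiv ℝ (H k).lam x w v| :=
        abs_sub _ _
    _ ≤ (2 * |C2|) * ‖v‖ * ‖w‖ := by linarith [mul_right_comm |C2| ‖w‖ ‖v‖]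
    _ ≤ _ := by gcongr; linarith

end

/-! ### Length of the orbit and the asymptotic end -/

section

variable {m : ℕ} {K : Configuration m} {ε : ℝ} {M : Set E4} {H : HamData}

theorem IsPeriodicOrbit.hasDerivAt_scale {X : E4 → E4} {x : ℝ → E4} {T : ℝ}
    (hx : IsPeriodicOrbit M X x T) (t : ℝ) :
    HasDerivAt (fun τ => x (T * τ)) (T • X (x (T * t))) t := by
  have h1 : HasDerivAt (fun τ : ℝ => T * τ) T t := by simpa using (hasDerivAt_id t).const_mul T
  exact (hx.deriv (T * t)).scomp t h1

theorem IsPeriodicOrbit.continuous_deriv_scale {X : E4 → E4} {x : ℝ → E4} {T : ℝ}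
    (hx : IsPeriodicOrbit M X x T) (hX : Continuous X) :
    Continuous (_root_.deriv fun τ => x (T * τ)) := by
  have h1 : (_root_.deriv fun τ => x (T * τ)) = fun t => T • X (x (T * t)) :=
    funext fun t => (hx.hasDerivAt_scale t).deriv
  have h2 : Continuous x := continuous_iff_continuousAt.2 fun t => (hx.deriv t).continuousAt
  rw [h1]
  fun_prop

/-- The length of an orbit which runs once along a knot is bounded by the knot. -/
theorem RunsOnceAlong.integral_norm_deriv_le {X : E4 → E4} {p x : ℝ → E4} {T : ℝ}
    (h : RunsOnceAlong p x T) (hp : IsKnot p) (hx : IsPeriodicOrbit M X x T) (hX : Continuous X)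
    {P : ℝ} (hP : ∀ t, ‖deriv p t‖ ≤ P) :
    ∫ t in (0 : ℝ)..1, ‖deriv (fun τ => x (T * τ)) t‖ ≤ P := by
  obtain ⟨θ, hθc, hθm, hθ⟩ := h
  let y : ℝ → E4 := fun τ => x (T * τ)
  let Θ : ℝ → ℝ := fun τ => θ (T * τ)
  have hΘc : Continuous Θ := by fun_prop
  have hyΘ (t : ℝ) : y t = p (Θ t) := (hθ (T * t)).2
  have hpd (t : ℝ) : HasDerivAt p (deriv p t) t :=
    (hp.smooth.differentiable (by simp) t).hasDerivAt
  have hdiff (t : ℝ) : DifferentiableAt ℝ Θ t := by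
    -- The parameter change `Θ` is only known to be continuous. Projecting the knot to its tangent
    -- line at `p (Θ t)` gives a locally invertible function, which expresses `Θ` through the smooth
    -- orbit.
    let f : ℝ → ℝ := fun s => inner ℝ (deriv p (Θ t)) (p s)
    have hf : ContDiff ℝ ∞ f := contDiff_const.inner ℝ hp.smooth
    have hfd : HasDerivAt f (‖deriv p (Θ t)‖ ^ 2) (Θ t) := by
      have := (hasDerivAt_const (Θ t) (deriv p (Θ t))).inner ℝ (hpd (Θ t))
      simpa [real_inner_self_eq_norm_sq] using this
    have hinj : Function.Injective (fderiv ℝ f (Θ t)) := by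
      rw [injective_iff_map_eq_zero]
      intro a ha
      rw [hfd.hasFDerivAt.fderiv] at ha
      simpa [hp.immersed] using ha
    obtain ⟨g, -, hg2, -, hg4⟩ := exists_localInverse rfl hf.contDiffAt hinj
    have h1 : DifferentiableAt ℝ (fun τ => f (Θ τ)) t := by
      have : (fun τ => f (Θ τ)) = fun τ => inner ℝ (deriv p (Θ t)) (y τ) := by
        ext1 τ; simp only [f]; rw [hyΘ]
      rw [this]
      exact (differentiableAt_const _).inner ℝ (hx.hasDerivAt_scale t).differentiableAt
    have h2 : DifferentiableAt ℝ (fun τ => g (f (Θ τ))) t :=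
      DifferentiableAt.comp (g := g) t (hg2.differentiableAt (by simp)) h1
    refine h2.congr_of_eventuallyEq ?_
    filter_upwards [(hΘc.tendsto t).eventually hg4] with τ hτ using hτ.symm
  have hyd (t : ℝ) : deriv y t = deriv Θ t • deriv p (Θ t) := by
    have h1 := (hpd (Θ t)).scomp t (hdiff t).hasDerivAt
    have h2 : y = p ∘ Θ := funext hyΘ
    rw [h2]
    exact h1.deriv
  have hne (t : ℝ) : ‖deriv p (Θ t)‖ ≠ 0 := norm_ne_zero_iff.2 (hp.immersed _)
  have hΘ' (t : ℝ) : deriv Θ t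
      = inner ℝ (deriv p (Θ t)) (deriv y t) / ‖deriv p (Θ t)‖ ^ 2 := by
    rw [hyd, inner_smul_right, real_inner_self_eq_norm_sq, mul_div_cancel_right₀]
    exact pow_ne_zero 2 (hne t)
  have hycont : Continuous (deriv y) := hx.continuous_deriv_scale hX
  have hpcont : Continuous (deriv p) := hp.smooth.continuous_deriv (by simp)
  have hΘcont : Continuous (deriv Θ) := by
    have h1 : deriv Θ = fun t => inner ℝ (deriv p (Θ t)) (deriv y t) / ‖deriv p (Θ t)‖ ^ 2 :=
      funext hΘ'
    rw [h1]
    refine Continuous.div ?_ ?_ fun t => pow_ne_zero 2 (hne t)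
    · exact (hpcont.comp hΘc).inner hycont
    · exact (hpcont.comp hΘc).norm.pow 2
  have hmono : Monotone Θ := fun a b hab =>
    hθm.monotone (mul_le_mul_of_nonneg_left hab hx.period_pos.le)
  have hnn (t : ℝ) : 0 ≤ deriv Θ t := hmono.deriv_nonneg
  -- One period runs once along the knot, so `Θ` increases by exactly one. This removes the period
  -- from the bound.
  have hint : ∫ t in (0 : ℝ)..1, deriv Θ t = 1 := by
    rw [intervalIntegral.integral_deriv_eq_sub (fun t _ => hdiff t)
      (hΘcont.intervalIntegrable 0 1)]
    have := (hθ 0).1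
    simp only [Θ, mul_one, mul_zero]
    rw [zero_add] at this
    linarith
  calc ∫ t in (0 : ℝ)..1, ‖deriv y t‖ ≤ ∫ t in (0 : ℝ)..1, P * deriv Θ t := by
        refine intervalIntegral.integral_mono_on zero_le_one (hycont.norm.intervalIntegrable 0 1)
          ((continuous_const.mul hΘcont).intervalIntegrable 0 1) fun t _ => ?_
        rw [hyd, norm_smul, Real.norm_of_nonneg (hnn t), mul_comm]
        exact mul_le_mul_of_nonneg_right (hP _) (hnn t)
    _ = P := by rw [intervalIntegral.integral_const_mul, hint, mul_one]

theorem IsKnot.isCompact_range {p : ℝ → E4} (hp : IsKnot p) : IsCompact (range p) := by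
  have hper : Function.Periodic p 1 := hp.periodic
  rw [← hper.image_Icc zero_lt_one 0]
  exact isCompact_Icc.image hp.smooth.continuous

theorem IsKnot.exists_bound_deriv {p : ℝ → E4} (hp : IsKnot p) :
    ∃ P : ℝ, 0 ≤ P ∧ ∀ t, ‖deriv p t‖ ≤ P := by
  obtain ⟨P, hP⟩ := isCompact_Icc.exists_bound_of_continuousOn (s := Icc (0 : ℝ) 1)
    (hp.smooth.continuous_deriv (by simp)).continuousOn
  refine ⟨|P|, abs_nonneg P, fun t => ?_⟩
  have h1 : (fun s => p (s + ⌊t⌋)) = p := by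
    have hper : Function.Periodic p 1 := hp.periodic
    ext1 s
    simpa using hper.int_mul ⌊t⌋ s
  have h2 : deriv p t = deriv p (Int.fract t) := by
    conv_lhs => rw [← Int.fract_add_floor t]
    rw [← deriv_comp_add_const (f := p) (a := (⌊t⌋ : ℝ)), h1]
  rw [h2]
  exact (hP _ ⟨Int.fract_nonneg t, (Int.fract_lt_one t).le⟩).trans (le_abs_self P)

/-- Along the end of a curve which is asymptotic to the knot, a `1`-form is bounded by its values
along the knot. -/
theorem exists_end_bound {p y : ℝ → E4} (hp : IsKnot p) (hy : ∀ t, y t ∈ range p) {u : ℂ → E4}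
    {ψ : ℂ → ℂ} (hu : ContDiff ℝ ∞ u) (hψ : ContDiff ℝ ∞ ψ)
    (hconv : ∀ n : ℕ, TendstoUniformly
      (fun s t : ℝ => iteratedDeriv n (fun τ : ℝ => u (ψ (s + τ * Complex.I))) t)
      (iteratedDeriv n y) atTop)
    {V : Set E4} (hV : IsOpen V) (hpV : ∀ t, p t ∈ V) {a : E4 → E4 →L[ℝ] ℝ}
    (ha : ContinuousOn a V) {C : ℝ} (hC : 0 ≤ C) (haC : ∀ t v, |a (p t) v| ≤ C * ‖v‖) :
    ∃ S₁ : ℝ, ∀ S ≥ S₁, ∀ t : ℝ,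
      |a (u (ψ (S + t * Complex.I)))
        (fderiv ℝ u (ψ (S + t * Complex.I)) (fderiv ℝ ψ (S + t * Complex.I) Complex.I))|
      ≤ (C + 1) * (‖deriv y t‖ + 1) := by
  -- On a neighbourhood of the compact knot the norm of the form exceeds its bound on the knot by
  -- less than one, and the end of the curve eventually stays in it.
  let W : Set E4 := {z | z ∈ V ∧ ‖a z‖ < C + 1}
  have hW : IsOpen W := ha.norm.isOpen_inter_preimage hV isOpen_Iio
  have hpW : range p ⊆ W := by
    rintro _ ⟨t, rfl⟩
    refine ⟨hpV t, ?_⟩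
    have := (a (p t)).opNorm_le_bound hC (haC t)
    linarith
  obtain ⟨η, hη, hηW⟩ := hp.isCompact_range.exists_thickening_subset_open hW hpW
  have h0 := Metric.tendstoUniformly_iff.1 (hconv 0) η hη
  have h1 := Metric.tendstoUniformly_iff.1 (hconv 1) 1 one_pos
  obtain ⟨S₁, hS₁⟩ := eventually_atTop.1 (h0.and h1)
  refine ⟨S₁, fun S hS t => ?_⟩
  obtain ⟨e0, e1⟩ := hS₁ S hS
  have e0 := e0 t
  have e1 := e1 t
  simp only [iteratedDeriv_zero, iteratedDeriv_one] at e0 e1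
  have hd : HasDerivAt (fun τ : ℝ => u (ψ (S + τ * Complex.I)))
      (fderiv ℝ u (ψ (S + t * Complex.I)) (fderiv ℝ ψ (S + t * Complex.I) Complex.I)) t := by
    have a1 : HasDerivAt (fun τ : ℝ => (S + τ * Complex.I : ℂ)) Complex.I t := by
      simpa using ((Complex.ofRealCLM.hasDerivAt (x := t)).mul_const Complex.I).const_add (S : ℂ)
    have a2 := HasFDerivAt.comp_hasDerivAt (l := ψ) t
      (hψ.differentiable (by simp) _).hasFDerivAt a1
    exact HasFDerivAt.comp_hasDerivAt (l := u) t (hu.differentiable (by simp) _).hasFDerivAt a2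
  rw [hd.deriv, dist_eq_norm] at e1
  have hmem : u (ψ (S + t * Complex.I)) ∈ W :=
    hηW (Metric.mem_thickening_iff.2 ⟨y t, hy t, by rwa [dist_comm]⟩)
  rw [← Real.norm_eq_abs]
  refine (ContinuousLinearMap.le_opNorm _ _).trans ?_
  have e2 := hmem.2.le
  generalize fderiv ℝ u (ψ (S + t * Complex.I)) (fderiv ℝ ψ (S + t * Complex.I) Complex.I) = w
    at e1 ⊢
  have e3 : ‖w‖ ≤ ‖deriv y t‖ + 1 := by
    rw [norm_sub_rev] at e1
    linarith [norm_sub_norm_le w (deriv y t)]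
  gcongr

end

/-! ### Pointwise positivity of the energy densities -/

section

variable {m : ℕ} {K : Configuration m} {ε : ℝ} {M : Set E4} {H : HamData} {D : Disks m}
  {c : CurveData}

/-- Only at interior points of the domain is `u` known to be sphere-valued in a full neighbourhood,
which makes its derivative tangent to the sphere. The excluded boundary circles are null sets. -/
theorem Disks.ae_eventually_mem (D : Disks m) :
    ∀ᵐ z ∂(volume.restrict D.domain), ∀ᶠ z' in 𝓝 z, z' ∈ D.domain := by
  have h1 : ∀ᵐ z : ℂ, ∀ i, z ∉ Metric.sphere (D.center i) (D.radius i) := by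
    rw [ae_all_iff]
    intro i
    exact measure_eq_zero_iff_ae_notMem.1 (Measure.addHaar_sphere volume _ _)
  rw [ae_restrict_iff' D.isClosed_domain.measurableSet]
  filter_upwards [h1] with z hz hzD
  have h2 : ∀ᶠ z' in 𝓝 z, ∀ i, z' ∉ Metric.closedBall (D.center i) (D.radius i) := by
    refine eventually_all.2 fun i => Metric.isClosed_closedBall.isOpen_compl.mem_nhds fun hb => ?_
    rcases (Metric.mem_closedBall.1 hb).lt_or_eq with h | h
    · exact hzD (mem_iUnion.2 ⟨i, h⟩)
    · exact hz i h
  filter_upwards [h2] with z' hz' hmem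
  obtain ⟨i, hi⟩ := mem_iUnion.1 hmem
  exact hz' i (Metric.ball_subset_closedBall hi)

theorem IsSetupCurve.fderiv_mem (hc : IsSetupCurve K D H c) {z : ℂ}
    (hz : ∀ᶠ z' in 𝓝 z, z' ∈ D.domain) (v : ℂ) : fderiv ℝ c.u z v ∈ tangentS3 (c.u z) := by
  refine fderiv_mem_tangentS3 (hc.smooth_u.differentiable (by simp) z) ?_ v
  filter_upwards [hz] with z' hz' using (mem_M_iff.1 (hc.mem z' hz')).1

/-- The part in `ξ` of the partial derivative of `u`. -/
def xiPart (H : HamData) (c : CurveData) (z : ℂ) : E4 :=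
  fderiv ℝ c.u z 1 - H.lam (c.u z) (fderiv ℝ c.u z 1) • H.X (c.u z)

theorem IsSetupCurve.xiPart_mem (hc : IsSetupCurve K D H c) (h : IsStableHamiltonian K.M H) {z : ℂ}
    (hz : ∀ᶠ z' in 𝓝 z, z' ∈ D.domain) : xiPart H c z ∈ H.xi (c.u z) := by
  have hM := hc.mem z hz.self_of_nhds
  refine ⟨sub_mem (hc.fderiv_mem hz 1) (Submodule.smul_mem _ _ (h.tangent _ hM)), ?_⟩
  change H.lam (c.u z) (xiPart H c z) = 0
  rw [xiPart, map_sub, map_smul, h.lam_X _ hM, smul_eq_mul, mul_one, sub_self]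

theorem complex_decomp (z : ℂ) : z = z.re • (1 : ℂ) + z.im • Complex.I := by
  apply Complex.ext <;> simp

theorem IsSetupCurve.im_pos (hc : IsSetupCurve K D H c) {z : ℂ} (hz : z ∈ D.domain) :
    0 < (c.j z 1).im := by
  simpa using hc.complexStructure.oriented z hz 1 one_ne_zero

theorem IsSetupCurve.fderiv_j (hc : IsSetupCurve K D H c) {z : ℂ} (hz : z ∈ D.domain) :
    fderiv ℝ c.a z (c.j z 1) = -(H.lam (c.u z) (fderiv ℝ c.u z 1)) ∧
      fderiv ℝ c.u z (c.j z 1) = fderiv ℝ c.a z 1 • H.X (c.u z)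
        + H.J (c.u z) (xiPart H c z) :=
  Prod.ext_iff.1 (hc.holomorphic z hz 1)

/-- The value of a form with kernel `X` on the derivative of a holomorphic curve. -/
theorem IsSetupCurve.bilin_fderiv (hc : IsSetupCurve K D H c) (h : IsStableHamiltonian K.M H)
    {z : ℂ} (hz : ∀ᶠ z' in 𝓝 z, z' ∈ D.domain) {B : E4 →ₗ[ℝ] E4 →ₗ[ℝ] ℝ}
    (hB : ∀ v w, B v w = - B w v) (hBX : ∀ v ∈ tangentS3 (c.u z), B (H.X (c.u z)) v = 0) :
    (c.j z 1).im * B (fderiv ℝ c.u z 1) (fderiv ℝ c.u z Complex.I)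
      = B (xiPart H c z) (H.J (c.u z) (xiPart H c z)) := by
  have hzD := hz.self_of_nhds
  have hM := hc.mem z hzD
  have h1 : B (fderiv ℝ c.u z 1) (fderiv ℝ c.u z 1) = 0 := by
    linarith [hB (fderiv ℝ c.u z 1) (fderiv ℝ c.u z 1)]
  have h2 : B (fderiv ℝ c.u z 1) (fderiv ℝ c.u z (c.j z 1))
      = (c.j z 1).im * B (fderiv ℝ c.u z 1) (fderiv ℝ c.u z Complex.I) := by
    conv_lhs => rw [complex_decomp (c.j z 1)]
    simp only [map_add, map_smul, smul_eq_mul, h1, mul_zero, zero_add]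
  have h3 := h.J_mem _ hM _ (hc.xiPart_mem h hz)
  -- Multiples of `X` drop out of both slots of `B`, so with `w` the part of `∂₁u` in `ξ` only `B
  -- (w, J w)` remains. The positive factor `(c.j z 1).im` accounts for replacing `I` by `j 1`.
  have h4 : fderiv ℝ c.u z 1
      = xiPart H c z + H.lam (c.u z) (fderiv ℝ c.u z 1) • H.X (c.u z) := by
    rw [xiPart, sub_add_cancel]
  rw [← h2, (hc.fderiv_j hzD).2, map_add, map_smul, hB _ (H.X (c.u z)),
    hBX _ (hc.fderiv_mem hz 1), neg_zero, smul_zero, zero_add]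
  conv_lhs => rw [h4]
  rw [map_add, map_smul, LinearMap.add_apply, LinearMap.smul_apply, hBX _ h3.1, smul_zero, add_zero]

/-- The density of the `ω`-energy is nonnegative and controls the pullback of `dλ`. -/
theorem IsSetupCurve.omega_density (hε : IsCollarWidth K ε) (hc : IsSetupCurve K D H c)
    (h : IsStableHamiltonian K.M H) {C δ : ℝ} (hC : 0 ≤ C) (hδ : 0 < δ)
    (hb : HasBounds K.M H C δ) {z : ℂ} (hz : ∀ᶠ z' in 𝓝 z, z' ∈ D.domain) :
    0 ≤ H.omega (c.u z) ![fderiv ℝ c.u z 1, fderiv ℝ c.u z Complex.I] ∧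
      |dOne H.lam (c.u z) (fderiv ℝ c.u z 1) (fderiv ℝ c.u z Complex.I)|
        ≤ C ^ 2 / δ * H.omega (c.u z) ![fderiv ℝ c.u z 1, fderiv ℝ c.u z Complex.I] := by
  have hzD := hz.self_of_nhds
  have hM := hc.mem z hzD
  have him := hc.im_pos hzD
  have hw := hc.xiPart_mem h hz
  have e1 := hc.bilin_fderiv h hz (B := twoBilin (H.omega (c.u z)))
    (fun v w => vecTwo_swap _ v w) (fun v hv => h.omega_X _ hM v hv)
  have e2 := hc.bilin_fderiv h hz (B := dOneBilin H.lam (c.u z))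
    (fun v w => dOne_swap _ _ v w) (fun v hv => h.dOne_lam_X hε hM hv)
  change (c.j z 1).im * H.omega (c.u z) ![fderiv ℝ c.u z 1, fderiv ℝ c.u z Complex.I]
    = H.omega (c.u z) ![xiPart H c z, H.J (c.u z) (xiPart H c z)] at e1
  change (c.j z 1).im * dOne H.lam (c.u z) (fderiv ℝ c.u z 1) (fderiv ℝ c.u z Complex.I)
    = dOne H.lam (c.u z) (xiPart H c z) (H.J (c.u z) (xiPart H c z)) at e2
  have e3 := hb.coercive _ hM _ hw
  have e4 := hb.dlam _ hM (xiPart H c z) (H.J (c.u z) (xiPart H c z))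
  have e5 : ‖H.J (c.u z) (xiPart H c z)‖ ≤ C * ‖xiPart H c z‖ :=
    ((H.J (c.u z)).le_opNorm _).trans (by gcongr; exact hb.J _ hM)
  rw [← e1] at e3
  rw [← e2, abs_mul, abs_of_pos him] at e4
  refine ⟨?_, ?_⟩
  · refine nonneg_of_mul_nonneg_right ((by positivity : 0 ≤ δ * ‖xiPart H c z‖ ^ 2).trans e3) him
  · refine le_of_mul_le_mul_left ?_ him
    calc _ ≤ C * ‖xiPart H c z‖ * (C * ‖xiPart H c z‖) := e4.trans (by gcongr)
      _ = C ^ 2 / δ * (δ * ‖xiPart H c z‖ ^ 2) := by field_simp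
      _ ≤ C ^ 2 / δ * ((c.j z 1).im
            * H.omega (c.u z) ![fderiv ℝ c.u z 1, fderiv ℝ c.u z Complex.I]) := by gcongr
      _ = _ := by ring

/-- The density of the `λ`-energy is nonnegative. -/
theorem IsSetupCurve.lam_density (hc : IsSetupCurve K D H c)
    (h : IsStableHamiltonian K.M H) {z : ℂ} (hz : ∀ᶠ z' in 𝓝 z, z' ∈ D.domain) :
    0 ≤ fderiv ℝ c.a z 1 * H.lam (c.u z) (fderiv ℝ c.u z Complex.I)
        - fderiv ℝ c.a z Complex.I * H.lam (c.u z) (fderiv ℝ c.u z 1) := by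
  have hzD := hz.self_of_nhds
  have hM := hc.mem z hzD
  have him := hc.im_pos hzD
  obtain ⟨e1, e2⟩ := hc.fderiv_j hzD
  have e3 := congrArg (H.lam (c.u z)) e2
  have e4 : H.lam (c.u z) (H.J (c.u z) (xiPart H c z)) = 0 :=
    (h.J_mem _ hM _ (hc.xiPart_mem h hz)).2
  rw [map_add, map_smul, h.lam_X _ hM, e4, smul_eq_mul, mul_one, add_zero] at e3
  rw [complex_decomp (c.j z 1)] at e1 e3
  simp only [map_add, map_smul, smul_eq_mul] at e1 e3
  -- Holomorphicity turns the density into a sum of two squares, up to the same positive factor.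
  have key : (c.j z 1).im * (fderiv ℝ c.a z 1 * H.lam (c.u z) (fderiv ℝ c.u z Complex.I)
        - fderiv ℝ c.a z Complex.I * H.lam (c.u z) (fderiv ℝ c.u z 1))
      = fderiv ℝ c.a z 1 ^ 2 + H.lam (c.u z) (fderiv ℝ c.u z 1) ^ 2 := by
    linear_combination fderiv ℝ c.a z 1 * e3 - H.lam (c.u z) (fderiv ℝ c.u z 1) * e1
  exact nonneg_of_mul_nonneg_right (key ▸ by positivity) him

/-- An integral over an exhausted domain is bounded by the integrals over the truncations. -/
theorem lintegral_le_of_truncations {U : Set ℂ} {A : ℝ → Set ℂ} (hA : ∀ S, IsCompact (A S))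
    (hAU : ∀ S, A S ⊆ U)
    (hmono : ∀ S T, S ≤ T → A S ⊆ A T) (hunion : U = ⋃ n : ℕ, A n) {f : ℂ → ℝ}
    (hf : Continuous f) (hnn : ∀ᵐ z ∂(volume.restrict U), 0 ≤ f z) {E : ℝ}
    (hE : ∃ S₁, ∀ S ≥ S₁, ∫ z in A S, f z ≤ E) :
    ∫⁻ z in U, ENNReal.ofReal (f z) ≤ ENNReal.ofReal E := by
  obtain ⟨S₁, hS₁⟩ := hE
  have hm : Monotone fun n : ℕ => A n := fun n n' h => hmono _ _ (by exact_mod_cast h)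
  rw [hunion, setLIntegral_iUnion_of_directed _ hm.directed_le]
  refine iSup_le fun n => ?_
  let S : ℝ := max n S₁
  calc ∫⁻ z in A n, ENNReal.ofReal (f z) ≤ ∫⁻ z in A S, ENNReal.ofReal (f z) :=
        lintegral_mono_set (hmono _ _ (le_max_left _ _))
    _ = ENNReal.ofReal (∫ z in A S, f z) := by
        rw [ofReal_integral_eq_lintegral_ofReal (hf.continuousOn.integrableOn_compact (hA S))]
        exact ae_restrict_of_ae_restrict_of_subset (hAU S) hnn
    _ ≤ ENNReal.ofReal E := ENNReal.ofReal_le_ofReal (hS₁ S (le_max_right _ _))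

theorem IsSetupCurve.hasDerivAt_circle (hc : IsSetupCurve K D H c) (i : Fin m) (t : ℝ) :
    HasDerivAt (fun t => c.u (D.center i + D.radius i * circ t))
      (fderiv ℝ c.u (D.center i + D.radius i * circ t)
        (2 * Real.pi * Complex.I * (D.radius i * circ t))) t := by
  have h1 : HasDerivAt (fun t => D.center i + D.radius i * circ t)
      (2 * Real.pi * Complex.I * (D.radius i * circ t)) t := by
    have := ((hasDerivAt_circ t).const_mul (D.radius i : ℂ)).const_add (D.center i)
    exact this.congr_deriv (by ring)
  exact HasFDerivAt.comp_hasDerivAt (l := c.u) t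
    (hc.smooth_u.differentiable (by simp) _).hasFDerivAt h1

theorem IsSetupCurve.continuous_deriv_circle (hc : IsSetupCurve K D H c) (i : Fin m) :
    Continuous fun t => fderiv ℝ c.u (D.center i + D.radius i * circ t)
        (2 * Real.pi * Complex.I * (D.radius i * circ t)) := by
  have h1 : Continuous (fderiv ℝ c.u) := hc.smooth_u.continuous_fderiv (by simp)
  have h2 := contDiff_circ.continuous
  exact (h1.comp (by fun_prop)).clm_apply (by fun_prop)

theorem circle_mem_sphere (D : Disks m) (i : Fin m) (t : ℝ) :
    D.center i + D.radius i * circ t ∈ Metric.sphere (D.center i) (D.radius i) := by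
  rw [mem_sphere_iff_norm, add_sub_cancel_left, norm_mul, norm_circ, mul_one, Complex.norm_real,
    Real.norm_of_nonneg (D.radius_pos i).le]

end

/-! ### The energy estimate -/

section

variable {m : ℕ} {K : Configuration m} {ε : ℝ} {M : Set E4} {H : HamData} {D : Disks m}
  {c : CurveData}

theorem IsStableHamiltonian.continuous_dOne_lam (h : IsStableHamiltonian M H)
    (hu : ContDiff ℝ ∞ c.u) :
    Continuous fun z => dOne H.lam (c.u z) (fderiv ℝ c.u z 1) (fderiv ℝ c.u z Complex.I) := by
  have h1 : Continuous fun z => fderiv ℝ H.lam (c.u z) :=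
    (h.smooth_lam.continuous_fderiv (by simp)).comp hu.continuous
  have h2 (v : ℂ) : Continuous fun z => fderiv ℝ c.u z v :=
    (hu.continuous_fderiv (by simp)).clm_apply continuous_const
  exact ((h1.clm_apply (h2 1)).clm_apply (h2 _)).sub ((h1.clm_apply (h2 _)).clm_apply (h2 1))

theorem IsStableHamiltonian.continuous_omega (h : IsStableHamiltonian M H)
    (hu : ContDiff ℝ ∞ c.u) :
    Continuous fun z => H.omega (c.u z) ![fderiv ℝ c.u z 1, fderiv ℝ c.u z Complex.I] := by
  have h1 : Continuous fun z => H.omega (c.u z) := h.smooth_omega.continuous.comp hu.continuous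
  have h2 (v : ℂ) : Continuous fun z => fderiv ℝ c.u z v :=
    (hu.continuous_fderiv (by simp)).clm_apply continuous_const
  refine h1.eval (continuous_pi fun i => ?_)
  fin_cases i
  · exact h2 1
  · exact h2 _

theorem IsStableHamiltonian.continuous_lam_density (h : IsStableHamiltonian M H)
    (hu : ContDiff ℝ ∞ c.u) {g : ℂ → ℝ} (hg : ContDiff ℝ ∞ g) :
    Continuous fun z => fderiv ℝ g z 1 * H.lam (c.u z) (fderiv ℝ c.u z Complex.I)
      - fderiv ℝ g z Complex.I * H.lam (c.u z) (fderiv ℝ c.u z 1) := by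
  have h1 : Continuous fun z => H.lam (c.u z) := h.smooth_lam.continuous.comp hu.continuous
  have h2 (v : ℂ) : Continuous fun z => fderiv ℝ c.u z v :=
    (hu.continuous_fderiv (by simp)).clm_apply continuous_const
  have h3 (v : ℂ) : Continuous fun z => fderiv ℝ g z v :=
    (hg.continuous_fderiv (by simp)).clm_apply continuous_const
  exact ((h3 1).mul (h1.clm_apply (h2 _))).sub ((h3 _).mul (h1.clm_apply (h2 1)))

/-- Stokes' theorem on an exhaustion of the domain of a curve asymptotic to the knot. -/
theorem IsSetupCurve.exists_exhaustion (hc : IsSetupCurve K D H c) (h : IsStableHamiltonian K.M H)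
    {P : ℝ} (hP : ∀ t, ‖deriv K.p t‖ ≤ P) :
    ∃ A : ℝ → Set ℂ, (∀ S, IsCompact (A S)) ∧ (∀ S, A S ⊆ D.domain) ∧
      (∀ S T, S ≤ T → A S ⊆ A T) ∧ (D.domain = ⋃ n : ℕ, A n) ∧
      ∀ (V : Set E4) (a : E4 → E4 →L[ℝ] ℝ) (g : ℂ → ℝ) (C : ℝ), IsOpen V → (∀ t, K.p t ∈ V) →
        (∀ z ∈ D.domain, c.u z ∈ V) → ContDiffOn ℝ 1 a V → 0 ≤ C →
        (∀ t v, |a (K.p t) v| ≤ C * ‖v‖) → ContDiff ℝ ∞ g → (∀ z, |g z| ≤ 1) →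
        ∃ S₁, ∀ S ≥ S₁, ∫ z in A S,
          (fderiv ℝ g z 1 * a (c.u z) (fderiv ℝ c.u z Complex.I)
            - fderiv ℝ g z Complex.I * a (c.u z) (fderiv ℝ c.u z 1)
            + g z * dOne a (c.u z) (fderiv ℝ c.u z 1) (fderiv ℝ c.u z Complex.I))
          ≤ (C + 1) * (P + 1) - ∑ i, ∫ t in (0 : ℝ)..1, g (D.center i + D.radius i * circ t) *
            a (c.u (D.center i + D.radius i * circ t))
              (fderiv ℝ c.u (D.center i + D.radius i * circ t)
                (2 * Real.pi * Complex.I * (D.radius i * circ t))) := by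
  obtain ⟨ψ, x, T, hψ, hx, hrun, hconvu, -⟩ := hc.asymptotic
  obtain ⟨S₀, A, -, hA, hAD, hmono, hunion, hstokes⟩ := exists_truncations hc.complexStructure hψ
  refine ⟨A, hA, hAD, hmono, hunion, fun V a g C hV hpV huV ha hC haC hg hg1 => ?_⟩
  have hy (t : ℝ) : x (T * t) ∈ range K.p := by
    obtain ⟨θ, -, -, hθ⟩ := hrun
    exact ⟨_, (hθ (T * t)).2.symm⟩
  obtain ⟨S₁, hS₁⟩ := exists_end_bound K.knot hy hc.smooth_u hψ.smooth hconvu hV hpV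
    ha.continuousOn hC haC
  have haat {z : ℂ} (hz : z ∈ D.domain) : ContDiffAt ℝ 1 a (c.u z) :=
    ha.contDiffAt (hV.mem_nhds (huV z hz))
  have hu2 : ContDiff ℝ 2 c.u := hc.smooth_u.of_le two_le_infty
  have hpull {z : ℂ} (hz : z ∈ D.domain) : ContDiffAt ℝ 1 (pullOne c.u a) z :=
    contDiffAt_pullOne hu2.contDiffAt (haat hz)
  have hg1' : ContDiff ℝ 1 g := hg.of_le (one_le_two.trans two_le_infty)
  refine ⟨max S₀ S₁, fun S hS => ?_⟩
  have hst := hstokes S ((le_max_left _ _).trans hS) (fun z => g z • pullOne c.u a z)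
    fun z hz => hg1'.contDiffAt.smul (hpull hz)
  have hend := hS₁ S ((le_max_right _ _).trans hS)
  have hcongr : ∫ z in A S, dOne (fun z => g z • pullOne c.u a z) z 1 Complex.I
      = ∫ z in A S, (fderiv ℝ g z 1 * a (c.u z) (fderiv ℝ c.u z Complex.I)
            - fderiv ℝ g z Complex.I * a (c.u z) (fderiv ℝ c.u z 1)
            + g z * dOne a (c.u z) (fderiv ℝ c.u z 1) (fderiv ℝ c.u z Complex.I)) := by
    refine setIntegral_congr_fun (hA S).measurableSet fun z hz => ?_
    have hzD := hAD S hz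
    change dOne (fun z => g z • pullOne c.u a z) z 1 Complex.I = _
    rw [dOne_smul (hg1'.differentiable one_ne_zero z) ((hpull hzD).differentiableAt one_ne_zero),
      dOne_pullOne hu2.contDiffAt ((haat hzD).differentiableAt one_ne_zero)]
    rfl
  rw [← hcongr, hst]
  refine sub_le_sub_right ?_ _
  have hyc : Continuous fun t => ‖deriv (fun τ => x (T * τ)) t‖ :=
    (hx.continuous_deriv_scale h.smooth_X.continuous).norm
  refine (le_abs_self _).trans ?_
  rw [← Real.norm_eq_abs]
  -- The end term is dominated pointwise by `(C + 1)` times the speed of the orbit plus one;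
  -- integrating the speed gives at most `P`.
  have h1 := intervalIntegral.norm_integral_le_of_norm_le (μ := volume) (zero_le_one' ℝ)
    (f := fun t : ℝ => (g (ψ (S + t * Complex.I)) • pullOne c.u a (ψ (S + t * Complex.I)))
      (fderiv ℝ ψ (S + t * Complex.I) Complex.I))
    (g := fun t => (C + 1) * (‖deriv (fun τ => x (T * τ)) t‖ + 1))
    (ae_of_all _ fun t _ => by
      change ‖g _ * a _ _‖ ≤ _
      rw [norm_mul, Real.norm_eq_abs, Real.norm_eq_abs]
      exact (mul_le_of_le_one_left (abs_nonneg _) (hg1 _)).trans (hend t))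
    (by apply Continuous.intervalIntegrable; fun_prop)
  refine h1.trans ?_
  rw [intervalIntegral.integral_const_mul, intervalIntegral.integral_add
    (hyc.intervalIntegrable _ _) (continuous_const.intervalIntegrable _ _)]
  have h2 := hrun.integral_norm_deriv_le K.knot hx h.smooth_X.continuous hP
  simp only [intervalIntegral.integral_const, sub_zero, smul_eq_mul, mul_one]
  gcongr

/-- The energy of a curve is bounded in terms of the bounds on the stable Hamiltonian structure. -/
theorem IsSetupCurve.energy_le (hε : IsCollarWidth K ε) (hc : IsSetupCurve K D H c)
    (h : IsStableHamiltonian K.M H) {C δ P B' Bl : ℝ} (hC : 0 ≤ C) (hδ : 0 < δ)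
    (hP : ∀ t, ‖deriv K.p t‖ ≤ P) (hb : HasBounds K.M H C δ) {V : Set E4} (hV : IsOpen V)
    (hpV : ∀ t, K.p t ∈ V) (huV : ∀ z, c.u z ∈ K.M → c.u z ∈ V) {α : E4 → E4 →L[ℝ] ℝ}
    (hα : IsToricPrimitive K V H.omega α) (hB' : 0 ≤ B')
    (hαp : ∀ t v, |α (K.p t) v| ≤ B' * ‖v‖)
    (hloop : ∀ j, ∀ (σ θ : ℝ → ℝ) (c' : ℝ → E4), (∀ t, DifferentiableAt ℝ σ t) →
      (∀ t, DifferentiableAt ℝ θ t) → σ 1 = σ 0 → |θ 1 - θ 0| = 1 →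
      (∀ t, HasDerivAt (fun t => K.Ψ j (σ t, circ (θ t))) (c' t) t) → Continuous c' →
      |∫ t in (0 : ℝ)..1, H.lam (K.Ψ j (σ t, circ (θ t))) (c' t)| ≤ Bl) :
    energy D H c ≤ ENNReal.ofReal ((B' + 1) * (P + 1)) + ENNReal.ofReal
      ((C + 1) * (P + 1) + m * Bl + C ^ 2 / δ * ((B' + 1) * (P + 1))) := by
  obtain ⟨A, hA, hAD, hmono, hunion, hstokes⟩ := hc.exists_exhaustion h hP
  have hae := D.ae_eventually_mem
  have hnn : ∀ᵐ z ∂(volume.restrict D.domain),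
      0 ≤ H.omega (c.u z) ![fderiv ℝ c.u z 1, fderiv ℝ c.u z Complex.I] ∧
      |dOne H.lam (c.u z) (fderiv ℝ c.u z 1) (fderiv ℝ c.u z Complex.I)|
        ≤ C ^ 2 / δ * H.omega (c.u z) ![fderiv ℝ c.u z 1, fderiv ℝ c.u z Complex.I] := by
    filter_upwards [hae] with z hz using hc.omega_density hε h hC hδ hb hz
  have hu := hc.smooth_u
  have hωE : ∃ S₁, ∀ S ≥ S₁, ∫ z in A S,
      H.omega (c.u z) ![fderiv ℝ c.u z 1, fderiv ℝ c.u z Complex.I] ≤ (B' + 1) * (P + 1) := by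
    -- With constant weight 1, Stokes' theorem computes the integral of the pullback of `dα = ω`.
    obtain ⟨S₁, hS₁⟩ := hstokes V α (fun _ => 1) B' hV hpV (fun z hz => huV z (hc.mem z hz))
      hα.contDiffOn hB' hαp contDiff_const (by simp)
    refine ⟨S₁, fun S hS => ?_⟩
    have h1 := hS₁ S hS
    rw [Finset.sum_eq_zero, sub_zero] at h1
    · refine (le_of_eq ?_).trans h1
      refine integral_congr_ae ?_
      filter_upwards [ae_restrict_of_ae_restrict_of_subset (hAD S) hae] with z hz
      have hM := hc.mem z hz.self_of_nhds
      rw [hα.dOne_eq _ hM (huV z hM) _ (hc.fderiv_mem hz 1) _ (hc.fderiv_mem hz _)]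
      simp
    · intro i _
      obtain ⟨σ, θ, hσ, hθ, hσ1, hθ1, he⟩ := hc.exists_boundary_lift i
      have hd := hc.hasDerivAt_circle i
      rw [he] at hd
      -- The lifted circle closes up in `ℝ` times the unit circle because `σ` returns to its initial
      -- value; hence the boundary term is zero.
      have h2 := hα.loop i σ (fun t => circ (θ t)) _ hσ
        (fun t => DifferentiableAt.comp (g := circ) t (hasDerivAt_circ _).differentiableAt (hθ t))
        (fun t => norm_circ _) hσ1 (by rw [hθ1, circ_add_one]) hd (hc.continuous_deriv_circle i)
      refine Eq.trans ?_ h2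
      refine intervalIntegral.integral_congr fun t _ => ?_
      simp only [one_mul]
      rw [congrFun he t]
  refine add_le_add ?_ ?_
  · exact lintegral_le_of_truncations hA hAD hmono hunion (h.continuous_omega hu)
      (hnn.mono fun z hz => hz.1) hωE
  · refine iSup₂_le fun φ hφ => ?_
    obtain ⟨hφs, hφ01, hφ'⟩ := hφ
    have hg : ContDiff ℝ ∞ fun z => φ (c.a z) := hφs.comp hc.smooth_a
    have hgd (z v : ℂ) : fderiv ℝ (fun z => φ (c.a z)) z v
        = deriv φ (c.a z) * fderiv ℝ c.a z v := by
      have h1 := (hφs.differentiable (by simp) (c.a z)).hasDerivAt.comp_hasFDerivAt z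
        (hc.smooth_a.differentiable (by simp) z).hasFDerivAt
      have h2 : fderiv ℝ (fun z => φ (c.a z)) z = _ := h1.fderiv
      rw [h2]
      simp
    have hφ1 (z : ℂ) : |φ (c.a z)| ≤ 1 :=
      abs_le.2 ⟨by linarith [(hφ01 (c.a z)).1], (hφ01 (c.a z)).2⟩
    have hden (z : ℂ) : deriv φ (c.a z) *
        (fderiv ℝ c.a z 1 * H.lam (c.u z) (fderiv ℝ c.u z Complex.I)
          - fderiv ℝ c.a z Complex.I * H.lam (c.u z) (fderiv ℝ c.u z 1))
        = fderiv ℝ (fun z => φ (c.a z)) z 1 * H.lam (c.u z) (fderiv ℝ c.u z Complex.I)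
          - fderiv ℝ (fun z => φ (c.a z)) z Complex.I * H.lam (c.u z) (fderiv ℝ c.u z 1) := by
      rw [hgd, hgd]
      ring
    have hnn' : ∀ᵐ z ∂(volume.restrict D.domain),
        0 ≤ fderiv ℝ (fun z => φ (c.a z)) z 1 * H.lam (c.u z) (fderiv ℝ c.u z Complex.I)
          - fderiv ℝ (fun z => φ (c.a z)) z Complex.I * H.lam (c.u z) (fderiv ℝ c.u z 1) := by
      filter_upwards [hae] with z hz
      rw [← hden]
      exact mul_nonneg (hφ' _) (hc.lam_density h hz)
    simp only [hden]
    refine lintegral_le_of_truncations hA hAD hmono hunion (h.continuous_lam_density hu hg) hnn' ?_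
    obtain ⟨S₁, hS₁⟩ := hstokes univ H.lam (fun z => φ (c.a z)) C isOpen_univ (fun _ => mem_univ _)
      (fun _ _ => mem_univ _) (h.smooth_lam.of_le (one_le_two.trans two_le_infty)).contDiffOn hC
      (fun t v => ((H.lam (K.p t)).le_opNorm v).trans
        (mul_le_mul_of_nonneg_right (hb.lam _ (knot_mem_M K t)) (norm_nonneg v))) hg hφ1
    obtain ⟨S₂, hS₂⟩ := hωE
    refine ⟨max S₁ S₂, fun S hS => ?_⟩
    have e1 := hS₁ S ((le_max_left _ _).trans hS)
    have e2 := hS₂ S ((le_max_right _ _).trans hS)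
    have c1 := h.continuous_lam_density hu hg
    have c2 : Continuous fun z => φ (c.a z) *
        dOne H.lam (c.u z) (fderiv ℝ c.u z 1) (fderiv ℝ c.u z Complex.I) :=
      hg.continuous.mul (h.continuous_dOne_lam hu)
    have hint {f : ℂ → ℝ} (hf : Continuous f) : IntegrableOn f (A S) :=
      hf.continuousOn.integrableOn_compact (hA S)
    rw [integral_add (hint c1) (hint c2)] at e1
    -- As `|φ| ≤ 1`, the `dλ`-term is at most the density constant times the `ω`-integral on the
    -- same truncation, already bounded above.
    have e3 : |∫ z in A S, φ (c.a z) *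
        dOne H.lam (c.u z) (fderiv ℝ c.u z 1) (fderiv ℝ c.u z Complex.I)|
        ≤ C ^ 2 / δ * ((B' + 1) * (P + 1)) := by
      have hcω : Continuous fun z => C ^ 2 / δ *
          H.omega (c.u z) ![fderiv ℝ c.u z 1, fderiv ℝ c.u z Complex.I] :=
        continuous_const.mul (h.continuous_omega hu)
      rw [← Real.norm_eq_abs]
      refine (norm_integral_le_of_norm_le (hint hcω) ?_).trans ?_
      · filter_upwards [ae_restrict_of_ae_restrict_of_subset (hAD S) hnn] with z hz
        rw [norm_mul, Real.norm_eq_abs, Real.norm_eq_abs]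
        exact (mul_le_of_le_one_left (abs_nonneg _) (hφ1 z)).trans hz.2
      · rw [integral_const_mul]
        gcongr
    have e4 : |∑ i, ∫ t in (0 : ℝ)..1, φ (c.a (D.center i + D.radius i * circ t)) *
        H.lam (c.u (D.center i + D.radius i * circ t))
          (fderiv ℝ c.u (D.center i + D.radius i * circ t)
            (2 * Real.pi * Complex.I * (D.radius i * circ t)))| ≤ m * Bl := by
      refine (Finset.abs_sum_le_sum_abs _ _).trans ?_
      have h1 : ∀ i ∈ (Finset.univ : Finset (Fin m)),
          |∫ t in (0 : ℝ)..1, φ (c.a (D.center i + D.radius i * circ t)) *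
            H.lam (c.u (D.center i + D.radius i * circ t))
              (fderiv ℝ c.u (D.center i + D.radius i * circ t)
                (2 * Real.pi * Complex.I * (D.radius i * circ t)))| ≤ Bl := by
        intro i _
        obtain ⟨σ, θ, hσ, hθ, hσ1, hθ1, he⟩ := hc.exists_boundary_lift i
        have hd := hc.hasDerivAt_circle i
        rw [he] at hd
        have h2 := hloop i σ θ _ hσ hθ hσ1 (by rw [hθ1]; simp) hd (hc.continuous_deriv_circle i)
        obtain ⟨r, hr⟩ := hc.boundary i
        -- The function `a` is constant on each boundary circle, so the weight leaves the integral
        -- and the bound for loops on the torus applies.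
        have h3 : (∫ t in (0 : ℝ)..1, φ (c.a (D.center i + D.radius i * circ t)) *
            H.lam (c.u (D.center i + D.radius i * circ t))
              (fderiv ℝ c.u (D.center i + D.radius i * circ t)
                (2 * Real.pi * Complex.I * (D.radius i * circ t))))
            = φ r * ∫ t in (0 : ℝ)..1, H.lam (K.Ψ i (σ t, circ (θ t)))
              (fderiv ℝ c.u (D.center i + D.radius i * circ t)
                (2 * Real.pi * Complex.I * (D.radius i * circ t))) := by
          rw [← intervalIntegral.integral_const_mul]
          refine intervalIntegral.integral_congr fun t _ => ?_
          rw [(hr _ (circle_mem_sphere D i t)).1, ← congrFun he t]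
        rw [h3, abs_mul]
        exact (mul_le_of_le_one_left (abs_nonneg _)
          (abs_le.2 ⟨by linarith [(hφ01 r).1], (hφ01 r).2⟩)).trans h2
      refine (Finset.sum_le_sum h1).trans ?_
      simp
    linarith [(abs_le.1 e3).1, (abs_le.1 e4).1]

/-- Convergence supplies common constants only from some index on. The earlier curves are finitely
many and have finite energy individually, so their sum can be added to the bound. -/
theorem exists_energy_bound (K : Configuration m) (H : ℕ → HamData) (Hlim : HamData)
    (hH : ∀ k, IsStableHamiltonian K.M (H k)) (hlim : IsStableHamiltonian K.M Hlim)
    (hconv : HamConverges K.M H Hlim) (hsetup : ∀ k, SatisfiesSetup K (H k))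
    (D : Disks m) (c : ℕ → CurveData) (hc : ∀ k, IsSetupCurve K D (H k) (c k)) :
    ∃ C : ℝ, 0 < C ∧ ∀ k, energy D (H k) (c k) < ENNReal.ofReal C := by
  obtain ⟨ε, hε⟩ := exists_collarWidth K
  obtain ⟨P, -, hP⟩ := K.knot.exists_bound_deriv
  obtain ⟨V, B, hV, hB, huV, hpV, hprim⟩ := exists_toricPrimitives hε fun k => (hc k).smooth_u
  obtain ⟨Bl, -, hBl⟩ := exists_bound_lam_loop hε
  obtain ⟨C, δ, hC, hδ, hbounds⟩ := hconv.eventually_hasBounds hε.isCompact_M hlim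
  obtain ⟨N, hN⟩ := eventually_atTop.1 hbounds
  obtain ⟨E, hE, hEk⟩ : ∃ E : ℝ≥0∞, E < ⊤ ∧ ∀ k ≥ N, energy D (H k) (c k) ≤ E := by
    refine ⟨ENNReal.ofReal ((B * C + 1) * (P + 1)) + ENNReal.ofReal
      ((C + 1) * (P + 1) + m * (C * Bl) + C ^ 2 / δ * ((B * C + 1) * (P + 1))),
      ENNReal.add_lt_top.2 ⟨ENNReal.ofReal_lt_top, ENNReal.ofReal_lt_top⟩, fun k hk => ?_⟩
    have hb := hN k hk
    obtain ⟨α, hα, hαp⟩ := hprim _ ((hH k).isToricForm hε (hsetup k))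
    exact (hc k).energy_le hε (hH k) hC hδ hP hb hV hpV (huV k) hα (mul_nonneg hB hC)
      (hαp C hC hb.omega) (hBl _ (hH k) (hsetup k) C hb.lam)
  have htop : E + ∑ k ∈ Finset.range N, energy D (H k) (c k) < ⊤ :=
    ENNReal.add_lt_top.2 ⟨hE, ENNReal.sum_lt_top.2 fun k _ => (hc k).finite_energy⟩
  -- Adding 1 makes both positivity and the strict inequality automatic.
  refine ⟨(E + ∑ k ∈ Finset.range N, energy D (H k) (c k)).toReal + 1, by positivity, fun k => ?_⟩
  rw [ENNReal.lt_ofReal_iff_toReal_lt (hc k).finite_energy.ne]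
  refine lt_of_le_of_lt (ENNReal.toReal_mono htop.ne ?_) (lt_add_one _)
  rcases le_or_gt N k with hk | hk
  · exact (hEk k hk).trans le_self_add
  · exact (Finset.single_le_sum (f := fun k => energy D (H k) (c k)) (fun _ _ => zero_le)
      (Finset.mem_range.2 hk)).trans le_add_self

end

end HolCurve

end

theorem proposition3p11 {m : ℕ} (K : HolCurve.Configuration m)
    (H : ℕ → HolCurve.HamData) (Hlim : HolCurve.HamData)
    (hH : ∀ k, HolCurve.IsStableHamiltonian K.M (H k))
    (hlim : HolCurve.IsStableHamiltonian K.M Hlim)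
    (hconv : HolCurve.HamConverges K.M H Hlim)
    (hsetup : ∀ k, HolCurve.SatisfiesSetup K (H k))
    (D : HolCurve.Disks m) (c : ℕ → HolCurve.CurveData)
    (hc : ∀ k, HolCurve.IsSetupCurve K D (H k) (c k)) :
    ∃ C : ℝ, 0 < C ∧ ∀ k, HolCurve.energy D (H k) (c k) < ENNReal.ofReal C := by
  exact HolCurve.exists_energy_bound K H Hlim hH hlim hconv hsetup D c hc
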